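/- **Corollary (Complexity of emptiness).** An alternating parity tree automaton $A=(\Sigma,Q,q_0,\delta,\Omega)$ has a finite alphabet, finitely many states, each of which is local-existential, local-universal, modal-existential or modal-universal, a transition function $\delta:Q\times\Sigma\to\mathcal P(Q)$ with exactly one successor $|\delta(q,a)|=1$ at every modal state $q$, and, for each letter, no loop through local states only. It reads pointed Kripke structures $(W,w_0,R,L)$ with $L:W\to\Sigma$ in which every world has an $R$-successor, and it accepts such a structure if player $\Diamond$ wins, from $(w_0,q_0)$, the max-parity game on $W\times Q$ with priorities $\Omega(q)$ in which $\Diamond$ owns the existential and $\Box$ the universal states, local states move to $(w,q')$ and modal states to $(w',q')$ with $q'\in\delta(q,L(w))$ and $w'\in R(w)$ (a player who cannot move loses). $A$ is empty if it accepts no structure. The rank of an automaton or a game is the number of priorities that occur in it. Time is counted on a unit-cost random access machine (natural-number cells, indexed arrays, addition, subtraction, halving). Let a history-determinization procedure be given that turns every nondeterministic parity word automaton with $l$ letters, $n$ states and rank $k$, in time $\tau(l,n,k)$, into an equivalent history-deterministic parity word automaton with at most $S_{HD}(n,k)$ states and rank at most $R_{HD}(n,k)$. Let a program be given that, for every parity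 game with at most $v$ nodes and at most $d$ priorities, decides within time $\mathrm{ParityTime}(v,d)$ who wins from a given node. Then there are a program and a constant $c$ such that for every alternating parity tree automaton $A$ with alphabet size $m$, $n$ states and rank $k$ the following holds, where $N=(m+1)\cdot 2^n\cdot S_{HD}(n,k)$. For some $l\le m(n+1)^2$, the program decides whether $A$ is empty in time at most $$\tau(l,n,k)+\mathrm{ParityTime}\bigl((n+1)\cdot N,\;R_{HD}(n,k)\bigr)+c\cdot N^c .$$ If moreover all automata produced by the history-determinization procedure are deterministic, then it does so in time at most $$\tau(l,n,k)+\mathrm{ParityTime}\bigl(N,\;R_{HD}(n,k)\bigr)+c\cdot N^c .$$ -/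

import Mathlib

open Filter

noncomputable section

namespace TreeEmptiness

/-! ### Parity games -/

/-- The max-parity condition: some even number occurs infinitely often, and from some point on
nothing larger occurs. (All priority functions used below have finite range.) -/
def ParityAccepting (f : ℕ → ℕ) : Prop :=
  ∃ p, Even p ∧ (∃ᶠ i in atTop, f i = p) ∧ ∀ᶠ i in atTop, f i ≤ p

/-- A parity game with node set `V`. The nodes satisfying `dia` belong to player Diamond,
the others to player Box. -/
structure ParityGame (V : Type) where
  dia : V → Prop
  edge : V → V → Prop
  prio : V → ℕ

/-- The first `i` entries of a sequence. -/
def pre {X : Type} (x : ℕ → X) (i : ℕ) : List X := (List.range i).map x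

/-- The `j`-th move of `π` is a move of the game that follows the Diamond-strategy `σ`. A strategy
maps the history, including the current node, to the next node. -/
def ParityGame.Follows {V : Type} (G : ParityGame V) (σ : List V → V) (π : ℕ → V) (j : ℕ) : Prop :=
  G.edge (π j) (π (j + 1)) ∧ (G.dia (π j) → π (j + 1) = σ (pre π (j + 1)))

/-- Player Diamond wins from `v`: she has a strategy that always provides a legal move when it is
her turn and all of whose infinite plays satisfy the parity condition. A player who cannot move
loses. -/
def ParityGame.Wins {V : Type} (G : ParityGame V) (v : V) : Prop :=
  ∃ σ : List V → V,
    (∀ (π : ℕ → V) (i : ℕ), π 0 = v → (∀ j < i, G.Follows σ π j) → G.dia (π i) →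
      G.edge (π i) (σ (pre π (i + 1)))) ∧
    (∀ π : ℕ → V, π 0 = v → (∀ j, G.Follows σ π j) → ParityAccepting (fun i => G.prio (π i)))

/-- The number of priorities of a game. -/
def ParityGame.rank {V : Type} (G : ParityGame V) : ℕ := (Set.range G.prio).ncard

/-! ### Kripke structures and alternating parity tree automata -/

/-- A pointed Kripke structure whose worlds are labelled with letters from `α` and in which every
world has a successor. -/
structure Kripke (α : Type) where
  W : Type
  root : W
  R : W → W → Prop
  label : W → α
  total : ∀ w, ∃ w', R w w'

/-- States are local-existential, local-universal, modal-existential or modal-universal. -/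
inductive StateKind
  | localEx
  | localUniv
  | modalEx
  | modalUniv

def StateKind.IsLocal (x : StateKind) : Prop := x = .localEx ∨ x = .localUniv

def StateKind.IsModal (x : StateKind) : Prop := x = .modalEx ∨ x = .modalUniv

/-- Alternating parity tree automata with alphabet `α` and state set `Q`. -/
structure APT (α Q : Type) where
  init : Q
  kind : Q → StateKind
  δ : Q → α → Set Q
  prio : Q → ℕ
  modal_single : ∀ q a, (kind q).IsModal → ∃ q', δ q a = {q'}
  no_local_loop : ∀ a q, ¬ Relation.TransGen
    (fun p p' => (kind p).IsLocal ∧ (kind p').IsLocal ∧ p' ∈ δ p a) q q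

/-- The acceptance game of an automaton on a Kripke structure. -/
def APT.acceptanceGame {α Q : Type} (A : APT α Q) (K : Kripke α) : ParityGame (K.W × Q) where
  dia v := A.kind v.2 = .localEx ∨ A.kind v.2 = .modalEx
  edge v v' := v'.2 ∈ A.δ v.2 (K.label v.1) ∧
    (((A.kind v.2).IsLocal ∧ v'.1 = v.1) ∨ ((A.kind v.2).IsModal ∧ K.R v.1 v'.1))
  prio v := A.prio v.2

/-- The automaton accepts some Kripke structure. -/
def APT.IsNonempty {α Q : Type} (A : APT α Q) : Prop :=
  ∃ K : Kripke α, (A.acceptanceGame K).Wins (K.root, A.init)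

/-- The number of priorities of a tree automaton. -/
def APT.rank {α Q : Type} (A : APT α Q) : ℕ := (Set.range A.prio).ncard

/-! ### Parity word automata -/

/-- Nondeterministic parity word automata with alphabet `α` and state set `Q`. -/
structure NPW (α Q : Type) where
  init : Q
  δ : Q → α → Set Q
  prio : Q → ℕ

def NPW.IsRun {α Q : Type} (N : NPW α Q) (w : ℕ → α) (r : ℕ → Q) : Prop :=
  r 0 = N.init ∧ ∀ i, r (i + 1) ∈ N.δ (r i) (w i)

def NPW.language {α Q : Type} (N : NPW α Q) : Set (ℕ → α) :=
  {w | ∃ r, N.IsRun w r ∧ ParityAccepting (fun i => N.prio (r i))}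

/-- A resolver: after reading a finite word it is in the given state, and it follows the transition
relation. -/
def NPW.IsResolver {α Q : Type} (N : NPW α Q) (σ : List α → Q) : Prop :=
  σ [] = N.init ∧ ∀ w a, σ (w ++ [a]) ∈ N.δ (σ w) a

def NPW.HistoryDeterministic {α Q : Type} (N : NPW α Q) : Prop :=
  ∃ σ, N.IsResolver σ ∧
    ∀ w, w ∈ N.language ↔ ParityAccepting (fun i => N.prio (σ (pre w i)))

def NPW.Deterministic {α Q : Type} (N : NPW α Q) : Prop :=
  ∀ q a, (N.δ q a).Subsingleton

/-- The number of priorities of a word automaton. -/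
def NPW.rank {α Q : Type} (N : NPW α Q) : ℕ := (Set.range N.prio).ncard

/-! ### A random access machine

Programs of a unit-cost random access machine in structured form. The memory consists of
arrays, each with three indices; every cell holds a natural number. The array accessed by an
instruction is fixed by the program, its indices are computed. The arithmetic operations are
addition, truncated subtraction and halving; there is no multiplication. -/

/-- Array name and three indices, to contents. -/
abbrev Store : Type := ℕ → ℕ → ℕ → ℕ → ℕ

inductive Expr
  | const (c : ℕ)
  | get (arr : ℕ) (i j k : Expr)
  | plus (e f : Expr)
  | minus (e f : Expr)
  | half (e : Expr)

def Expr.eval (st : Store) : Expr → ℕ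
  | .const c => c
  | .get arr i j k => st arr (i.eval st) (j.eval st) (k.eval st)
  | .plus e f => e.eval st + f.eval st
  | .minus e f => e.eval st - f.eval st
  | .half e => e.eval st / 2

/-- The number of steps needed to evaluate an expression: one for every operation. -/
def Expr.cost : Expr → ℕ
  | .const _ => 1
  | .get _ i j k => i.cost + j.cost + k.cost + 1
  | .plus e f => e.cost + f.cost + 1
  | .minus e f => e.cost + f.cost + 1
  | .half e => e.cost + 1

inductive Prog
  | skip
  | assign (arr : ℕ) (i j k e : Expr)
  | seq (p q : Prog)
  | cond (e : Expr) (p q : Prog)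
  | loop (e : Expr) (p : Prog)

open Classical in
/-- Overwrite one memory cell. -/
def Store.write (st : Store) (arr i j k x : ℕ) : Store :=
  fun arr' i' j' k' => if arr' = arr ∧ i' = i ∧ j' = j ∧ k' = k then x else st arr' i' j' k'

/-- `Run p st t st'`: the program `p`, started in memory `st`, halts after exactly `t` steps in
memory `st'`. Tests of `cond` and `loop` succeed if the value is nonzero. -/
inductive Run : Prog → Store → ℕ → Store → Prop
  | skip (st : Store) : Run .skip st 1 st
  | assign (arr : ℕ) (i j k e : Expr) (st : Store) :
      Run (.assign arr i j k e) st (i.cost + j.cost + k.cost + e.cost + 1)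
        (st.write arr (i.eval st) (j.eval st) (k.eval st) (e.eval st))
  | seq {p q : Prog} {st st' st'' : Store} {t t' : ℕ} :
      Run p st t st' → Run q st' t' st'' → Run (.seq p q) st (t + t') st''
  | condTrue {e : Expr} {p q : Prog} {st st' : Store} {t : ℕ} :
      e.eval st ≠ 0 → Run p st t st' → Run (.cond e p q) st (e.cost + 1 + t) st'
  | condFalse {e : Expr} {p q : Prog} {st st' : Store} {t : ℕ} :
      e.eval st = 0 → Run q st t st' → Run (.cond e p q) st (e.cost + 1 + t) st'
  | loopTrue {e : Expr} {p : Prog} {st st' st'' : Store} {t t' : ℕ} :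
      e.eval st ≠ 0 → Run p st t st' → Run (.loop e p) st' t' st'' →
        Run (.loop e p) st (e.cost + 1 + t + t') st''
  | loopFalse {e : Expr} {p : Prog} {st : Store} :
      e.eval st = 0 → Run (.loop e p) st (e.cost + 1) st

/-- Started in `st`, the program halts within `T` steps in a memory that satisfies `post`. -/
def HaltsWithin (p : Prog) (st : Store) (T : ℕ) (post : Store → Prop) : Prop :=
  ∃ t st', t ≤ T ∧ Run p st t st' ∧ post st'

open Classical in
/-- Truth values as numbers. -/
def bit (P : Prop) : ℕ := if P then 1 else 0

/-- The answer of a decision procedure stands in the first cell of array `0`. -/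
def Answers (P : Prop) (st : Store) : Prop := st 0 0 0 0 = bit P

/-! ### Inputs and outputs of programs

States, letters and nodes are numbered from `0`. Array `0` holds the sizes and the initial state
or node. In an input all cells without a meaning are zero. -/

/-- A value at an index below `n`, zero at the other indices. -/
def tab {n : ℕ} (f : Fin n → ℕ) (i : ℕ) : ℕ := if h : i < n then f ⟨i, h⟩ else 0

/-- A cell whose index is used in its first component only. -/
def cell1 (f : ℕ → ℕ) (i j k : ℕ) : ℕ := if j = 0 ∧ k = 0 then f i else 0

/-- Three numbers, at the indices `0`, `1` and `2`. -/
def header (x y z : ℕ) : ℕ → ℕ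
  | 0 => x
  | 1 => y
  | 2 => z
  | _ => 0

def StateKind.code : StateKind → ℕ
  | .localEx => 0
  | .localUniv => 1
  | .modalEx => 2
  | .modalUniv => 3

def inputAPT {m n : ℕ} (A : APT (Fin m) (Fin n)) : Store
  | 0 => cell1 (header m n A.init)
  | 1 => cell1 (tab fun q => (A.kind q).code)
  | 2 => fun i j k => tab (fun q => tab (fun a => tab (fun q' => bit (q' ∈ A.δ q a)) k) j) i
  | 3 => cell1 (tab A.prio)
  | _ => fun _ _ _ => 0

def inputNPW {l n : ℕ} (N : NPW (Fin l) (Fin n)) : Store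
  | 0 => cell1 (header l n N.init)
  | 1 => fun i j k => tab (fun q => tab (fun a => tab (fun q' => bit (q' ∈ N.δ q a)) k) j) i
  | 2 => cell1 (tab N.prio)
  | _ => fun _ _ _ => 0

def inputGame {v : ℕ} (G : ParityGame (Fin v)) (v₀ : Fin v) : Store
  | 0 => cell1 (header v v₀ 0)
  | 1 => fun i j k => if k = 0 then tab (fun u => tab (fun u' => bit (G.edge u u')) j) i else 0
  | 2 => cell1 (tab fun u => bit (G.dia u))
  | 3 => cell1 (tab G.prio)
  | _ => fun _ _ _ => 0

/-- The memory `st` describes the word automaton `N`; the other cells may hold anything. -/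
def OutputsNPW {l n : ℕ} (N : NPW (Fin l) (Fin n)) (st : Store) : Prop :=
  st 0 0 0 0 = l ∧ st 0 1 0 0 = n ∧ st 0 2 0 0 = N.init ∧
    (∀ (q : Fin n) (a : Fin l) (q' : Fin n), st 1 q a q' = bit (q' ∈ N.δ q a)) ∧
    ∀ q : Fin n, st 2 q 0 0 = N.prio q

/-- `p` solves parity games, and `time v d` bounds its running time on all games with at most `v`
nodes and at most `d` priorities. -/
def SolvesParityGames (p : Prog) (time : ℕ → ℕ → ℕ) : Prop :=
  ∀ (v d v' : ℕ) (G : ParityGame (Fin v')) (v₀ : Fin v'), v' ≤ v → G.rank ≤ d →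
    HaltsWithin p (inputGame G v₀) (time v d) (Answers (G.Wins v₀))

/-- `p` turns every parity word automaton with `l` letters, `n` states and rank `k` into an
equivalent history-deterministic one with at most `S n k` states and rank at most `R n k`, within
`time l n k` steps. -/
def HistoryDeterminizes (p : Prog) (S R : ℕ → ℕ → ℕ) (time : ℕ → ℕ → ℕ → ℕ) : Prop :=
  ∀ (l n : ℕ) (N : NPW (Fin l) (Fin n)),
    HaltsWithin p (inputNPW N) (time l n N.rank) fun st =>
      ∃ (s : ℕ) (H : NPW (Fin l) (Fin s)), OutputsNPW H st ∧ H.HistoryDeterministic ∧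
        H.language = N.language ∧ s ≤ S n N.rank ∧ H.rank ≤ R n N.rank

/-- All word automata that `p` outputs are deterministic. -/
def OutputsDeterministic (p : Prog) : Prop :=
  ∀ (l n : ℕ) (N : NPW (Fin l) (Fin n)) (t : ℕ) (st : Store), Run p (inputNPW N) t st →
    ∀ (s : ℕ) (H : NPW (Fin l) (Fin s)), OutputsNPW H st → H.Deterministic

/-- `p` decides emptiness of the tree automaton `A` within `T` steps. -/
def DecidesEmptinessWithin {m n : ℕ} (p : Prog) (A : APT (Fin m) (Fin n)) (T : ℕ) : Prop :=
  HaltsWithin p (inputAPT A) T (Answers (¬ A.IsNonempty))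

end TreeEmptiness

end

open TreeEmptiness

/-! Emptiness of `A` is reduced to a finite parity game by way of an intermediate object, the
`Tableau`. A trace of `A` is a sequence of states that some play of the acceptance game may visit.
One letter (label, active state, Diamond's choice) describes a step taken by a whole set of states
at once: a picked local state is replaced by its chosen successor or by all its successors, or, when
all states are modal, the modal-universal states and at most one modal-existential state move on to
a new world. The word automaton `APT.tracker` guesses a trace along a word of such letters. Its
priorities are those of `A` raised by one, so it accepts exactly the words along which some trace
violates the parity condition. A tableau is a system of sets of states that evolve by letters, none
of whose infinite branches spells a word of that language.

A structure accepted by `A` yields a tableau (`exists_tableau_of_isNonempty`). A set of states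
forgets how its members were reached, so Diamond's strategy may depend on the world and the state
only. This is why winning strategies are first made positional
(`ParityGame.Wins.exists_positional`), by choosing at every node a memory state of least signature.
Conversely (`Tableau.isNonempty`) the nodes of a tableau serve as worlds and its modal steps as
accessibility relation. Both directions use that a phase of local steps ends, a multiset descent
that rests on the absence of local loops (`APT.wellFounded_localDescent`).

In the emptiness game Diamond builds a tableau while Box picks the branch and the transitions of a
history-deterministic automaton `H` equivalent to the tracker; the priorities of `H` are again
raised by one, which complements them. If Diamond wins, she wins in particular when Box follows the
resolver of `H`; then every word spelled is rejected along the resolver, hence outside the language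
(`IsEmptinessGame.exists_tableau`). If there is a tableau, no run of `H` on one of its words is
accepting, so she wins however Box moves (`IsEmptinessGame.wins`).

A node consists of a label or none, a set of states, a state of `H` and a pending choice of Diamond,
which gives the factors `m + 1`, `2 ^ n`, `s` and `n + 1`. The pending choice separates Diamond's
move from Box's move in `H`. If `H` is deterministic, Box has nothing to resolve, the two moves are
merged, and the factor `n + 1` disappears.

The program writes the tracker, runs the determinizer, writes the game, runs the solver and negates
the answer. The two given programs work on renamed, disjoint families of arrays. What is written in
between is specified by terms with bounded iteration, whose compiled form is correct
(`Tm.compile_run`, `execAll_run`) and costs polynomially much in a bound on the loop lengths. -/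

namespace TreeEmptiness

/-! ### Sequences -/

/-- A reparametrization that repeats indices but skips none. -/
structure Stutter (φ : ℕ → ℕ) : Prop where
  zero : φ 0 = 0
  succ : ∀ j, φ (j + 1) = φ j ∨ φ (j + 1) = φ j + 1
  unbounded : ∀ i, ∃ j, i ≤ φ j

theorem Stutter.monotone {φ : ℕ → ℕ} (h : Stutter φ) : Monotone φ :=
  monotone_nat_of_le_succ fun j => by rcases h.succ j with h | h <;> omega

/-- A discrete intermediate value argument: at the first index where `φ` reaches `i + 1` it cannot
have jumped over that value. -/
theorem Stutter.surjective {φ : ℕ → ℕ} (h : Stutter φ) (i : ℕ) : ∃ j, φ j = i := by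
  induction i with
  | zero => exact ⟨0, h.zero⟩
  | succ i ih =>
    classical
    have hex := h.unbounded (i + 1)
    obtain ⟨k, hk⟩ : ∃ k, Nat.find hex = k + 1 := by
      refine Nat.exists_eq_succ_of_ne_zero fun h0 => ?_
      have := Nat.find_spec hex
      rw [h0, h.zero] at this
      omega
    have h1 := Nat.find_spec hex
    have h2 := Nat.find_min hex (m := k) (by omega)
    rw [hk] at h1
    exact ⟨k + 1, by rcases h.succ k with h | h <;> omega⟩

/-- Monotone and unbounded gives one inequality; for the other, every large `b` is hit by some `j`,
and monotonicity handles a hit that lies before the threshold. "Infinitely often" and "eventually"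
therefore transfer along `φ`, and so does the parity condition. -/
theorem Stutter.map_atTop {φ : ℕ → ℕ} (h : Stutter φ) : map φ atTop = atTop := by
  apply le_antisymm
  · exact tendsto_atTop_atTop_of_monotone h.monotone h.unbounded
  · intro s hs
    obtain ⟨a, ha⟩ := mem_atTop_sets.1 (mem_map.1 hs)
    refine mem_atTop_sets.2 ⟨φ a, fun b hb => ?_⟩
    obtain ⟨j, rfl⟩ := h.surjective b
    rcases le_total a j with h' | h'
    · exact ha j h'
    · rw [le_antisymm (h.monotone h') hb]
      exact ha a le_rfl

theorem Stutter.parityAccepting_iff {φ : ℕ → ℕ} (h : Stutter φ) (f : ℕ → ℕ) :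
    ParityAccepting (fun j => f (φ j)) ↔ ParityAccepting f := by
  have h1 : ∀ P : ℕ → Prop, (∃ᶠ j in atTop, P (φ j)) ↔ ∃ᶠ i in atTop, P i := fun P => by
    rw [← frequently_map (P := P), h.map_atTop]
  have h2 : ∀ P : ℕ → Prop, (∀ᶠ j in atTop, P (φ j)) ↔ ∀ᶠ i in atTop, P i := fun P => by
    rw [← eventually_map (P := P), h.map_atTop]
  exact exists_congr fun p => and_congr_right fun _ => and_congr (h1 (f · = p)) (h2 (f · ≤ p))

theorem parityAccepting_add_iff (k : ℕ) (f : ℕ → ℕ) :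
    ParityAccepting (fun j => f (j + k)) ↔ ParityAccepting f := by
  have h1 : ∀ P : ℕ → Prop, (∃ᶠ j in atTop, P (j + k)) ↔ ∃ᶠ i in atTop, P i := fun P => by
    rw [← frequently_map (P := P) (m := (· + k)), map_add_atTop_eq_nat]
  have h2 : ∀ P : ℕ → Prop, (∀ᶠ j in atTop, P (j + k)) ↔ ∀ᶠ i in atTop, P i := fun P => by
    rw [← eventually_map (P := P) (m := (· + k)), map_add_atTop_eq_nat]
  exact exists_congr fun p => and_congr_right fun _ => and_congr (h1 (f · = p)) (h2 (f · ≤ p))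

/-- The largest value that a bounded sequence takes infinitely often. -/
theorem exists_limsup_of_bounded {f : ℕ → ℕ} {D : ℕ} (hf : ∀ i, f i < D) :
    ∃ p, (∃ᶠ i in atTop, f i = p) ∧ ∀ᶠ i in atTop, f i ≤ p := by
  induction D with
  | zero => exact absurd (hf 0) (by omega)
  | succ D _ =>
    have key : ∀ k, (∀ᶠ i in atTop, f i ≤ k) →
        ∃ p, (∃ᶠ i in atTop, f i = p) ∧ ∀ᶠ i in atTop, f i ≤ p := by
      intro k
      induction k with
      | zero =>
        intro h
        exact ⟨0, (h.mono fun i hi => Nat.le_zero.1 hi).frequently, h⟩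
      | succ k ih =>
        intro h
        by_cases hk : ∃ᶠ i in atTop, f i = k + 1
        · exact ⟨k + 1, hk, h⟩
        · refine ih ?_
          filter_upwards [h, not_frequently.1 hk] with i h1 h2
          omega
    exact key D (Eventually.of_forall fun i => Nat.lt_succ_iff.1 (hf i))

theorem limsup_unique {f : ℕ → ℕ} {p p' : ℕ} (h1 : ∃ᶠ i in atTop, f i = p)
    (h2 : ∀ᶠ i in atTop, f i ≤ p) (h1' : ∃ᶠ i in atTop, f i = p')
    (h2' : ∀ᶠ i in atTop, f i ≤ p') : p = p' := by
  obtain ⟨i, hi, hi'⟩ := (h1.and_eventually h2').exists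
  obtain ⟨j, hj, hj'⟩ := (h1'.and_eventually h2).exists
  omega

/-- The shift changes the parity of the largest value taken infinitely often. The bound ensures that
there is such a value; an unbounded sequence would fail the condition both before and after the
shift. -/
theorem parityAccepting_succ_iff {f : ℕ → ℕ} {D : ℕ} (hf : ∀ i, f i < D) :
    ParityAccepting (fun i => f i + 1) ↔ ¬ ParityAccepting f := by
  obtain ⟨p, hp, hp'⟩ := exists_limsup_of_bounded hf
  constructor
  · rintro ⟨q, hq, h1, h2⟩ ⟨q', hq', h1', h2'⟩
    obtain rfl := limsup_unique hp hp' h1' h2'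
    have := limsup_unique (f := fun i => f i + 1) h1 h2
      (h1'.mono fun i hi => by rw [hi]) (h2'.mono fun i hi => by omega)
    subst this
    exact absurd hq (by simpa [Nat.even_add_one] using hq')
  · intro h
    refine ⟨p + 1, ?_, hp.mono fun i hi => congrArg (· + 1) hi,
      hp'.mono fun i hi => Nat.succ_le_succ hi⟩
    rw [Nat.even_add_one]
    exact fun he => h ⟨p, he, hp, hp'⟩

theorem exists_path_of_reflTransGen {Y : Type*} {S : Y → Y → Prop} {a b : Y}
    (h : Relation.ReflTransGen S a b) :
    ∃ (d : ℕ) (f : ℕ → Y), f 0 = a ∧ f d = b ∧ ∀ e < d, S (f e) (f (e + 1)) := by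
  induction h with
  | refl => exact ⟨0, fun _ => a, rfl, rfl, fun e he => absurd he (by omega)⟩
  | @tail b c _ hbc ih =>
    obtain ⟨d, f, h0, hd, hs⟩ := ih
    refine ⟨d + 1, fun e => if e ≤ d then f e else c, by simp [h0], by simp, fun e he => ?_⟩
    rcases Nat.lt_succ_iff_lt_or_eq.1 he with h | rfl
    · have h1 : e ≤ d := h.le
      have h2 : e + 1 ≤ d := h
      simpa [h1, h2] using hs e h
    · simpa [hd] using hbc

/-- A sequence whose consecutive members are joined by finite paths can be refined to a sequence
of single steps. -/
theorem exists_refinement {Y : Type*} (z : ℕ → Y) (S T : ℕ → Y → Y → Prop)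
    (h : ∀ i, ∃ x, Relation.ReflTransGen (S i) (z i) x ∧ T i x (z (i + 1))) :
    ∃ (y : ℕ → Y) (φ : ℕ → ℕ), Stutter φ ∧ y 0 = z 0 ∧
      ∀ j, Relation.ReflTransGen (S (φ j)) (z (φ j)) (y j) ∧
        ((S (φ j) (y j) (y (j + 1)) ∧ φ (j + 1) = φ j) ∨
          (T (φ j) (y j) (y (j + 1)) ∧ φ (j + 1) = φ j + 1)) := by
  have h' : ∀ i, ∃ (d : ℕ) (f : ℕ → Y), f 0 = z i ∧ (∀ e < d, S i (f e) (f (e + 1))) ∧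
      T i (f d) (z (i + 1)) := by
    intro i
    obtain ⟨x, hx, ht⟩ := h i
    obtain ⟨d, f, h0, hd, hs⟩ := exists_path_of_reflTransGen hx
    exact ⟨d, f, h0, hs, by rw [hd]; exact ht⟩
  choose d f h0 hS hT using h'
  -- The pair `(i, e)` points to position `e` on the `i`-th path; past the end `d i` the pointer
  -- moves to the start of the next path by a step of `T`.
  let next : ℕ × ℕ → ℕ × ℕ := fun p => if p.2 < d p.1 then (p.1, p.2 + 1) else (p.1 + 1, 0)
  let s : ℕ → ℕ × ℕ := fun j => next^[j] (0, 0)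
  have hs : ∀ j, s (j + 1) = next (s j) := fun j => Function.iterate_succ_apply' next j (0, 0)
  have hle : ∀ j, (s j).2 ≤ d (s j).1 := by
    intro j
    induction j with
    | zero => exact Nat.zero_le _
    | succ j ih =>
      rw [hs]
      by_cases hlt : (s j).2 < d (s j).1
      · simp only [next, hlt, if_true]
        omega
      · simp [next, hlt]
  have hreach : ∀ j, Relation.ReflTransGen (S (s j).1) (z (s j).1) (f (s j).1 (s j).2) := by
    intro j
    have : ∀ e ≤ d (s j).1, Relation.ReflTransGen (S (s j).1) (z (s j).1) (f (s j).1 e) := by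
      intro e
      induction e with
      | zero => intro _; rw [h0]
      | succ e ih => intro he; exact (ih (by omega)).tail (hS _ _ (by omega))
    exact this _ (hle j)
  have hnext : ∀ i, ∃ j, s j = (i, 0) := by
    intro i
    induction i with
    | zero => exact ⟨0, rfl⟩
    | succ i ih =>
      obtain ⟨j, hj⟩ := ih
      have : ∀ e ≤ d i, s (j + e) = (i, e) := by
        intro e
        induction e with
        | zero => intro _; exact hj
        | succ e ih =>
          intro he
          have hlt : e < d i := he
          rw [← add_assoc, hs, ih (by omega)]
          simp [next, hlt]
      refine ⟨j + d i + 1, ?_⟩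
      rw [hs, this _ le_rfl]
      simp [next]
  refine ⟨fun j => f (s j).1 (s j).2, fun j => (s j).1, ⟨rfl, ?_, ?_⟩, h0 0, fun j => ⟨hreach j, ?_⟩⟩
  · intro j
    rw [hs]
    by_cases hlt : (s j).2 < d (s j).1 <;> simp [next, hlt]
  · intro i
    obtain ⟨j, hj⟩ := hnext i
    exact ⟨j, by rw [hj]⟩
  · simp only [hs]
    by_cases hlt : (s j).2 < d (s j).1
    · left
      simp only [next, hlt, if_true]
      exact ⟨hS _ _ hlt, trivial⟩
    · right
      have : (s j).2 = d (s j).1 := le_antisymm (hle j) (not_lt.1 hlt)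
      simp only [next, hlt, if_false, h0]
      exact ⟨this ▸ hT _, trivial⟩

/-- Removing from a sequence the steps at which nothing changes. -/
theorem exists_contraction {X : Type*} (x : ℕ → X) (tick : ℕ → Prop)
    (hinf : ∀ i, ∃ j, i ≤ j ∧ tick j) (hst : ∀ i, ¬ tick i → x (i + 1) = x i) :
    ∃ ψ φ : ℕ → ℕ, Stutter φ ∧ (∀ j, tick (ψ j)) ∧ x (ψ 0) = x 0 ∧
      (∀ j, x (ψ (j + 1)) = x (ψ j + 1)) ∧ ∀ i, x i = x (ψ (φ i)) := by
  classical
  have hinf' : {i | tick i}.Infinite := by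
    refine Set.infinite_of_forall_exists_gt fun i => ?_
    obtain ⟨j, hj, ht⟩ := hinf (i + 1)
    exact ⟨j, ht, by omega⟩
  have hconst : ∀ i k, (∀ j, i ≤ j → j < i + k → ¬ tick j) → x (i + k) = x i := by
    intro i k
    induction k with
    | zero => intro _; rfl
    | succ k ih =>
      intro h
      rw [← add_assoc, hst _ (h _ (by omega) (by omega)), ih fun j h1 h2 => h j h1 (by omega)]
  -- The first tick at or after `i` has number `count tick i`; nothing changes before it.
  have hcount : ∀ i, x (Nat.nth tick (Nat.count tick i)) = x i := by
    intro i
    have hle : i ≤ Nat.nth tick (Nat.count tick i) := Nat.le_nth_count hinf' i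
    obtain ⟨k, hk⟩ := Nat.exists_eq_add_of_le hle
    rw [hk]
    refine hconst i k fun j h1 h2 ht => ?_
    rw [← hk] at h2
    have h3 : Nat.count tick j < Nat.count tick i := by
      rw [← Nat.nth_count ht] at h2
      exact (Nat.nth_lt_nth hinf').1 h2
    exact absurd (Nat.count_monotone tick h1) (by omega)
  refine ⟨Nat.nth tick, Nat.count tick, ⟨Nat.count_zero _, fun j => ?_, fun i => ?_⟩,
    fun j => Nat.nth_mem_of_infinite hinf' j, ?_, fun j => ?_, fun i => (hcount i).symm⟩
  · rw [Nat.count_succ]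
    by_cases h : tick j <;> simp [h]
  · exact ⟨Nat.nth tick i, (Nat.count_nth_of_infinite hinf' i).ge⟩
  · have := hcount 0
    rwa [Nat.count_zero] at this
  · have := hcount (Nat.nth tick j + 1)
    rwa [Nat.count_succ, if_pos (Nat.nth_mem_of_infinite hinf' j),
      Nat.count_nth_of_infinite hinf'] at this

/-! ### Strategies with memory and positional strategies -/

theorem pre_succ {X : Type} (x : ℕ → X) (i : ℕ) : pre x (i + 1) = pre x i ++ [x i] := by
  simp [pre, List.range_succ]

theorem pre_congr {X : Type} {x y : ℕ → X} {i : ℕ} (h : ∀ j < i, x j = y j) :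
    pre x i = pre y i :=
  List.map_congr_left fun j hj => h j (List.mem_range.1 hj)

/-- A Diamond-strategy presented as a transition system of memory states; winning from every
state. -/
structure ParityGame.StrategySystem {V : Type} (G : ParityGame V) (M : Type) where
  pos : M → V
  step : M → M → Prop
  edge : ∀ {μ μ'}, step μ μ' → G.edge (pos μ) (pos μ')
  dia : ∀ μ, G.dia (pos μ) → ∃ μ', step μ μ'
  box : ∀ μ v', ¬ G.dia (pos μ) → G.edge (pos μ) v' → ∃ μ', step μ μ' ∧ pos μ' = v'
  win : ∀ ρ : ℕ → M, (∀ i, step (ρ i) (ρ (i + 1))) →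
    ParityAccepting (fun i => G.prio (pos (ρ i)))

/-- The memory state is recomputed from the history by folding an update function, so a strategy
with memory is a strategy on histories. Only plays of memory states from `start` need to satisfy the
parity condition. -/
theorem ParityGame.wins_of_memory {V M : Type} (G : ParityGame V) (pos : M → V)
    (step : M → M → Prop) (start : M)
    (hdia : ∀ μ, G.dia (pos μ) → ∃ μ', step μ μ' ∧ G.edge (pos μ) (pos μ'))
    (hbox : ∀ μ v', ¬ G.dia (pos μ) → G.edge (pos μ) v' → ∃ μ', step μ μ' ∧ pos μ' = v')
    (hwin : ∀ ρ : ℕ → M, ρ 0 = start → (∀ i, step (ρ i) (ρ (i + 1))) →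
      ParityAccepting (fun i => G.prio (pos (ρ i)))) :
    G.Wins (pos start) := by
  classical
  choose nd hnd hnde using hdia
  choose nb hnb hnbp using hbox
  -- The last alternative concerns illegal moves and is never met along a play. The head of the
  -- history is dropped in `mem` because `start` already accounts for it.
  let upd : M → V → M := fun μ v =>
    if h : G.dia (pos μ) then nd μ h else if h' : G.edge (pos μ) v then nb μ v h h' else μ
  let mem : List V → M := fun l => l.tail.foldl upd start
  let σ : List V → V := fun l => if h : G.dia (pos (mem l)) then pos (nd (mem l) h) else pos start
  have hmem : ∀ (π : ℕ → V) i, mem (pre π (i + 1 + 1)) = upd (mem (pre π (i + 1))) (π (i + 1)) := by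
    intro π i
    simp only [mem]
    rw [pre_succ π (i + 1), List.tail_append_of_ne_nil (by simp [pre]), List.foldl_append]
    rfl
  have hpos : ∀ (π : ℕ → V) i, π 0 = pos start → (∀ j < i, G.Follows σ π j) →
      pos (mem (pre π (i + 1))) = π i := by
    intro π i h0
    induction i with
    | zero => intro _; simp [mem, pre, h0]
    | succ i ih =>
      intro h
      have hi := ih fun j hj => h j (by omega)
      have hf := h i (by omega)
      rw [hmem]
      by_cases hd : G.dia (π i)
      · have h2 := hf.2 hd
        have hd' : G.dia (pos (mem (pre π (i + 1)))) := by rwa [hi]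
        simp only [upd, hd', dif_pos]
        rw [h2]
        simp [σ, hd']
      · have hd' : ¬ G.dia (pos (mem (pre π (i + 1)))) := by rwa [hi]
        have he : G.edge (pos (mem (pre π (i + 1)))) (π (i + 1)) := by rw [hi]; exact hf.1
        simp only [upd, hd', he, dif_pos, dif_neg, not_false_iff]
        exact hnbp _ _ _ _
  refine ⟨σ, fun π i h0 h hd => ?_, fun π h0 h => ?_⟩
  · have hi := hpos π i h0 h
    have hd' : G.dia (pos (mem (pre π (i + 1)))) := by rwa [hi]
    simp only [σ, hd', dif_pos]
    rw [← hi]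
    exact hnde _ _
  · have hi : ∀ i, pos (mem (pre π (i + 1))) = π i := fun i => hpos π i h0 fun j _ => h j
    have := hwin (fun i => mem (pre π (i + 1))) (by simp [mem, pre]) fun i => by
      simp only [hmem]
      by_cases hd : G.dia (pos (mem (pre π (i + 1))))
      · simp only [upd, hd, dif_pos]
        exact hnd _ _
      · have he : G.edge (pos (mem (pre π (i + 1)))) (π (i + 1)) := by rw [hi]; exact (h i).1
        simp only [upd, hd, he, dif_pos, dif_neg, not_false_iff]
        exact hnb _ _ _ _
    simpa [hi] using this

/-- A winning strategy yields a strategy system: its memory states are the finite plays that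
follow the strategy. -/
theorem ParityGame.Wins.exists_strategySystem {V : Type} {G : ParityGame V} {v : V}
    (h : G.Wins v) : ∃ (M : Type) (T : G.StrategySystem M) (start : M), T.pos start = v := by
  classical
  obtain ⟨σ, hlegal, hwin⟩ := h
  -- In a memory state `(π, i)` only the entries of `π` up to `i` matter; the rest is padding, which
  -- is why `step` compares no further.
  refine ⟨{p : (ℕ → V) × ℕ // p.1 0 = v ∧ ∀ j < p.2, G.Follows σ p.1 j},
    { pos := fun p => p.1.1 p.1.2
      step := fun p p' => p'.1.2 = p.1.2 + 1 ∧ ∀ j ≤ p.1.2, p'.1.1 j = p.1.1 j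
      edge := ?_
      dia := ?_
      box := ?_
      win := ?_ }, ⟨(fun _ => v, 0), rfl, fun j hj => absurd hj (by omega)⟩, rfl⟩
  · rintro ⟨⟨π, i⟩, h0, hf⟩ ⟨⟨π', i'⟩, h0', hf'⟩ ⟨h1, h2⟩
    simp only at h1 h2 hf'
    subst h1
    have := (hf' i (by omega)).1
    rwa [h2 i le_rfl] at this
  · rintro ⟨⟨π, i⟩, h0, hf⟩ hd
    have he := hlegal π i h0 hf hd
    let π' : ℕ → V := fun j => if j ≤ i then π j else σ (pre π (i + 1))
    have hle : ∀ j ≤ i, π' j = π j := fun j hj => if_pos hj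
    have hpre : ∀ j ≤ i, pre π' (j + 1) = pre π (j + 1) := fun j hj =>
      pre_congr fun k hk => hle k (by omega)
    have hlast : π' (i + 1) = σ (pre π (i + 1)) := if_neg (by omega)
    refine ⟨⟨(π', i + 1), by rw [← h0]; exact hle 0 (by omega), fun j hj => ?_⟩, rfl, hle⟩
    change j < i + 1 at hj
    change G.edge (π' j) (π' (j + 1)) ∧ (G.dia (π' j) → π' (j + 1) = σ (pre π' (j + 1)))
    rw [hle j (by omega), hpre j (by omega)]
    rcases Nat.lt_succ_iff_lt_or_eq.1 hj with hj' | rfl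
    · rw [hle (j + 1) hj']
      exact hf j hj'
    · rw [hlast]
      exact ⟨he, fun _ => rfl⟩
  · rintro ⟨⟨π, i⟩, h0, hf⟩ v' hd he
    let π' : ℕ → V := fun j => if j ≤ i then π j else v'
    have hle : ∀ j ≤ i, π' j = π j := fun j hj => if_pos hj
    have hpre : ∀ j ≤ i, pre π' (j + 1) = pre π (j + 1) := fun j hj =>
      pre_congr fun k hk => hle k (by omega)
    have hlast : π' (i + 1) = v' := if_neg (by omega)
    refine ⟨⟨(π', i + 1), by rw [← h0]; exact hle 0 (by omega), fun j hj => ?_⟩, ⟨rfl, hle⟩, hlast⟩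
    change j < i + 1 at hj
    change G.edge (π' j) (π' (j + 1)) ∧ (G.dia (π' j) → π' (j + 1) = σ (pre π' (j + 1)))
    rw [hle j (by omega), hpre j (by omega)]
    rcases Nat.lt_succ_iff_lt_or_eq.1 hj with hj' | rfl
    · rw [hle (j + 1) hj']
      exact hf j hj'
    · rw [hlast]
      exact ⟨he, fun h => absurd h hd⟩
  · intro ρ hρ
    let i₀ := (ρ 0).1.2
    have hidx : ∀ k, (ρ k).1.2 = i₀ + k := by
      intro k
      induction k with
      | zero => rfl
      | succ k ih => rw [(hρ k).1, ih]; rfl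
    have hagree : ∀ k d j, j ≤ i₀ + k → (ρ (k + d)).1.1 j = (ρ k).1.1 j := by
      intro k d j hj
      induction d with
      | zero => rfl
      | succ d ih =>
        rw [← add_assoc, (hρ (k + d)).2 j (by rw [hidx]; omega), ih]
    -- The limit of the growing finite plays, read off on the diagonal. The sequence of memory
    -- states starts at length `i₀`, so its priorities are a tail of those of `π`.
    let π : ℕ → V := fun j => (ρ j).1.1 j
    have hπ : ∀ k j, j ≤ i₀ + k → (ρ k).1.1 j = π j := by
      intro k j hj
      rcases le_total k j with h | h
      · obtain ⟨d, rfl⟩ := Nat.exists_eq_add_of_le h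
        exact (hagree k d _ hj).symm
      · obtain ⟨d, rfl⟩ := Nat.exists_eq_add_of_le h
        exact hagree j d j (by omega)
    have hwin' := hwin π (ρ 0).2.1 fun j => by
      have hf := (ρ (j + 1)).2.2 j (by rw [hidx]; omega)
      unfold ParityGame.Follows at hf ⊢
      rwa [hπ _ _ (by omega), hπ _ _ (by omega),
        pre_congr fun k hk => hπ (j + 1) k (by omega)] at hf
    rw [← parityAccepting_add_iff i₀] at hwin'
    have heq : (fun j => G.prio (π (j + i₀))) = fun i => G.prio ((ρ i).1.1 (ρ i).1.2) := by
      funext i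
      rw [hidx, hπ _ _ le_rfl, add_comm]
    rw [heq] at hwin'
    exact hwin'

/-! ### Signatures and positional strategies -/

section Positional

variable {V M : Type} {G : ParityGame V} (T : G.StrategySystem M)

/-- From `x` a path through priorities at most `p` leads to a node of priority `p` just before
`y`. -/
def ParityGame.StrategySystem.Progress (p : ℕ) (y x : M) : Prop :=
  ∃ u, Relation.ReflTransGen (fun a b => T.step a b ∧ G.prio (T.pos a) < p) x u ∧
    T.step u y ∧ G.prio (T.pos u) = p

/-- An infinite descending chain would concatenate to an infinite play whose priorities never exceed
`p` and equal `p` infinitely often. For odd `p` this contradicts that every play of the system is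
won. -/
theorem ParityGame.StrategySystem.wellFounded_progress {p : ℕ} (hp : ¬ Even p) :
    WellFounded (T.Progress p) := by
  rw [wellFounded_iff_isEmpty_descending_chain]
  refine ⟨fun ⟨z, hz⟩ => ?_⟩
  obtain ⟨y, φ, hφ, _, hy⟩ := exists_refinement z
    (fun _ a b => T.step a b ∧ G.prio (T.pos a) < p)
    (fun _ u y => T.step u y ∧ G.prio (T.pos u) = p) hz
  have hacc := T.win y fun j => by
    rcases (hy j).2 with h | h
    · exact h.1.1
    · exact h.1.1
  obtain ⟨q, hq, h1, h2⟩ := hacc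
  have hle : ∀ j, G.prio (T.pos (y j)) ≤ p := fun j => by
    rcases (hy j).2 with h | h
    · exact h.1.2.le
    · exact h.1.2.le
  have hfreq : ∃ᶠ j in atTop, G.prio (T.pos (y j)) = p := by
    rw [frequently_atTop]
    intro a
    by_contra hno
    push Not at hno
    have hconst : ∀ k, φ (a + k) = φ a := by
      intro k
      induction k with
      | zero => rfl
      | succ k ih =>
        rcases (hy (a + k)).2 with h | h
        · rw [← add_assoc, h.2, ih]
        · exact absurd h.1.2 (hno (a + k) (by omega))
    obtain ⟨j, hj⟩ := hφ.unbounded (φ a + 1)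
    rcases le_total a j with h | h
    · obtain ⟨d, rfl⟩ := Nat.exists_eq_add_of_le h
      have := hconst d
      omega
    · have := hφ.monotone h
      omega
  exact hp (limsup_unique h1 h2 hfreq (Eventually.of_forall hle) ▸ hq)

open Classical in
/-- The signature of a memory state: for every odd priority the rank of its progress relation. -/
noncomputable def ParityGame.StrategySystem.signature (D : ℕ) (x : M) (p : Fin D) : Ordinal.{0} :=
  if h : Even (p : ℕ) then 0 else
    @IsWellFounded.rank M (T.Progress p) ⟨T.wellFounded_progress h⟩ x

/-- Only the components from `p` on. -/
noncomputable def truncate {D : ℕ} (p : ℕ) (s : Fin D → Ordinal.{0}) (i : Fin D) : Ordinal.{0} :=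
  open Classical in if p ≤ i then s i else 0

/-- The comparison is decided at the largest differing index. Either this index survives the
truncation, or the truncations coincide. -/
theorem truncate_mono {D : ℕ} (p : ℕ) {s t : Fin D → Ordinal.{0}} (h : toColex s ≤ toColex t) :
    toColex (truncate p s) ≤ toColex (truncate p t) := by
  rcases h.eq_or_lt with h | ⟨i, hi, hlt⟩
  · rw [toColex_inj.1 h]
  · by_cases hp : p ≤ i
    · refine le_of_lt ⟨i, fun j hj => ?_, ?_⟩
      · simp only [Pi.toColex_apply, truncate]
        rw [show s j = t j from hi j hj]
      · simpa [truncate, hp] using hlt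
    · refine le_of_eq (congrArg toColex (funext fun j => ?_))
      unfold truncate
      split_ifs with hj
      · exact hi j (show (i : Fin D) < j by rw [Fin.lt_def]; omega)
      · rfl

/-- If `x` has priority below `p`, everything that makes progress from `y` also makes progress from
`x`, the step from `x` to `y` being put in front; if its priority is `p`, then `y` itself is
progress from `x`. -/
theorem ParityGame.StrategySystem.signature_le {D : ℕ} {x y : M} (h : T.step x y) (p : Fin D)
    (hp : G.prio (T.pos x) ≤ p) : T.signature D y p ≤ T.signature D x p := by
  unfold signature
  split_ifs with he
  · exact le_rfl
  · have : IsWellFounded M (T.Progress p) := ⟨T.wellFounded_progress he⟩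
    rcases hp.eq_or_lt with hp | hp
    · exact (IsWellFounded.rank_lt_of_rel ⟨x, .refl, h, hp⟩).le
    · rw [IsWellFounded.rank_eq (T.Progress p) y]
      refine Ordinal.iSup_le fun ⟨b, u, hu, hub⟩ => ?_
      exact Order.succ_le_of_lt (IsWellFounded.rank_lt_of_rel ⟨u, hu.head ⟨h, hp⟩, hub⟩)

theorem ParityGame.StrategySystem.signature_lt {D : ℕ} {x y : M} (h : T.step x y) (p : Fin D)
    (hp : G.prio (T.pos x) = p) (ho : ¬ Even (p : ℕ)) :
    T.signature D y p < T.signature D x p := by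
  unfold signature
  rw [dif_neg ho, dif_neg ho]
  have : IsWellFounded M (T.Progress p) := ⟨T.wellFounded_progress ho⟩
  exact IsWellFounded.rank_lt_of_rel ⟨x, .refl, h, hp⟩

/-- On the set of positions of a strategy system, Diamond wins with a positional strategy. -/
theorem ParityGame.StrategySystem.exists_positional [Nonempty M] {D : ℕ} (hD : ∀ v, G.prio v < D) :
    ∃ σ : V → V,
      (∀ v ∈ Set.range T.pos, G.dia v → G.edge v (σ v) ∧ σ v ∈ Set.range T.pos) ∧
      (∀ v ∈ Set.range T.pos, ¬ G.dia v → ∀ v', G.edge v v' → v' ∈ Set.range T.pos) ∧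
      ∀ π : ℕ → V, π 0 ∈ Set.range T.pos →
        (∀ i, G.edge (π i) (π (i + 1)) ∧ (G.dia (π i) → π (i + 1) = σ (π i))) →
        ParityAccepting (fun i => G.prio (π i)) := by
  classical
  let sig : M → Colex (Fin D → Ordinal.{0}) := fun x => toColex (T.signature D x)
  -- Several memory states may sit at the same node; the positional strategy always moves as the one
  -- with the least signature does. Signatures are compared with the largest priority first.
  have hmin : ∀ v ∈ Set.range T.pos, ∃ x, T.pos x = v ∧ ∀ y, T.pos y = v → sig x ≤ sig y := by
    rintro v ⟨x₀, hx₀⟩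
    have wf : WellFounded ((· < ·) : Colex (Fin D → Ordinal.{0}) → _ → Prop) := wellFounded_lt
    obtain ⟨x, hx, hxmin⟩ := (InvImage.wf sig wf).has_min {x | T.pos x = v} ⟨x₀, hx₀⟩
    exact ⟨x, hx, fun y hy => not_lt.1 (hxmin y hy)⟩
  choose! best hbest hbestmin using hmin
  have hnext : ∀ v ∈ Set.range T.pos, G.dia v → ∃ y, T.step (best v) y := fun v hv hd =>
    T.dia _ (by rwa [hbest v hv])
  choose! next hnext using hnext
  have hedge : ∀ v ∈ Set.range T.pos, G.dia v → G.edge v (T.pos (next v)) := fun v hv hd => by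
    have := T.edge (hnext v hv hd)
    rwa [hbest v hv] at this
  have hbox : ∀ v ∈ Set.range T.pos, ¬ G.dia v → ∀ v', G.edge v v' →
      ∃ y, T.step (best v) y ∧ T.pos y = v' := fun v hv hd v' he =>
    T.box _ _ (by rwa [hbest v hv]) (by rwa [hbest v hv])
  refine ⟨fun v => T.pos (next v), fun v hv hd => ⟨hedge v hv hd, _, rfl⟩, fun v hv hd v' he => ?_,
    fun π h0 hπ => ?_⟩
  · obtain ⟨y, -, hy⟩ := hbox v hv hd v' he
    exact ⟨y, hy⟩
  · have hstep : ∀ i, π i ∈ Set.range T.pos → ∃ y, T.step (best (π i)) y ∧ T.pos y = π (i + 1) := by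
      intro i hi
      by_cases hd : G.dia (π i)
      · exact ⟨_, hnext _ hi hd, ((hπ i).2 hd).symm⟩
      · exact hbox _ hi hd _ (hπ i).1
    have hmem : ∀ i, π i ∈ Set.range T.pos := by
      intro i
      induction i with
      | zero => exact h0
      | succ i ih =>
        obtain ⟨y, -, hy⟩ := hstep i ih
        exact ⟨y, hy⟩
    obtain ⟨p, h1, h2⟩ := exists_limsup_of_bounded fun i => hD (π i)
    by_cases he : Even p
    · exact ⟨p, he, h1, h2⟩
    exfalso
    obtain ⟨k, hk⟩ := h1.exists
    have hpD : p < D := hk ▸ hD (π k)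
    -- After each move the play switches to the best memory state at the new node, which can only
    -- lower the signature. If `p` is the odd limit superior, the components from `p` on never
    -- increase once the priorities stay at most `p`, and they decrease strictly at each occurrence
    -- of `p`.
    let F : ℕ → Colex (Fin D → Ordinal.{0}) := fun i =>
      toColex (truncate p (T.signature D (best (π i))))
    have hFle : ∀ i, G.prio (π i) ≤ p → F (i + 1) ≤ F i := by
      intro i hi
      obtain ⟨y, hy, hy'⟩ := hstep i (hmem i)
      refine (truncate_mono p (hbestmin _ (hmem (i + 1)) y hy')).trans ?_
      refine Pi.toColex_monotone fun j => ?_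
      unfold truncate
      split_ifs with hj
      · exact T.signature_le hy j (by rw [hbest _ (hmem i)]; omega)
      · exact le_rfl
    have hFlt : ∀ i, G.prio (π i) = p → F (i + 1) < F i := by
      intro i hi
      obtain ⟨y, hy, hy'⟩ := hstep i (hmem i)
      refine (truncate_mono p (hbestmin _ (hmem (i + 1)) y hy')).trans_lt ?_
      refine Pi.toColex_strictMono (lt_of_le_of_ne (fun j => ?_) fun heq => ?_)
      · unfold truncate
        split_ifs with hj
        · exact T.signature_le hy j (by rw [hbest _ (hmem i)]; omega)
        · exact le_rfl
      · have := congrFun heq ⟨p, hpD⟩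
        simp only [truncate, le_refl, if_true] at this
        exact absurd this (T.signature_lt hy ⟨p, hpD⟩ (by rw [hbest _ (hmem i)]; exact hi) he).ne
    obtain ⟨a, ha⟩ := eventually_atTop.1 h2
    have wf : WellFounded ((· < ·) : Colex (Fin D → Ordinal.{0}) → _ → Prop) := wellFounded_lt
    -- A minimal value of `F` from `a` on is undercut after the next occurrence of `p`.
    obtain ⟨i, hi, hmin⟩ := (InvImage.wf F wf).has_min {i | a ≤ i} ⟨a, by simp⟩
    obtain ⟨j, hj, hj'⟩ := frequently_atTop.1 h1 i
    have hanti : ∀ d, F (i + d) ≤ F i := by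
      intro d
      induction d with
      | zero => exact le_rfl
      | succ d ih => exact (hFle (i + d) (ha _ (le_trans hi (by omega)))).trans ih
    obtain ⟨d, rfl⟩ := Nat.exists_eq_add_of_le hj
    exact hmin (i + d + 1) (show a ≤ i + d + 1 from le_trans hi (by omega)) ((hFlt _ hj').trans_le (hanti d))

end Positional

/-- A winning strategy can be made positional. -/
theorem ParityGame.Wins.exists_positional {V : Type} {G : ParityGame V} {v : V} (h : G.Wins v)
    {D : ℕ} (hD : ∀ v, G.prio v < D) :
    ∃ (W : Set V) (σ : V → V), v ∈ W ∧
      (∀ v ∈ W, G.dia v → G.edge v (σ v) ∧ σ v ∈ W) ∧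
      (∀ v ∈ W, ¬ G.dia v → ∀ v', G.edge v v' → v' ∈ W) ∧
      ∀ π : ℕ → V, π 0 ∈ W →
        (∀ i, G.edge (π i) (π (i + 1)) ∧ (G.dia (π i) → π (i + 1) = σ (π i))) →
        ParityAccepting (fun i => G.prio (π i)) := by
  obtain ⟨M, T, start, hstart⟩ := h.exists_strategySystem
  have : Nonempty M := ⟨start⟩
  obtain ⟨σ, h1, h2, h3⟩ := T.exists_positional hD
  exact ⟨Set.range T.pos, σ, ⟨start, hstart⟩, h1, h2, h3⟩

/-! ### Tracking automata and tableaux -/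

section Tracking

variable {α Q B : Type}

/-- The states reached from a set of states by one letter. -/
def NPW.post (N : NPW B Q) (U : Set Q) (b : B) : Set Q := {q' | ∃ q ∈ U, q' ∈ N.δ q b}

/-- The moves of a trace of a tree automaton. With `y = some q'` the local existential state `x`
moves to `q'`; with `y = none` and a local universal state `x`, that state moves to any of its
successors; otherwise all modal universal states and the modal existential state `x` move, and the
other traces end. In local steps all states but `x` stay. -/
def APT.Track (A : APT α Q) (a : α) (x : Option Q) : Option Q → Q → Q → Prop
  | some q', p, p' => (x = some p ∧ p' = q') ∨ (x ≠ some p ∧ p' = p)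
  | none, p, p' =>
    ((∃ q, x = some q ∧ A.kind q = .localUniv) ∧
      ((x = some p ∧ p' ∈ A.δ p a) ∨ (x ≠ some p ∧ p' = p))) ∨
    ((¬ ∃ q, x = some q ∧ A.kind q = .localUniv) ∧ p' ∈ A.δ p a ∧
      (A.kind p = .modalUniv ∨ (x = some p ∧ A.kind p = .modalEx)))

/-- The word automaton `N` accepts a word if some trace along it violates the parity condition
of `A`. -/
structure IsTracker (A : APT α Q) (enc : α → Option Q → Option Q → B) (N : NPW B Q) : Prop where
  init : N.init = A.init
  mem_δ : ∀ p a x y p', p' ∈ N.δ p (enc a x y) ↔ A.Track a x y p p'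
  prio : ∀ q, N.prio q = A.prio q + 1

/-- `pick` selects a local state. -/
structure IsPick (A : APT α Q) (pick : Set Q → Option Q) : Prop where
  some : ∀ {U q}, pick U = some q → q ∈ U ∧ (A.kind q).IsLocal
  none : ∀ {U}, pick U = none → ∀ q ∈ U, ¬ (A.kind q).IsLocal

open Classical in
/-- The letter that describes a step: the picked local state moves, `ch` being the successor that
Diamond chose; if all states are modal, the modal step with Box's choice `p` is made. -/
noncomputable def APT.letter (A : APT α Q) (enc : α → Option Q → Option Q → B) (o : Option Q)
    (a : α) (ch : Q) (p : Option Q) : B :=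
  match o with
  | some q => enc a (some q) (if A.kind q = .localEx then some ch else none)
  | none => enc a p none

/-- In a modal step, Box chooses a modal existential state or nothing. -/
def APT.ValidChoice (A : APT α Q) (o p : Option Q) : Prop :=
  o = none → p = none ∨ ∃ q, p = some q ∧ A.kind q = .modalEx

/-- Sets of states that evolve by letters, all of whose infinite branches spell words without
bad traces. -/
structure Tableau (A : APT α Q) (enc : α → Option Q → Option Q → B) (N : NPW B Q)
    (pick : Set Q → Option Q) (C : Type) where
  root : C
  U : C → Set Q
  lab : C → α
  choice : C → Q
  step : C → Option Q → C → Prop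
  U_root : U root = {A.init}
  choice_mem : ∀ {c q}, pick (U c) = some q → A.kind q = .localEx → choice c ∈ A.δ q (lab c)
  exists_step : ∀ c p, A.ValidChoice (pick (U c)) p → ∃ c', step c p c'
  valid : ∀ {c p c'}, step c p c' → A.ValidChoice (pick (U c)) p
  U_step : ∀ {c p c'}, step c p c' →
    U c' = N.post (U c) (A.letter enc (pick (U c)) (lab c) (choice c) p)
  lab_step : ∀ {c p c'}, step c p c' → pick (U c) ≠ none → lab c' = lab c
  good : ∀ (ρ : ℕ → C) (ps : ℕ → Option Q), ρ 0 = root → (∀ i, step (ρ i) (ps i) (ρ (i + 1))) →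
    (fun i => A.letter enc (pick (U (ρ i))) (lab (ρ i)) (choice (ρ i)) (ps i)) ∉ N.language

theorem StateKind.IsLocal.cases {x : StateKind} (h : x.IsLocal) :
    x = .localEx ∨ x = .localUniv := h

theorem StateKind.isModal_of_not_isLocal {x : StateKind} (h : ¬ x.IsLocal) :
    x = .modalEx ∨ x = .modalUniv := by
  unfold StateKind.IsLocal at h
  cases x <;> simp_all

variable {A : APT α Q} {enc : α → Option Q → Option Q → B} {N : NPW B Q}
  {pick : Set Q → Option Q}

theorem IsTracker.mem_of_existential (hN : IsTracker A enc N) {q : Q}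
    (hk : A.kind q = .localEx) {a : α} {ch p p' : Q} {o : Option Q} :
    p' ∈ N.δ p (A.letter enc (some q) a ch o) ↔ (p = q ∧ p' = ch) ∨ (p ≠ q ∧ p' = p) := by
  simp only [APT.letter, hk, if_true, hN.mem_δ, APT.Track, Option.some_inj, ne_eq]
  rw [eq_comm (a := q)]

theorem IsTracker.mem_of_universal (hN : IsTracker A enc N) {q : Q}
    (hk : A.kind q = .localUniv) {a : α} {ch p p' : Q} {o : Option Q} :
    p' ∈ N.δ p (A.letter enc (some q) a ch o) ↔ (p = q ∧ p' ∈ A.δ q a) ∨ (p ≠ q ∧ p' = p) := by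
  have hex : ∃ q₁, q = q₁ ∧ A.kind q₁ = .localUniv := ⟨q, rfl, hk⟩
  simp only [APT.letter, hk, hN.mem_δ, APT.Track, Option.some_inj, ne_eq, reduceCtorEq, if_false, hex,
    true_and, not_true_eq_false, false_and, or_false]
  rw [eq_comm (a := q)]
  constructor
  · rintro (⟨rfl, h⟩ | h)
    · exact .inl ⟨rfl, h⟩
    · exact .inr h
  · rintro (⟨rfl, h⟩ | h)
    · exact .inl ⟨rfl, h⟩
    · exact .inr h

/-- Validity of the choice rules out a local-universal active state, for which the same letter would
describe a local step. -/
theorem IsTracker.mem_of_modal (hN : IsTracker A enc N) {a : α} {ch p p' : Q} {o : Option Q}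
    (ho : A.ValidChoice none o) :
    p' ∈ N.δ p (A.letter enc none a ch o) ↔
      p' ∈ A.δ p a ∧ (A.kind p = .modalUniv ∨ (o = some p ∧ A.kind p = .modalEx)) := by
  have h : ¬ ∃ q₁, o = some q₁ ∧ A.kind q₁ = .localUniv := by
    rintro ⟨q₁, rfl, hk⟩
    rcases ho rfl with h | ⟨q, h, hq⟩
    · cases h
    · cases h
      rw [hk] at hq
      cases hq
  simp only [APT.letter, hN.mem_δ, APT.Track, h, false_and, false_or, not_false_iff, true_and]

/-- Removing a local state `q` and adding some of its successors. -/
def APT.LocalDescent (A : APT α Q) (a : α) (U' U : Set Q) : Prop :=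
  ∃ q ∈ U, (A.kind q).IsLocal ∧ ∃ T ⊆ A.δ q a, U' = U \ {q} ∪ T

/-- The relation "local successor of a local state" is acyclic on a finite set, hence well-founded.
Replacing one member of a finite multiset by finitely many smaller ones is then well-founded as well
(`Relation.CutExpand`). Modal states are ignored. -/
theorem APT.wellFounded_localDescent [Finite Q] (A : APT α Q) (a : α) :
    WellFounded (A.LocalDescent a) := by
  classical
  let R : Q → Q → Prop := fun p p' => (A.kind p).IsLocal ∧ (A.kind p').IsLocal ∧ p' ∈ A.δ p a
  have hR : WellFounded (Function.swap R) := by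
    have : Std.Irrefl (Relation.TransGen (Function.swap R)) :=
      ⟨fun q hq => A.no_local_loop a q (Relation.transGen_swap.1 hq)⟩
    have := Finite.wellFounded_of_trans_of_irrefl (Relation.TransGen (Function.swap R))
    exact Subrelation.wf (fun h => Relation.TransGen.single h) this
  let L : Set Q → Finset Q := fun U => (Set.toFinite {q | q ∈ U ∧ (A.kind q).IsLocal}).toFinset
  have hL : ∀ U q, q ∈ L U ↔ q ∈ U ∧ (A.kind q).IsLocal := fun U q => by simp [L]
  refine Subrelation.wf (r := InvImage (Relation.CutExpand (Function.swap R)) fun U => (L U).val)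
    ?_ (InvImage.wf _ hR.cutExpand)
  rintro U' U ⟨q, hq, hloc, T, hT, rfl⟩
  -- Only those successors count as added that are not present already, since sets carry no
  -- multiplicities.
  refine ⟨(L T \ (L U).erase q).val, q, fun q' hq' => ?_, ?_⟩
  · have h := (hL T q').1 (Finset.mem_sdiff.1 hq').1
    exact ⟨hloc, h.2, hT h.1⟩
  · have h1 : L (U \ {q} ∪ T) =
        ((L U).erase q).disjUnion (L T \ (L U).erase q) Finset.disjoint_sdiff := by
      ext x
      simp only [Finset.mem_disjUnion, Finset.mem_sdiff, Finset.mem_erase, hL, Set.mem_union,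
        Set.mem_sdiff, Set.mem_singleton_iff]
      tauto
    have h2 : (L U).val = ((L U).erase q).val + {q} := by
      conv_lhs => rw [← Finset.insert_erase ((hL U q).2 ⟨hq, hloc⟩)]
      rw [Finset.insert_val_of_notMem (by simp), ← Multiset.singleton_add, add_comm]
    change (L (U \ {q} ∪ T)).val + {q} = (L U).val + _
    rw [h1, h2, Finset.disjUnion_val]
    abel

theorem IsTracker.localDescent (hN : IsTracker A enc N) (hpick : IsPick A pick) {U : Set Q} {q : Q}
    (hq : pick U = some q) {a : α} {ch : Q} {p : Option Q}
    (hch : A.kind q = .localEx → ch ∈ A.δ q a) :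
    A.LocalDescent a (N.post U (A.letter enc (pick U) a ch p)) U := by
  obtain ⟨hmem, hloc⟩ := hpick.some hq
  rw [hq]
  rcases hloc.cases with hk | hk
  · refine ⟨q, hmem, hloc, {ch}, by simpa using hch hk, ?_⟩
    ext x
    simp only [NPW.post, Set.mem_ofPred_eq, hN.mem_of_existential hk, Set.mem_union, Set.mem_sdiff,
      Set.mem_singleton_iff]
    constructor
    · rintro ⟨q₁, h1, ⟨-, rfl⟩ | ⟨h2, rfl⟩⟩
      · exact .inr rfl
      · exact .inl ⟨h1, h2⟩
    · rintro (⟨h1, h2⟩ | rfl)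
      · exact ⟨x, h1, .inr ⟨h2, rfl⟩⟩
      · exact ⟨q, hmem, .inl ⟨rfl, rfl⟩⟩
  · refine ⟨q, hmem, hloc, A.δ q a, subset_rfl, ?_⟩
    ext x
    simp only [NPW.post, Set.mem_ofPred_eq, hN.mem_of_universal hk, Set.mem_union, Set.mem_sdiff,
      Set.mem_singleton_iff]
    constructor
    · rintro ⟨q₁, h1, ⟨-, h2⟩ | ⟨h2, rfl⟩⟩
      · exact .inr h2
      · exact .inl ⟨h1, h2⟩
    · rintro (⟨h1, h2⟩ | h)
      · exact ⟨x, h1, .inr ⟨h2, rfl⟩⟩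
      · exact ⟨q, hmem, .inl ⟨rfl, h⟩⟩

theorem APT.exists_prio_lt [Finite Q] (A : APT α Q) : ∃ D, ∀ q, A.prio q < D := by
  obtain ⟨D, hD⟩ := (Set.finite_range A.prio).bddAbove
  exact ⟨D + 1, fun q => Nat.lt_succ_of_le (hD ⟨q, rfl⟩)⟩

/-- Words along which all traces satisfy the parity condition of the tree automaton. -/
theorem IsTracker.notMem_language_iff [Finite Q] (hN : IsTracker A enc N) {w : ℕ → B} :
    w ∉ N.language ↔ ∀ r, N.IsRun w r → ParityAccepting (fun i => A.prio (r i)) := by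
  obtain ⟨D, hD⟩ := A.exists_prio_lt
  have h : ∀ r : ℕ → Q, ParityAccepting (fun i => N.prio (r i)) ↔
      ¬ ParityAccepting (fun i => A.prio (r i)) := fun r => by
    simp only [hN.prio]
    exact parityAccepting_succ_iff fun i => hD (r i)
  simp only [NPW.language, Set.mem_ofPred_eq, h, not_exists, not_and, not_not]

/-! ### From structures to tableaux -/

/-- The step of a trace at a set of states, when Diamond plays positionally. -/
theorem IsTracker.move (hN : IsTracker A enc N) (hpick : IsPick A pick) (K : Kripke α)
    {W : Set (K.W × Q)} {σ : K.W × Q → K.W × Q}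
    (hσ : ∀ v ∈ W, (A.acceptanceGame K).dia v → (A.acceptanceGame K).edge v (σ v) ∧ σ v ∈ W)
    {w w' : K.W} {U : Set Q} {ch : Q} {p : Option Q} (hU : ∀ q ∈ U, (w, q) ∈ W)
    (hch : ∀ q, pick U = some q → ch = (σ (w, q)).2)
    (hvalid : A.ValidChoice (pick U) p)
    (hlocal : pick U ≠ none → w' = w)
    (hmodal : pick U = none → K.R w w' ∧
      ∀ q ∈ U, p = some q → A.kind q = .modalEx → w' = (σ (w, q)).1)
    {q q' : Q} (hq : q ∈ U) (hq' : q' ∈ N.δ q (A.letter enc (pick U) (K.label w) ch p)) :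
    (pick U ≠ none ∧ w' = w ∧ q' = q) ∨
      ((A.acceptanceGame K).edge (w, q) (w', q') ∧
        ((A.acceptanceGame K).dia (w, q) → (w', q') = σ (w, q))) := by
  rcases ho : pick U with _ | q₀
  · rw [ho] at hq' hvalid
    obtain ⟨hR, hex⟩ := hmodal ho
    right
    rw [hN.mem_of_modal hvalid] at hq'
    obtain ⟨h1, h2 | ⟨rfl, h2⟩⟩ := hq'
    · exact ⟨⟨h1, .inr ⟨.inr h2, hR⟩⟩, fun hd => by
        rcases hd with hd | hd <;> simp only [h2] at hd <;> cases hd⟩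
    · obtain ⟨h3, -⟩ := hσ _ (hU q hq) (.inr h2)
      have h4 : σ (w, q) = (w', q') := by
        refine Prod.ext (hex q hq rfl h2).symm ?_
        obtain ⟨q₁, hq₁⟩ := A.modal_single q (K.label w) (.inl h2)
        have h5 := h3.1
        simp only [hq₁, Set.mem_singleton_iff] at h5 h1
        rw [h5, h1]
      rw [h4] at h3
      exact ⟨h3, fun _ => h4.symm⟩
  · obtain ⟨hq₀, hloc⟩ := hpick.some ho
    have hw := hlocal (by simp [ho])
    subst hw
    rw [ho] at hq'
    rcases hloc.cases with hk | hk
    · rw [hN.mem_of_existential hk] at hq'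
      rcases hq' with ⟨rfl, rfl⟩ | ⟨-, rfl⟩
      · right
        obtain ⟨h3, -⟩ := hσ _ (hU q hq) (.inl hk)
        have h4 : σ (w', q) = (w', q') := by
          refine Prod.ext ?_ (hch q ho).symm
          rcases h3.2 with h | h
          · exact h.2
          · rcases h.1 with h | h <;> simp only [hk] at h <;> cases h
        rw [h4] at h3
        exact ⟨h3, fun _ => h4.symm⟩
      · exact .inl ⟨by simp, rfl, rfl⟩
    · rw [hN.mem_of_universal hk] at hq'
      rcases hq' with ⟨rfl, h⟩ | ⟨-, rfl⟩
      · exact .inr ⟨⟨h, .inl ⟨hloc, rfl⟩⟩, fun hd => by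
          rcases hd with hd | hd <;> simp only [hk] at hd <;> cases hd⟩
      · exact .inl ⟨by simp, rfl, rfl⟩

/-- Nodes are pairs of a world and a set of states, all of which win there under the positional
strategy. A trace along a branch stays put or makes a move that obeys this strategy. Deleting the
idle steps leaves an infinite winning play, so every trace satisfies the parity condition and the
word of the branch is not accepted by the tracker. -/
theorem exists_tableau_of_isNonempty [Finite Q] (hN : IsTracker A enc N) (hpick : IsPick A pick)
    (h : A.IsNonempty) : ∃ C, Nonempty (Tableau A enc N pick C) := by
  classical
  obtain ⟨K, hK⟩ := h
  obtain ⟨D, hD⟩ := A.exists_prio_lt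
  obtain ⟨W, σ, hroot, hdia, hbox, hwin⟩ := hK.exists_positional (D := D) fun v => hD v.2
  -- Without a picked state the value is a dummy.
  let ch : K.W → Set Q → Q := fun w U => match pick U with
    | some q => (σ (w, q)).2
    | none => A.init
  have hch : ∀ w U q, pick U = some q → ch w U = (σ (w, q)).2 := fun w U q hq => by
    simp only [ch, hq]
  let C := {x : K.W × Set Q // ∀ q ∈ x.2, (x.1, q) ∈ W}
  let step : C → Option Q → C → Prop := fun c p c' =>
    A.ValidChoice (pick c.1.2) p ∧
    c'.1.2 = N.post c.1.2 (A.letter enc (pick c.1.2) (K.label c.1.1) (ch c.1.1 c.1.2) p) ∧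
    (pick c.1.2 ≠ none → c'.1.1 = c.1.1) ∧
    (pick c.1.2 = none → K.R c.1.1 c'.1.1 ∧
      ∀ q ∈ c.1.2, p = some q → A.kind q = .modalEx → c'.1.1 = (σ (c.1.1, q)).1)
  have hedgeW : ∀ {v v'}, v ∈ W → (A.acceptanceGame K).edge v v' →
      ((A.acceptanceGame K).dia v → v' = σ v) → v' ∈ W := fun {v v'} hv he hd => by
    by_cases h : (A.acceptanceGame K).dia v
    · rw [hd h]; exact (hdia v hv h).2
    · exact hbox v hv h v' he
  refine ⟨C, ⟨{
    root := ⟨(K.root, {A.init}), fun q hq => by rw [hq]; exact hroot⟩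
    U := fun c => c.1.2
    lab := fun c => K.label c.1.1
    choice := fun c => ch c.1.1 c.1.2
    step := step
    U_root := rfl
    choice_mem := ?_
    exists_step := ?_
    valid := fun h => h.1
    U_step := fun h => h.2.1
    lab_step := fun h h' => by rw [h.2.2.1 h']
    good := ?_ }⟩⟩
  · intro c q hq hk
    have := (hdia _ (c.2 q (hpick.some hq).1) (.inl hk)).1.1
    rwa [hch _ _ _ hq]
  · rintro ⟨⟨w, U⟩, hU⟩ p hp
    simp only at hU hp
    obtain ⟨w', h1, h2⟩ : ∃ w', (pick U ≠ none → w' = w) ∧ (pick U = none → K.R w w' ∧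
        ∀ q ∈ U, p = some q → A.kind q = .modalEx → w' = (σ (w, q)).1) := by
      -- In a modal step the new world is the one that the strategy prescribes for the chosen
      -- modal-existential state. If no such state of `U` is chosen, any successor will do; this is
      -- where totality of the structure enters.
      by_cases ho : pick U = none
      · by_cases hex : ∃ q ∈ U, p = some q ∧ A.kind q = .modalEx
        · obtain ⟨q, hq, rfl, hk⟩ := hex
          refine ⟨(σ (w, q)).1, fun h => absurd ho h, fun _ => ⟨?_, fun q' _ h _ => ?_⟩⟩
          · rcases (hdia _ (hU q hq) (.inr hk)).1.2 with h | h
            · exact absurd h.1 (hpick.none ho q hq)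
            · exact h.2
          · rw [Option.some_inj.1 h]
        · obtain ⟨w', hw'⟩ := K.total w
          exact ⟨w', fun h => absurd ho h, fun _ => ⟨hw', fun q hq h hk =>
            absurd ⟨q, hq, h, hk⟩ hex⟩⟩
      · exact ⟨w, fun _ => rfl, fun h => absurd h ho⟩
    refine ⟨⟨(w', N.post U (A.letter enc (pick U) (K.label w) (ch w U) p)), ?_⟩, hp, rfl, h1, h2⟩
    rintro q' ⟨q, hq, hq'⟩
    rcases hN.move hpick K hdia hU (hch w U) hp h1 h2 hq hq' with ⟨-, rfl, rfl⟩ | ⟨he, hd⟩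
    · exact hU _ hq
    · exact hedgeW (hU q hq) he hd
  · intro ρ ps h0 hρ
    rw [hN.notMem_language_iff]
    intro r hr
    have hrU : ∀ i, r i ∈ (ρ i).1.2 := by
      intro i
      induction i with
      | zero => rw [h0, hr.1, hN.init]; rfl
      | succ i ih => rw [(hρ i).2.1]; exact ⟨r i, ih, hr.2 i⟩
    let x : ℕ → K.W × Q := fun i => ((ρ i).1.1, r i)
    let tick : ℕ → Prop := fun i => (A.acceptanceGame K).edge (x i) (x (i + 1)) ∧
      ((A.acceptanceGame K).dia (x i) → x (i + 1) = σ (x i))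
    have hmove : ∀ i, (pick (ρ i).1.2 ≠ none ∧ x (i + 1) = x i) ∨ tick i := fun i => by
      rcases hN.move hpick K hdia (ρ i).2 (hch _ _) (hρ i).1 (hρ i).2.2.1 (hρ i).2.2.2 (hrU i)
        (hr.2 i) with ⟨h1, h2, h3⟩ | h
      · exact .inl ⟨h1, Prod.ext h2 h3⟩
      · exact .inr h
    -- Local steps keep the world, hence the letter, so they cannot go on forever; a modal step is a
    -- genuine move for every trace that survives it.
    have hterm : ∀ a U i, (ρ i).1.2 = U → K.label (ρ i).1.1 = a →
        ∃ j, i ≤ j ∧ pick (ρ j).1.2 = none := by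
      intro a U
      induction U using (A.wellFounded_localDescent a).induction with
      | _ U ih =>
        intro i hi ha
        rcases ho : pick (ρ i).1.2 with _ | q
        · exact ⟨i, le_rfl, ho⟩
        · have hw := (hρ i).2.2.1 (by simp [ho])
          obtain ⟨j, hj, hj'⟩ := ih (ρ (i + 1)).1.2 (by
            have := (hρ i).2.1
            rw [ha] at this
            rw [this, ← hi]
            refine hN.localDescent hpick ho fun hk => ?_
            rw [hch _ _ _ ho, ← ha]
            exact (hdia _ ((ρ i).2 q (hpick.some ho).1) (.inl hk)).1.1)
            (i + 1) rfl (by rw [hw, ha])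
          exact ⟨j, by omega, hj'⟩
    obtain ⟨ψ, φ, hφ, hψ, hx0, hx1, hx⟩ := exists_contraction x tick (fun i => by
        obtain ⟨j, hj, hj'⟩ := hterm _ _ i rfl rfl
        refine ⟨j, hj, ?_⟩
        rcases hmove j with h | h
        · exact absurd hj' h.1
        · exact h)
      fun i hi => by
        rcases hmove i with h | h
        · exact h.2
        · exact absurd h hi
    have hacc := hwin (fun j => x (ψ j)) (by
        simp only [hx0]
        exact (ρ 0).2 _ (hrU 0)) fun j => by
      simp only [hx1]
      exact hψ j
    rw [← hφ.parityAccepting_iff] at hacc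
    have heq : (fun j => (A.acceptanceGame K).prio (x (ψ (φ j)))) = fun i => A.prio (r i) := by
      funext i
      rw [← hx]
      rfl
    rwa [heq] at hacc

/-! ### From tableaux to structures -/

/-- Every tableau node is a world. From it a fixed chain of local steps leads to a node with modal
states only, whose modal successors are the accessible worlds. Diamond remembers the current node on
this chain. A state waits, unchanged, until it is picked or the chain ends, so a play of the
acceptance game is a trace with the waiting removed, and goodness of the tableau gives the parity
condition. -/
theorem Tableau.isNonempty {C : Type} [Finite Q] (hN : IsTracker A enc N) (hpick : IsPick A pick)
    (T : Tableau A enc N pick C) : A.IsNonempty := by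
  classical
  have hvn : ∀ o, A.ValidChoice o none := fun _ _ => .inl rfl
  have hnx := fun c => T.exists_step c none (hvn _)
  choose nx hnx using hnx
  -- Box's component is irrelevant in local steps, so the choice `none` fixes one chain.
  let loc : C → ℕ → C := fun c k => nx^[k] c
  have hloc0 : ∀ c, loc c 0 = c := fun _ => rfl
  have hlocs : ∀ c k, loc c (k + 1) = nx (loc c k) := fun c k => Function.iterate_succ_apply' nx k c
  have hlocal : ∀ c k, T.step (loc c k) none (loc c (k + 1)) := fun c k => by
    rw [hlocs]; exact hnx _
  have hterm : ∀ a U c, T.U c = U → T.lab c = a → ∃ k, pick (T.U (loc c k)) = none := by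
    intro a U
    induction U using (A.wellFounded_localDescent a).induction with
    | _ U ih =>
      intro c hc ha
      rcases ho : pick (T.U c) with _ | q
      · exact ⟨0, ho⟩
      · obtain ⟨k, hk⟩ := ih (T.U (nx c)) (by
          rw [T.U_step (hnx c), ← hc, ha]
          exact hN.localDescent hpick ho fun h => ha ▸ T.choice_mem ho h) (nx c) rfl
          (by rw [T.lab_step (hnx c) (by simp [ho]), ha])
        exact ⟨k + 1, hk⟩
  have hterm' : ∀ c, ∃ k, pick (T.U (loc c k)) = none := fun c => hterm _ _ c rfl rfl
  let last : C → ℕ := fun c => Nat.find (hterm' c)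
  have hlast : ∀ c, pick (T.U (loc c (last c))) = none := fun c => Nat.find_spec (hterm' c)
  have hlt : ∀ c k, k < last c → pick (T.U (loc c k)) ≠ none := fun c k hk =>
    Nat.find_min (hterm' c) hk
  have hlab : ∀ c k, k ≤ last c → T.lab (loc c k) = T.lab c := by
    intro c k
    induction k with
    | zero => intro _; rfl
    | succ k ih =>
      intro hk
      rw [T.lab_step (hlocal c k) (hlt c k hk), ih (by omega)]
  let K : Kripke α :=
    { W := C
      root := T.root
      R := fun c c' => ∃ p, T.step (loc c (last c)) p c'
      label := T.lab
      total := fun c => ⟨_, none, hnx _⟩ }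
  let trace : C × Q → C × Q → Prop := fun x x' => ∃ p, T.step x.1 p x'.1 ∧
    x'.2 ∈ N.δ x.2 (A.letter enc (pick (T.U x.1)) (T.lab x.1) (T.choice x.1) p)
  let wait : C × Q → C × Q → Prop := fun x x' => trace x x' ∧ x'.2 = x.2
  -- By induction on the number `d` of local steps that remain: the state survives until it is
  -- picked itself or the end of the chain is reached.
  have hadv : ∀ c q d k, k + d = last c → q ∈ T.U (loc c k) →
      ∃ j, k ≤ j ∧ j ≤ last c ∧ Relation.ReflTransGen wait (loc c k, q) (loc c j, q) ∧
        q ∈ T.U (loc c j) ∧ ((j < last c ∧ pick (T.U (loc c j)) = some q) ∨ j = last c) := by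
    intro c q d
    induction d with
    | zero => exact fun k hk hq => ⟨k, le_rfl, by omega, .refl, hq, .inr (by omega)⟩
    | succ d ih =>
      intro k hk hq
      rcases ho : pick (T.U (loc c k)) with _ | q₀
      · exact absurd ho (hlt c k (by omega))
      · by_cases hqq : q = q₀
        · exact ⟨k, le_rfl, by omega, .refl, hq, .inl ⟨by omega, by rw [ho, hqq]⟩⟩
        · have hstay : q ∈ N.δ q (A.letter enc (pick (T.U (loc c k))) (T.lab (loc c k))
              (T.choice (loc c k)) none) := by
            rw [ho]
            rcases (hpick.some ho).2.cases with hk | hk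
            · exact (hN.mem_of_existential hk).2 (.inr ⟨hqq, rfl⟩)
            · exact (hN.mem_of_universal hk).2 (.inr ⟨hqq, rfl⟩)
          obtain ⟨j, h1, h2, h3, h4⟩ := ih (k + 1) (by omega) (by
            rw [T.U_step (hlocal c k)]
            exact ⟨q, hq, hstay⟩)
          exact ⟨j, by omega, h2, .head (show wait (loc c k, q) (loc c (k + 1), q) from
            ⟨⟨none, hlocal c k, hstay⟩, rfl⟩) h3, h4⟩
  -- The first component is the world, the second the current node on its local chain. The position
  -- in the acceptance game depends on the world and the state only, so waiting is invisible there.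
  let M := {x : C × C × Q // (∃ k ≤ last x.1, x.2.1 = loc x.1 k) ∧ x.2.2 ∈ T.U x.2.1}
  let pos : M → K.W × Q := fun μ => (μ.1.1, μ.1.2.2)
  let step : M → M → Prop := fun μ μ' =>
    ∃ x, Relation.ReflTransGen wait μ.1.2 x ∧ trace x μ'.1.2
  let start : M := ⟨(T.root, T.root, A.init), ⟨0, Nat.zero_le _, rfl⟩, by simp [T.U_root]⟩
  refine ⟨K, (A.acceptanceGame K).wins_of_memory pos step start ?_ ?_ ?_⟩
  · rintro ⟨⟨c, cur, q⟩, ⟨k, hk, hcur⟩, hq⟩ hd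
    simp only at hk hcur hq
    subst hcur
    obtain ⟨j, h1, h2, h3, h4, ⟨h5, h6⟩ | rfl⟩ := hadv c q (last c - k) k (by omega) hq
    · have hloc := (hpick.some h6).2
      have hk : A.kind q = .localEx := by
        rcases hd with hd | hd
        · exact hd
        · rcases hloc.cases with h | h <;> simp only [h, pos] at hd <;> cases hd
      have htr : T.choice (loc c j) ∈ N.δ q (A.letter enc (pick (T.U (loc c j)))
          (T.lab (loc c j)) (T.choice (loc c j)) none) := by
        rw [h6, hN.mem_of_existential hk]; exact .inl ⟨rfl, rfl⟩
      refine ⟨⟨(c, loc c (j + 1), T.choice (loc c j)), ⟨j + 1, h5, rfl⟩, ?_⟩,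
        ⟨_, h3, none, hlocal c j, htr⟩, ?_, .inl ⟨hloc, rfl⟩⟩
      · simp only
        rw [T.U_step (hlocal c j)]
        exact ⟨q, h4, htr⟩
      · have := T.choice_mem h6 hk
        rwa [hlab c j h2] at this
    · have hnl := hpick.none (hlast c) q h4
      have hk : A.kind q = .modalEx := by
        rcases hd with hd | hd
        · exact absurd (.inl hd) hnl
        · exact hd
      -- Diamond moves to a child in which `q` is the modal-existential state that survives.
      have hv : A.ValidChoice none (some q) := fun _ => .inr ⟨q, rfl, hk⟩
      obtain ⟨c', hc'⟩ := T.exists_step (loc c (last c)) (some q) (by rw [hlast]; exact hv)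
      obtain ⟨q', hq'⟩ := A.modal_single q (T.lab c) (.inl hk)
      have hmem : q' ∈ A.δ q (T.lab c) := by rw [hq']; rfl
      have htr : q' ∈ N.δ q (A.letter enc (pick (T.U (loc c (last c))))
          (T.lab (loc c (last c))) (T.choice (loc c (last c))) (some q)) := by
        rw [hlast, hN.mem_of_modal hv, hlab c _ le_rfl]
        exact ⟨hmem, .inr ⟨rfl, hk⟩⟩
      refine ⟨⟨(c', c', q'), ⟨0, Nat.zero_le _, rfl⟩, ?_⟩, ⟨_, h3, some q, hc', htr⟩, hmem,
        .inr ⟨.inl hk, some q, hc'⟩⟩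
      simp only
      rw [T.U_step hc']
      exact ⟨q, h4, htr⟩
  · rintro ⟨⟨c, cur, q⟩, ⟨k, hk, hcur⟩, hq⟩ ⟨c', q'⟩ hd he
    simp only at hk hcur hq
    subst hcur
    obtain ⟨hmem, he⟩ := he
    simp only [pos] at hmem he
    obtain ⟨j, h1, h2, h3, h4, ⟨h5, h6⟩ | rfl⟩ := hadv c q (last c - k) k (by omega) hq
    · have hloc := (hpick.some h6).2
      have hkind : A.kind q = .localUniv := by
        rcases hloc.cases with h | h
        · exact absurd (.inl h) hd
        · exact h
      obtain rfl : c' = c := by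
        rcases he with h | h
        · exact h.2
        · rcases h.1 with h | h <;> rw [hkind] at h <;> cases h
      have htr : q' ∈ N.δ q (A.letter enc (pick (T.U (loc c' j)))
          (T.lab (loc c' j)) (T.choice (loc c' j)) none) := by
        rw [h6, hN.mem_of_universal hkind, hlab c' j h2]; exact .inl ⟨rfl, hmem⟩
      refine ⟨⟨(c', loc c' (j + 1), q'), ⟨j + 1, h5, rfl⟩, ?_⟩,
        ⟨_, h3, none, hlocal c' j, htr⟩, rfl⟩
      simp only
      rw [T.U_step (hlocal c' j)]
      exact ⟨q, h4, htr⟩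
    · have hnl := hpick.none (hlast c) q h4
      have hk : A.kind q = .modalUniv := by
        rcases StateKind.isModal_of_not_isLocal hnl with h | h
        · exact absurd (.inr h) hd
        · exact h
      obtain ⟨p, hp⟩ : K.R c c' := by
        rcases he with h | h
        · exact absurd h.1 hnl
        · exact h.2
      have hv := T.valid hp
      rw [hlast] at hv
      have htr : q' ∈ N.δ q (A.letter enc (pick (T.U (loc c (last c))))
          (T.lab (loc c (last c))) (T.choice (loc c (last c))) p) := by
        rw [hlast, hN.mem_of_modal hv, hlab c _ le_rfl]
        exact ⟨hmem, .inl hk⟩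
      refine ⟨⟨(c', c', q'), ⟨0, Nat.zero_le _, rfl⟩, ?_⟩, ⟨_, h3, p, hp, htr⟩, rfl⟩
      simp only
      rw [T.U_step hp]
      exact ⟨q, h4, htr⟩
  · intro ρ h0 hρ
    obtain ⟨y, φ, hφ, hy0, hy⟩ := exists_refinement (fun i => (ρ i).1.2) (fun _ => wait)
      (fun _ => trace) hρ
    have hstep : ∀ j, trace (y j) (y (j + 1)) := fun j => by
      rcases (hy j).2 with h | h
      · exact h.1.1
      · exact h.1
    choose ps hps using hstep
    have hconst : ∀ {x x' : C × Q}, Relation.ReflTransGen wait x x' → x'.2 = x.2 := by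
      intro x x' h
      induction h with
      | refl => rfl
      | tail _ h ih => exact h.2.trans ih
    have hgood := T.good (fun j => (y j).1) ps (by simp [hy0, h0, start]) fun j => (hps j).1
    rw [hN.notMem_language_iff] at hgood
    have hacc := hgood (fun j => (y j).2) ⟨by simp [hy0, h0, start, hN.init], fun j => (hps j).2⟩
    rw [← hφ.parityAccepting_iff]
    refine Eq.mp (congrArg ParityAccepting (funext fun j => ?_)) hacc
    rw [hconst (hy j).1]
    rfl

end Tracking

/-! ### The emptiness game -/

/-- A node of the emptiness game: the letter of the current world, if already chosen, the set of
states to be satisfied, the state of the word automaton, and the successor that Diamond chose for a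
local existential state. -/
structure View (α Q S : Type) where
  a : Option α
  U : Set Q
  h : S
  y : Option Q

section EmptinessGame

variable {α Q B S : Type}

/-- The moves of the emptiness game. If `det` holds, choosing a successor of a local existential
state and moving the word automaton are one step. -/
inductive EmptinessEdge (A : APT α Q) (enc : α → Option Q → Option Q → B) (N : NPW B Q)
    (pick : Set Q → Option Q) (H : NPW B S) (det : Prop) : View α Q S → View α Q S → Prop
  | label {U h} (a : α) : EmptinessEdge A enc N pick H det ⟨none, U, h, none⟩ ⟨some a, U, h, none⟩
  | choose {a U h q q'} : ¬ det → pick U = some q → A.kind q = .localEx → q' ∈ A.δ q a →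
      EmptinessEdge A enc N pick H det ⟨some a, U, h, none⟩ ⟨some a, U, h, some q'⟩
  | chosen {a U h q q' h'} : pick U = some q → h' ∈ H.δ h (enc a (some q) (some q')) →
      EmptinessEdge A enc N pick H det ⟨some a, U, h, some q'⟩
        ⟨some a, N.post U (enc a (some q) (some q')), h', none⟩
  | existential {a U h q q' h'} : det → pick U = some q → A.kind q = .localEx → q' ∈ A.δ q a →
      h' ∈ H.δ h (enc a (some q) (some q')) →
      EmptinessEdge A enc N pick H det ⟨some a, U, h, none⟩
        ⟨some a, N.post U (enc a (some q) (some q')), h', none⟩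
  | universal {a U h q h'} : pick U = some q → A.kind q = .localUniv →
      h' ∈ H.δ h (enc a (some q) none) →
      EmptinessEdge A enc N pick H det ⟨some a, U, h, none⟩
        ⟨some a, N.post U (enc a (some q) none), h', none⟩
  | modal {a U h p h'} : pick U = none → (p = none ∨ ∃ q, p = some q ∧ A.kind q = .modalEx) →
      h' ∈ H.δ h (enc a p none) →
      EmptinessEdge A enc N pick H det ⟨some a, U, h, none⟩
        ⟨none, N.post U (enc a p none), h', none⟩

/-- Diamond chooses letters and the successors of local existential states. -/
def APT.EmptinessDia (A : APT α Q) (pick : Set Q → Option Q) (v : View α Q S) : Prop :=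
  v.y = none ∧ (v.a = none ∨ ∃ q, pick v.U = some q ∧ A.kind q = .localEx)

/-- A parity game whose nodes represent the nodes of the emptiness game. -/
structure IsEmptinessGame (A : APT α Q) (enc : α → Option Q → Option Q → B) (N : NPW B Q)
    (pick : Set Q → Option Q) (H : NPW B S) (det : Prop) {V : Type} (G : ParityGame V)
    (view : V → View α Q S) : Prop where
  dia : ∀ v, G.dia v ↔ A.EmptinessDia pick (view v)
  edge : ∀ v v', G.edge v v' ↔ EmptinessEdge A enc N pick H det (view v) (view v')
  prio : ∀ v, G.prio v = H.prio (view v).h + 1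
  surj : ∀ x : View α Q S, (det → x.y = none) → ∃ v, view v = x

variable {A : APT α Q} {enc : α → Option Q → Option Q → B} {N : NPW B Q}
  {pick : Set Q → Option Q} {H : NPW B S} {det : Prop} {V : Type} {G : ParityGame V}
  {view : V → View α Q S}

theorem NPW.exists_prio_lt [Finite S] (H : NPW B S) : ∃ D, ∀ q, H.prio q < D := by
  obtain ⟨D, hD⟩ := (Set.finite_range H.prio).bddAbove
  exact ⟨D + 1, fun q => Nat.lt_succ_of_le (hD ⟨q, rfl⟩)⟩

/-- Diamond's winning strategy is played against a Box who moves `H` by the resolver and is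
otherwise free. The tableau nodes are the memory states reached, paired with the word read so far.
Diamond wins with raised priorities, so the resolver's run on each branch is rejecting, and by
history determinism the word lies outside the language of `H`, which is that of `N`. -/
theorem IsEmptinessGame.exists_tableau [Finite S] (hpick : IsPick A pick)
    (hG : IsEmptinessGame A enc N pick H det G view) (hHD : H.HistoryDeterministic)
    (hlang : H.language = N.language) (hdet : det → H.Deterministic) {v₀ : V}
    (hv₀ : view v₀ = ⟨none, {A.init}, H.init, none⟩) (hwin : G.Wins v₀) :
    ∃ C, Nonempty (Tableau A enc N pick C) := by
  classical
  obtain ⟨M, T, start, hstart⟩ := hwin.exists_strategySystem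
  obtain ⟨σ, ⟨hσ0, hσ1⟩, hσ⟩ := hHD
  let vw : M → View α Q S := fun μ => view (T.pos μ)
  let quiet : M → M → Prop := fun μ μ' => T.step μ μ' ∧ (vw μ').h = (vw μ).h
  let C := {c : M × List B // (vw c.1).h = σ c.2 ∧ (vw c.1).y = none}
  have hact : ∀ c : C, ∃ (μ : M) (a : α), Relation.ReflTransGen quiet c.1.1 μ ∧
      vw μ = ⟨some a, (vw c.1.1).U, σ c.1.2, none⟩ ∧ ∀ a', (vw c.1.1).a = some a' → a = a' := by
    rintro ⟨⟨μ, w⟩, hh, hy⟩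
    change ∃ (μ₁ : M) (a : α), Relation.ReflTransGen quiet μ μ₁ ∧
      vw μ₁ = ⟨some a, (vw μ).U, σ w, none⟩ ∧ ∀ a', (vw μ).a = some a' → a = a'
    rcases hv : vw μ with ⟨_ | a, U, h, y⟩
    · simp only [hv] at hh hy
      subst hh hy
      have hd : G.dia (T.pos μ) := by
        rw [hG.dia]; change A.EmptinessDia pick (vw μ); rw [hv]; exact ⟨rfl, .inl rfl⟩
      obtain ⟨μ', hμ'⟩ := T.dia μ hd
      have he := T.edge hμ'
      rw [hG.edge] at he
      change EmptinessEdge A enc N pick H det (vw μ) (vw μ') at he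
      rw [hv] at he
      generalize hv' : vw μ' = x at he
      cases he with
      | label a =>
        exact ⟨μ', a, .single ⟨hμ', by rw [hv', hv]⟩, by simp [hv'], fun a' h => by
          simp only at h; cases h⟩
    · simp only [hv] at hh hy
      subst hh hy
      exact ⟨μ, a, .refl, by simp only [hv], fun a' h => by
        simp only at h; exact Option.some_inj.1 h⟩
  choose act lab hquiet hact hlab using hact
  -- Diamond's choice is fixed before Box's component `p` is known. Where she has nothing to choose,
  -- `A.init` is a dummy.
  have hchoice : ∀ c : C, ∃ ch : Q,
      (∀ q, pick (vw c.1.1).U = some q → A.kind q = .localEx → ch ∈ A.δ q (lab c)) ∧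
      ∀ p, A.ValidChoice (pick (vw c.1.1).U) p → ∃ x μ', Relation.ReflTransGen quiet (act c) x ∧
        T.step x μ' ∧ vw μ' = ⟨if pick (vw c.1.1).U = none then none else some (lab c),
          N.post (vw c.1.1).U (A.letter enc (pick (vw c.1.1).U) (lab c) ch p),
          σ (c.1.2 ++ [A.letter enc (pick (vw c.1.1).U) (lab c) ch p]), none⟩ := by
    intro c
    have hv := hact c
    generalize (vw c.1.1).U = U at hv ⊢
    generalize c.1.2 = w at hv ⊢
    generalize lab c = a at hv ⊢
    generalize act c = μ at hv ⊢
    rcases ho : pick U with _ | q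
    · refine ⟨A.init, fun q hq => (by cases hq), fun p hp => ?_⟩
      obtain ⟨v', hv'⟩ := hG.surj ⟨none, N.post U (enc a p none), σ (w ++ [enc a p none]), none⟩
        fun _ => rfl
      obtain ⟨μ', hs, hμ'⟩ := T.box μ v' (by
          rw [hG.dia]; change ¬ A.EmptinessDia pick (vw μ); rw [hv]
          rintro ⟨-, h | ⟨q, h, -⟩⟩
          · cases h
          · simp only [ho] at h; cases h)
        (by
          rw [hG.edge]; change EmptinessEdge A enc N pick H det (vw μ) _; rw [hv, hv']
          exact .modal ho (hp rfl) (hσ1 _ _))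
      exact ⟨μ, μ', .refl, hs, by simp only [vw, hμ', hv', APT.letter, if_true]⟩
    · rcases (hpick.some ho).2.cases with hk | hk
      · have hd : G.dia (T.pos μ) := by
          rw [hG.dia]; change A.EmptinessDia pick (vw μ); rw [hv]; exact ⟨rfl, .inr ⟨q, ho, hk⟩⟩
        obtain ⟨μ₁, hμ₁⟩ := T.dia μ hd
        have he := T.edge hμ₁
        rw [hG.edge] at he
        change EmptinessEdge A enc N pick H det (vw μ) (vw μ₁) at he
        rw [hv] at he
        generalize hv₁ : vw μ₁ = x at he
        cases he with
        | @choose _ _ _ q₁ q' hnd h1 h2 h3 =>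
          obtain rfl : q = q₁ := by rw [ho] at h1; exact Option.some_inj.1 h1
          refine ⟨q', fun q₂ h4 _ => by rw [← Option.some_inj.1 h4]; exact h3, fun p _ => ?_⟩
          obtain ⟨v', hv'⟩ := hG.surj ⟨some a, N.post U (enc a (some q) (some q')),
            σ (w ++ [enc a (some q) (some q')]), none⟩ fun _ => rfl
          obtain ⟨μ', hs, hμ'⟩ := T.box μ₁ v' (by
              rw [hG.dia]; change ¬ A.EmptinessDia pick (vw μ₁); rw [hv₁]
              rintro ⟨h, -⟩
              cases h)
            (by
              rw [hG.edge]; change EmptinessEdge A enc N pick H det (vw μ₁) _; rw [hv₁, hv']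
              exact .chosen ho (hσ1 _ _))
          exact ⟨μ₁, μ', .single ⟨hμ₁, by rw [hv₁, hv]⟩, hs, by
            simp [vw, hμ', hv', APT.letter, hk]⟩
        | @existential _ _ _ q₁ q' h' hd h1 h2 h3 h4 =>
          obtain rfl : q = q₁ := by rw [ho] at h1; exact Option.some_inj.1 h1
          refine ⟨q', fun q₂ h4 _ => by rw [← Option.some_inj.1 h4]; exact h3, fun p _ => ?_⟩
          refine ⟨μ, μ₁, .refl, hμ₁, ?_⟩
          -- Here Diamond's own move also moves `H`; determinism forces it to agree with the
          -- resolver.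
          have := hdet hd _ _ h4 (hσ1 w _)
          simp [hv₁, APT.letter, hk, this]
        | universal h1 h2 =>
          rw [ho] at h1
          rw [← Option.some_inj.1 h1, hk] at h2
          cases h2
        | modal h1 => rw [ho] at h1; cases h1
      · refine ⟨A.init, fun q₁ h1 h2 => ?_, fun p _ => ?_⟩
        · rw [← Option.some_inj.1 h1, hk] at h2; cases h2
        · obtain ⟨v', hv'⟩ := hG.surj ⟨some a, N.post U (enc a (some q) none),
            σ (w ++ [enc a (some q) none]), none⟩ fun _ => rfl
          obtain ⟨μ', hs, hμ'⟩ := T.box μ v' (by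
              rw [hG.dia]; change ¬ A.EmptinessDia pick (vw μ); rw [hv]
              rintro ⟨-, h | ⟨q₁, h, h'⟩⟩
              · cases h
              · simp only [ho] at h; rw [← Option.some_inj.1 h, hk] at h'; cases h')
            (by
              rw [hG.edge]; change EmptinessEdge A enc N pick H det (vw μ) _; rw [hv, hv']
              exact .universal ho hk (hσ1 _ _))
          exact ⟨μ, μ', .refl, hs, by simp [vw, hμ', hv', APT.letter, hk]⟩
  choose choice hchmem hemit using hchoice
  let b : C → Option Q → B := fun c p =>
    A.letter enc (pick (vw c.1.1).U) (lab c) (choice c) p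
  have hroot : vw start = ⟨none, {A.init}, H.init, none⟩ := by simp only [vw, hstart, hv₀]
  refine ⟨C, ⟨{
    root := ⟨(start, []), by simp only [hroot, hσ0], by simp only [hroot]⟩
    U := fun c => (vw c.1.1).U
    lab := lab
    choice := choice
    step := fun c p c' => A.ValidChoice (pick (vw c.1.1).U) p ∧
      (vw c'.1.1).U = N.post (vw c.1.1).U (b c p) ∧
      (pick (vw c.1.1).U ≠ none → lab c' = lab c) ∧ c'.1.2 = c.1.2 ++ [b c p] ∧
      ∃ x, Relation.ReflTransGen quiet c.1.1 x ∧ T.step x c'.1.1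
    U_root := by simp only [hroot]
    choice_mem := fun h h' => hchmem _ _ h h'
    exists_step := ?_
    valid := fun h => h.1
    U_step := fun h => h.2.1
    lab_step := fun h => h.2.2.1
    good := ?_ }⟩⟩
  · intro c p hp
    obtain ⟨x, μ', h1, h2, h3⟩ := hemit c p hp
    refine ⟨⟨(μ', c.1.2 ++ [b c p]), by simp only [h3]; rfl, by simp only [h3]⟩, hp,
      by simp only [h3]; rfl, fun hne => ?_, rfl, x, (hquiet c).trans h1, h2⟩
    exact hlab _ _ (by simp only [h3, hne, if_false])
  · intro ρ ps h0 hρ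
    set w : ℕ → B := fun i => b (ρ i) (ps i) with hw
    change w ∉ N.language
    have hpre : ∀ i, (ρ i).1.2 = pre w i := by
      intro i
      induction i with
      | zero => rw [h0]; rfl
      | succ i ih => rw [(hρ i).2.2.2.1, ih, pre_succ]
    obtain ⟨y, φ, hφ, -, hy⟩ := exists_refinement (fun i => (ρ i).1.1) (fun _ => quiet)
      (fun _ => T.step) fun i => (hρ i).2.2.2.2
    have hacc := T.win y fun j => by
      rcases (hy j).2 with h | h
      · exact h.1.1
      · exact h.1
    have hconst : ∀ {x x' : M}, Relation.ReflTransGen quiet x x' → (vw x').h = (vw x).h := by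
      intro x x' h
      induction h with
      | refl => rfl
      | tail _ h ih => exact h.2.trans ih
    have heq : (fun j => G.prio (T.pos (y j))) = fun j => H.prio (σ (pre w (φ j))) + 1 := by
      funext j
      rw [hG.prio]
      change H.prio (vw (y j)).h + 1 = _
      rw [hconst (hy j).1, (ρ (φ j)).2.1, hpre]
    rw [heq, hφ.parityAccepting_iff fun i => H.prio (σ (pre w i)) + 1] at hacc
    obtain ⟨D, hD⟩ := H.exists_prio_lt
    rw [parityAccepting_succ_iff fun i => hD _] at hacc
    rwa [← hlang, hσ]

/-- The stages of a game round: the label is still to be chosen, the label is known, or a choice of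
Diamond awaits Box's transition of `H`. -/
inductive Phase
  | label
  | main
  | chosen

/-- The node of the emptiness game at a node of a tableau. -/
def Tableau.node {C : Type} (T : Tableau A enc N pick C) : Phase → C → S → View α Q S
  | .label, c, h => ⟨none, T.U c, h, none⟩
  | .main, c, h => ⟨some (T.lab c), T.U c, h, none⟩
  | .chosen, c, h => ⟨some (T.lab c), T.U c, h, some (T.choice c)⟩

/-- Diamond copies labels and choices from the tableau and follows Box's branch in it. Whatever
transitions are taken, the states of `H` form a run on a word outside the language, which is
rejecting; with raised priorities the play is won. -/
theorem IsEmptinessGame.wins [Finite S]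
    (hG : IsEmptinessGame A enc N pick H det G view) (hHD : H.HistoryDeterministic)
    (hlang : H.language = N.language) (hdet : det → H.Deterministic) {v₀ : V}
    (hv₀ : view v₀ = ⟨none, {A.init}, H.init, none⟩) {C : Type} (T : Tableau A enc N pick C) :
    G.Wins v₀ := by
  classical
  obtain ⟨σ, ⟨hσ0, hσ1⟩, -⟩ := hHD
  let b : C → Option Q → B := fun c p => A.letter enc (pick (T.U c)) (T.lab c) (T.choice c) p
  -- In the merged game Diamond must exhibit a transition of `H`. Tying the state of `H` to the
  -- resolver's state guarantees one; in the other game Box supplies the transition and no such tie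
  -- is needed.
  let M := {x : V × Phase × C × S × List B // view x.1 = T.node x.2.1 x.2.2.1 x.2.2.2.1 ∧
    (x.2.1 = .chosen → ∃ q, pick (T.U x.2.2.1) = some q ∧ A.kind q = .localEx) ∧
    (det → x.2.2.2.1 = σ x.2.2.2.2)}
  let ph : M → Phase := fun μ => μ.1.2.1
  let node : M → C := fun μ => μ.1.2.2.1
  let st : M → S := fun μ => μ.1.2.2.2.1
  let word : M → List B := fun μ => μ.1.2.2.2.2
  let quiet : M → M → Prop := fun μ μ' => node μ' = node μ ∧ st μ' = st μ ∧
    ((ph μ = .label ∧ ph μ' = .main) ∨ (ph μ = .main ∧ ph μ' = .chosen))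
  let emit : M → M → Prop := fun μ μ' => ∃ p, T.step (node μ) p (node μ') ∧
    st μ' ∈ H.δ (st μ) (b (node μ) p)
  let start : M := ⟨(v₀, .label, T.root, H.init, []), by
    simp only [hv₀, Tableau.node, T.U_root], fun h => (by cases h), fun _ => hσ0.symm⟩
  -- Every move that emits a letter leads to a memory state again.
  have hemit : ∀ (μ : M) (p : Option Q) (h' : S) (v' : V),
      A.ValidChoice (pick (T.U (node μ))) p →
      h' ∈ H.δ (st μ) (b (node μ) p) →
      view v' = ⟨if pick (T.U (node μ)) = none then none else some (T.lab (node μ)),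
        N.post (T.U (node μ)) (b (node μ) p), h', none⟩ →
      ∃ μ', emit μ μ' ∧ μ'.1.1 = v' := by
    intro μ p h' v' hp hh hv'
    obtain ⟨c', hc'⟩ := T.exists_step _ p hp
    refine ⟨⟨(v', if pick (T.U (node μ)) = none then .label else .main, c', h',
      word μ ++ [b (node μ) p]), ?_, fun h => ?_, fun hd => ?_⟩, ⟨p, hc', hh⟩, rfl⟩
    · simp only [hv']
      by_cases ho : pick (T.U (node μ)) = none
      · simp only [ho, if_true, Tableau.node, T.U_step hc', b]
      · simp only [ho, if_false, Tableau.node, T.U_step hc', T.lab_step hc' ho, b]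
    · simp only at h
      split_ifs at h
    · have h1 := hσ1 (word μ) (b (node μ) p)
      have h2 : st μ = σ (word μ) := μ.2.2.2 hd
      rw [← h2] at h1
      exact hdet hd _ _ hh h1
  have hvalid : ∀ {o : Option Q} {q}, o = some q → A.ValidChoice o none := fun _ _ => .inl rfl
  refine G.wins_of_memory (M := M) (fun μ => μ.1.1) (fun μ μ' => quiet μ μ' ∨ emit μ μ') start
    ?_ ?_ ?_
  · intro μ hd
    rw [hG.dia, μ.2.1] at hd
    simp only [hG.edge, μ.2.1]
    rcases hph : μ.1.2.1
    · rw [hph] at hd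
      obtain ⟨v', hv'⟩ := hG.surj (T.node .main (node μ) (st μ)) fun _ => rfl
      refine ⟨⟨(v', .main, node μ, st μ, word μ), hv', fun h => (by cases h), μ.2.2.2⟩,
        .inl ⟨rfl, rfl, .inl ⟨hph, rfl⟩⟩, by rw [hv']; exact .label _⟩
    · rw [hph] at hd
      obtain ⟨-, h | ⟨q, hq, hk⟩⟩ := hd
      · cases h
      have hmem := T.choice_mem hq hk
      by_cases hdt : det
      · have h1 := hσ1 (word μ) (b (node μ) none)
        have h2 : st μ = σ (word μ) := μ.2.2.2 hdt
        rw [← h2] at h1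
        obtain ⟨v', hv'⟩ := hG.surj ⟨some (T.lab (node μ)), N.post (T.U (node μ)) (b (node μ) none),
          σ (word μ ++ [b (node μ) none]), none⟩ fun _ => rfl
        change pick (T.U (node μ)) = some q at hq
        obtain ⟨μ', h3, rfl⟩ := hemit μ none _ v' (hvalid hq) h1 (by simp [hv', hq])
        refine ⟨μ', .inr h3, ?_⟩
        rw [hv']
        simp only [b, hq, APT.letter, hk, if_true] at h1 ⊢
        exact .existential hdt hq hk hmem h1
      · obtain ⟨v', hv'⟩ := hG.surj (T.node .chosen (node μ) (st μ)) fun h => absurd h hdt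
        exact ⟨⟨(v', .chosen, node μ, st μ, word μ), hv', fun _ => ⟨q, hq, hk⟩, μ.2.2.2⟩,
          .inl ⟨rfl, rfl, .inr ⟨hph, rfl⟩⟩, by rw [hv']; exact .choose hdt hq hk hmem⟩
    · rw [hph] at hd
      cases hd.1
  · intro μ v' hd he
    rw [hG.dia, μ.2.1] at hd
    rw [hG.edge, μ.2.1] at he
    rcases hph : μ.1.2.1
    · rw [hph] at hd
      exact absurd ⟨rfl, .inl rfl⟩ hd
    · rw [hph] at hd he
      simp only [Tableau.node] at he hd
      generalize hx : view v' = x at he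
      cases he with
      | choose _ h1 h2 => exact absurd ⟨rfl, .inr ⟨_, h1, h2⟩⟩ hd
      | existential _ h1 h2 => exact absurd ⟨rfl, .inr ⟨_, h1, h2⟩⟩ hd
      | universal h1 h2 h3 =>
        obtain ⟨μ', h4, h5⟩ := hemit μ none _ v' (hvalid h1)
          (by simpa [b, node, h1, APT.letter, h2] using h3)
          (by simp [b, node, h1, APT.letter, h2, hx])
        exact ⟨μ', .inr h4, h5⟩
      | @modal _ _ _ p _ h1 h2 h3 =>
        obtain ⟨μ', h4, h5⟩ := hemit μ p _ v' (fun _ => h2)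
          (by simpa [b, node, h1, APT.letter] using h3)
          (by simp [b, node, h1, APT.letter, hx])
        exact ⟨μ', .inr h4, h5⟩
    · obtain ⟨q, hq, hk⟩ := μ.2.2.1 hph
      rw [hph] at hd he
      simp only [Tableau.node] at he hd
      generalize hx : view v' = x at he
      cases he with
      | chosen h1 h3 =>
        rw [hq] at h1
        cases h1
        obtain ⟨μ', h4, h5⟩ := hemit μ none _ v' (hvalid hq)
          (by simpa [b, node, hq, APT.letter, hk] using h3)
          (by simp [b, node, hq, APT.letter, hk, hx])
        exact ⟨μ', .inr h4, h5⟩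
  · intro ρ h0 hρ
    have hq : ∀ i, ¬ emit (ρ i) (ρ (i + 1)) → quiet (ρ i) (ρ (i + 1)) := fun i h => by
      rcases hρ i with h' | h'
      · exact h'
      · exact absurd h' h
    -- Quiet moves only advance the phase, from `label` to `main` to `chosen`, so three in a row are
    -- impossible.
    have hinf : ∀ i, ∃ j, i ≤ j ∧ emit (ρ j) (ρ (j + 1)) := by
      intro i
      by_contra hno
      push Not at hno
      have h1 := (hq i (hno i le_rfl)).2.2
      have h2 := (hq (i + 1) (hno _ (by omega))).2.2
      have h3 := (hq (i + 2) (hno _ (by omega))).2.2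
      rcases h1 with h1 | h1 <;> rcases h2 with h2 | h2 <;> rcases h3 with h3 | h3 <;>
        simp_all
    obtain ⟨ψ, φ, hφ, hψ, hx0, hx1, hx⟩ := exists_contraction (fun i => (node (ρ i), st (ρ i)))
      (fun i => emit (ρ i) (ρ (i + 1))) hinf fun i hi =>
        Prod.ext (hq i hi).1 (hq i hi).2.1
    choose ps hps1 hps2 using hψ
    have hnode : ∀ j, node (ρ (ψ j + 1)) = node (ρ (ψ (j + 1))) := fun j =>
      (congrArg Prod.fst (hx1 j)).symm
    have hst : ∀ j, st (ρ (ψ j + 1)) = st (ρ (ψ (j + 1))) := fun j =>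
      (congrArg Prod.snd (hx1 j)).symm
    have hgood := T.good (fun j => node (ρ (ψ j))) ps
      ((congrArg Prod.fst hx0).trans (by rw [h0])) fun j => by
        simp only [← hnode]; exact hps1 j
    have hprio : ∀ i, G.prio (ρ i).1.1 = H.prio (st (ρ i)) + 1 := fun i => by
      rw [hG.prio, (ρ i).2.1]
      cases hp : (ρ i).1.2.1 <;> rfl
    obtain ⟨D, hD⟩ := H.exists_prio_lt
    have heq : (fun i => G.prio (ρ i).1.1) = fun i => H.prio (st (ρ (ψ (φ i)))) + 1 := by
      funext i
      rw [hprio, show st (ρ i) = st (ρ (ψ (φ i))) from congrArg Prod.snd (hx i)]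
    rw [heq, hφ.parityAccepting_iff fun j => H.prio (st (ρ (ψ j))) + 1,
      parityAccepting_succ_iff fun i => hD _]
    intro hacc
    rw [← hlang] at hgood
    refine hgood ⟨fun j => st (ρ (ψ j)), ⟨(congrArg Prod.snd hx0).trans (by rw [h0]), fun j => ?_⟩,
      hacc⟩
    simp only [← hst]
    exact hps2 j

/-- Diamond wins the emptiness game if and only if the tree automaton is not empty. -/
theorem IsEmptinessGame.wins_iff [Finite S] [Finite Q] (hN : IsTracker A enc N)
    (hpick : IsPick A pick) (hG : IsEmptinessGame A enc N pick H det G view)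
    (hHD : H.HistoryDeterministic) (hlang : H.language = N.language)
    (hdet : det → H.Deterministic) {v₀ : V}
    (hv₀ : view v₀ = ⟨none, {A.init}, H.init, none⟩) : G.Wins v₀ ↔ A.IsNonempty := by
  constructor
  · intro h
    obtain ⟨C, ⟨T⟩⟩ := hG.exists_tableau hpick hHD hlang hdet hv₀ h
    exact T.isNonempty hN hpick
  · intro h
    obtain ⟨C, ⟨T⟩⟩ := exists_tableau_of_isNonempty hN hpick h
    exact hG.wins hHD hlang hdet hv₀ T

end EmptinessGame

/-! ### Renaming the arrays of a program -/

def Expr.rename (f : ℕ → ℕ) : Expr → Expr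
  | .const c => .const c
  | .get arr i j k => .get (f arr) (i.rename f) (j.rename f) (k.rename f)
  | .plus e e' => .plus (e.rename f) (e'.rename f)
  | .minus e e' => .minus (e.rename f) (e'.rename f)
  | .half e => .half (e.rename f)

def Prog.rename (f : ℕ → ℕ) : Prog → Prog
  | .skip => .skip
  | .assign arr i j k e => .assign (f arr) (i.rename f) (j.rename f) (k.rename f) (e.rename f)
  | .seq p q => .seq (p.rename f) (q.rename f)
  | .cond e p q => .cond (e.rename f) (p.rename f) (q.rename f)
  | .loop e p => .loop (e.rename f) (p.rename f)

theorem Expr.cost_rename (f : ℕ → ℕ) (e : Expr) : (e.rename f).cost = e.cost := by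
  induction e <;> simp_all [Expr.rename, Expr.cost]

theorem Expr.eval_rename {f : ℕ → ℕ} {st st₁ : Store} (h : ∀ a, st₁ (f a) = st a) (e : Expr) :
    (e.rename f).eval st₁ = e.eval st := by
  induction e <;> simp_all [Expr.rename, Expr.eval]

theorem Store.write_apply (st : Store) (arr i j k x arr' : ℕ) (i' j' k' : ℕ) :
    st.write arr i j k x arr' i' j' k' =
      open Classical in
      if arr' = arr ∧ i' = i ∧ j' = j ∧ k' = k then x else st arr' i' j' k' := rfl

theorem Store.write_of_ne (st : Store) {arr arr' : ℕ} (h : arr' ≠ arr) (i j k x : ℕ) :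
    st.write arr i j k x arr' = st arr' := by
  funext i' j' k'
  simp [Store.write_apply, h]

/-- The renamed program does the same in the same time and leaves all arrays outside the range of
`f` alone. Two programs with disjoint ranges can thus share one memory without cleaning up. -/
theorem Run.rename {f : ℕ → ℕ} (hf : Function.Injective f) {p : Prog} {st st' : Store} {t : ℕ}
    (h : Run p st t st') : ∀ st₁ : Store, (∀ a, st₁ (f a) = st a) →
      ∃ st₁', Run (p.rename f) st₁ t st₁' ∧ (∀ a, st₁' (f a) = st' a) ∧
        ∀ b, b ∉ Set.range f → st₁' b = st₁ b := by
  induction h with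
  | skip st => exact fun st₁ h => ⟨st₁, .skip _, h, fun _ _ => rfl⟩
  | assign arr i j k e st =>
    intro st₁ h
    have hr := Run.assign (f arr) (i.rename f) (j.rename f) (k.rename f) (e.rename f) st₁
    simp only [Expr.cost_rename, Expr.eval_rename h] at hr
    refine ⟨_, hr, fun a => ?_, fun b hb => Store.write_of_ne _ (fun he => hb ⟨arr, he.symm⟩) _ _ _ _⟩
    funext i' j' k'
    simp only [Store.write_apply, hf.eq_iff, h]
  | seq _ _ ih ih' =>
    intro st₁ h
    obtain ⟨st₂, h1, h2, h3⟩ := ih st₁ h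
    obtain ⟨st₃, h4, h5, h6⟩ := ih' st₂ h2
    exact ⟨st₃, .seq h1 h4, h5, fun b hb => (h6 b hb).trans (h3 b hb)⟩
  | @condTrue e p q _ _ _ he _ ih =>
    intro st₁ h
    obtain ⟨st₂, h1, h2⟩ := ih st₁ h
    have hr := Run.condTrue (e := e.rename f) (q := q.rename f)
      (by rwa [Expr.eval_rename h]) h1
    rw [Expr.cost_rename] at hr
    exact ⟨st₂, hr, h2⟩
  | @condFalse e p q _ _ _ he _ ih =>
    intro st₁ h
    obtain ⟨st₂, h1, h2⟩ := ih st₁ h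
    have hr := Run.condFalse (e := e.rename f) (p := p.rename f)
      (by rwa [Expr.eval_rename h]) h1
    rw [Expr.cost_rename] at hr
    exact ⟨st₂, hr, h2⟩
  | @loopTrue e _ _ _ _ _ _ he _ _ ih ih' =>
    intro st₁ h
    obtain ⟨st₂, h1, h2, h3⟩ := ih st₁ h
    obtain ⟨st₃, h4, h5, h6⟩ := ih' st₂ h2
    have hr := Run.loopTrue (e := e.rename f) (by rwa [Expr.eval_rename h]) h1 h4
    rw [Expr.cost_rename] at hr
    exact ⟨st₃, hr, h5, fun b hb => (h6 b hb).trans (h3 b hb)⟩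
  | @loopFalse e p _ he =>
    intro st₁ h
    have hr := Run.loopFalse (e := e.rename f) (p := p.rename f)
      (by rwa [Expr.eval_rename h])
    rw [Expr.cost_rename] at hr
    exact ⟨st₁, hr, h, fun _ _ => rfl⟩

/-! ### A term language with bounded iteration

Array `4` holds the bounds of iterations, array `5` is scratch memory: its cells `(x, 0, 0)` are
variables, its cells `(d, 1, 0)` intermediate results. -/

inductive Tm
  | const (c : ℕ)
  | var (x : ℕ)
  | get (arr : ℕ) (i j k : Tm)
  | plus (s t : Tm)
  | minus (s t : Tm)
  | half (t : Tm)
  | ite (c s t : Tm)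
  /-- Iterate `step` as often as cell `b` of array `4` says. In `step`, the variable `x` is the
  number of the iteration and `x + 1` is the current value. -/
  | fold (x b : ℕ) (init step : Tm)

def Tm.eval (st : Store) : (ℕ → ℕ) → Tm → ℕ
  | _, .const c => c
  | env, .var x => env x
  | env, .get arr i j k => st arr (i.eval st env) (j.eval st env) (k.eval st env)
  | env, .plus s t => s.eval st env + t.eval st env
  | env, .minus s t => s.eval st env - t.eval st env
  | env, .half t => t.eval st env / 2
  | env, .ite c s t => if c.eval st env = 0 then t.eval st env else s.eval st env
  | env, .fold x b init step =>
    Nat.rec (init.eval st env)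
      (fun j acc => step.eval st (Function.update (Function.update env x j) (x + 1) acc))
      (st 4 b 0 0)

/-- The term uses variables below `v` only, and its bound variables are numbered consecutively. -/
def Tm.wf : ℕ → Tm → Bool
  | _, .const _ => true
  | v, .var x => x < v
  | v, .get _ i j k => i.wf v && j.wf v && k.wf v
  | v, .plus s t => s.wf v && t.wf v
  | v, .minus s t => s.wf v && t.wf v
  | v, .half t => t.wf v
  | v, .ite c s t => c.wf v && s.wf v && t.wf v
  | v, .fold x _ init step => x == v && init.wf v && step.wf (v + 2)

/-- The term does not read the given arrays. -/
def Tm.avoids (l : List ℕ) : Tm → Bool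
  | .const _ => true
  | .var _ => true
  | .get arr i j k => !(l.contains arr) && i.avoids l && j.avoids l && k.avoids l
  | .plus s t => s.avoids l && t.avoids l
  | .minus s t => s.avoids l && t.avoids l
  | .half t => t.avoids l
  | .ite c s t => c.avoids l && s.avoids l && t.avoids l
  | .fold _ _ init step => init.avoids l && step.avoids l

theorem Tm.eval_congr {l : List ℕ} (hl : 4 ∉ l) {st st' : Store} (h : ∀ a, a ∉ l → st' a = st a)
    (t : Tm) (ht : t.avoids l = true) (env : ℕ → ℕ) : t.eval st' env = t.eval st env := by
  induction t generalizing env with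
  | fold x b init step ih ih' =>
    simp only [Tm.avoids, Bool.and_eq_true] at ht
    simp only [Tm.eval, h 4 hl, ih ht.1, ih' ht.2]
  | get arr i j k hi hj hk =>
    simp only [Tm.avoids, Bool.and_eq_true, Bool.not_eq_true', List.contains_eq_mem,
      decide_eq_false_iff_not] at ht
    simp only [Tm.eval, h arr ht.1.1.1, hi ht.1.1.2, hj ht.1.2, hk ht.2]
  | _ => simp_all [Tm.eval, Tm.avoids]

def varE (x : ℕ) : Expr := .get 5 (.const x) (.const 0) (.const 0)
def tmpE (d : ℕ) : Expr := .get 5 (.const d) (.const 1) (.const 0)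
def sizeE (b : ℕ) : Expr := .get 4 (.const b) (.const 0) (.const 0)
def setVar (x : ℕ) (e : Expr) : Prog := .assign 5 (.const x) (.const 0) (.const 0) e
def setTmp (d : ℕ) (e : Expr) : Prog := .assign 5 (.const d) (.const 1) (.const 0) e

/-- Count the variable `x` up to the contents of cell `b` of array `4`. -/
def forLoop (x b : ℕ) (body : Prog) : Prog :=
  .seq (setVar x (.const 0))
    (.loop (.minus (sizeE b) (varE x)) (.seq body (setVar x (.plus (varE x) (.const 1)))))

/-- A program that leaves the value of a term in the intermediate result `d`. -/
def Tm.compile : Tm → ℕ → Prog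
  | .const c, d => setTmp d (.const c)
  | .var x, d => setTmp d (varE x)
  | .get arr i j k, d => .seq (i.compile d) (.seq (j.compile (d + 1)) (.seq (k.compile (d + 2))
      (setTmp d (.get arr (tmpE d) (tmpE (d + 1)) (tmpE (d + 2))))))
  | .plus s t, d => .seq (s.compile d) (.seq (t.compile (d + 1))
      (setTmp d (.plus (tmpE d) (tmpE (d + 1)))))
  | .minus s t, d => .seq (s.compile d) (.seq (t.compile (d + 1))
      (setTmp d (.minus (tmpE d) (tmpE (d + 1)))))
  | .half t, d => .seq (t.compile d) (setTmp d (.half (tmpE d)))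
  | .ite c s t, d => .seq (c.compile d) (.cond (tmpE d) (s.compile d) (t.compile d))
  | .fold x b init step, d => .seq (init.compile d) (.seq (setVar (x + 1) (tmpE d))
      (.seq (forLoop x b (.seq (step.compile d) (setVar (x + 1) (tmpE d))))
        (setTmp d (varE (x + 1)))))

/-- A bound for the running time of the compiled term, if array `4` holds numbers up to `B`. -/
def Tm.cost (B : ℕ) : Tm → ℕ
  | .const _ => 5
  | .var _ => 8
  | .get _ i j k => i.cost B + j.cost B + k.cost B + 17
  | .plus s t => s.cost B + t.cost B + 13
  | .minus s t => s.cost B + t.cost B + 13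
  | .half t => t.cost B + 9
  | .ite c s t => c.cost B + s.cost B + t.cost B + 5
  | .fold _ _ init step => init.cost B + B * (step.cost B + 28) + 31

/-- Loop rule with invariant `I j` at counter value `j`. Initializing the counter costs 5 and each
test 10, hence 15 in all besides the iterations; incrementing costs another 10, hence 20 per
iteration on top of the body. -/
theorem forLoop_run {x b n c : ℕ} {body : Prog} (I : ℕ → Store → Prop)
    (hI : ∀ j st, I j st → st 5 x 0 0 = j ∧ st 4 b 0 0 = n)
    (hbody : ∀ j < n, ∀ st, I j st → ∃ t st', Run body st t st' ∧ t ≤ c ∧ st' 5 x 0 0 = j ∧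
      I (j + 1) (st'.write 5 x 0 0 (j + 1)))
    {st : Store} (h0 : I 0 (st.write 5 x 0 0 0)) :
    ∃ t st', Run (forLoop x b body) st t st' ∧ t ≤ 15 + n * (c + 20) ∧ I n st' := by
  have key : ∀ d j st, j + d = n → I j st →
      ∃ t st', Run (.loop (.minus (sizeE b) (varE x))
        (.seq body (setVar x (.plus (varE x) (.const 1))))) st t st' ∧
        t ≤ 10 + d * (c + 20) ∧ I n st' := by
    intro d
    induction d with
    | zero =>
      intro j st hj hst
      obtain ⟨h1, h2⟩ := hI j st hst
      refine ⟨_, st, .loopFalse ?_, ?_, ?_⟩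
      · simp only [Expr.eval, sizeE, varE, h1, h2]; omega
      · simp [Expr.cost, sizeE, varE]
      · rwa [← hj]
    | succ d ih =>
      intro j st hj hst
      obtain ⟨h1, h2⟩ := hI j st hst
      obtain ⟨t, st', h3, h4, h5, h6⟩ := hbody j (by omega) st hst
      have h7 := Run.assign 5 (.const x) (.const 0) (.const 0) (.plus (varE x) (.const 1)) st'
      simp only [Expr.eval, varE, h5] at h7
      obtain ⟨t', st'', h8, h9, h10⟩ := ih (j + 1) _ (by omega) h6
      refine ⟨_, st'', .loopTrue ?_ (.seq h3 h7) h8, ?_, h10⟩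
      · simp only [Expr.eval, sizeE, varE, h1, h2]; omega
      · simp only [Expr.cost, sizeE, varE]
        ring_nf at h9 ⊢
        omega
  obtain ⟨t, st', h1, h2, h3⟩ := key n 0 _ (by omega) h0
  refine ⟨_, st', .seq (Run.assign 5 _ _ _ _ st) h1, ?_, h3⟩
  simp only [Expr.cost]
  omega

/-- The second memory agrees with the first one outside of scratch memory, on the variables below
`v`, and on the intermediate results below `d`. -/
structure Agree (v d : ℕ) (st st' : Store) : Prop where
  arr : ∀ a, a ≠ 5 → st' a = st a
  var : ∀ x < v, st' 5 x 0 0 = st 5 x 0 0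
  tmp : ∀ e < d, st' 5 e 1 0 = st 5 e 1 0

theorem Agree.trans {v d : ℕ} {st st' st'' : Store} (h : Agree v d st st')
    (h' : Agree v d st' st'') : Agree v d st st'' :=
  ⟨fun a ha => (h'.arr a ha).trans (h.arr a ha), fun x hx => (h'.var x hx).trans (h.var x hx),
    fun e he => (h'.tmp e he).trans (h.tmp e he)⟩

theorem Agree.mono {v d v' d' : ℕ} {st st' : Store} (h : Agree v d st st') (hv : v' ≤ v)
    (hd : d' ≤ d) : Agree v' d' st st' :=
  ⟨h.arr, fun x hx => h.var x (by omega), fun e he => h.tmp e (by omega)⟩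

theorem Agree.write_tmp {v d : ℕ} (st : Store) (x : ℕ) : Agree v d st (st.write 5 d 1 0 x) :=
  ⟨fun a ha => Store.write_of_ne _ ha _ _ _ _, fun y hy => by simp [Store.write_apply],
    fun e he => by simp [Store.write_apply, he.ne]⟩

theorem Agree.write_var {v d : ℕ} (st : Store) {y : ℕ} (hy : v ≤ y) (x : ℕ) :
    Agree v d st (st.write 5 y 0 0 x) :=
  ⟨fun a ha => Store.write_of_ne _ ha _ _ _ _, fun z hz => by
      have : z ≠ y := by omega
      simp [Store.write_apply, this],
    fun e he => by simp [Store.write_apply]⟩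

theorem setTmp_run (d : ℕ) (e : Expr) (st : Store) :
    Run (setTmp d e) st (e.cost + 4) (st.write 5 d 1 0 (e.eval st)) := by
  have := Run.assign 5 (.const d) (.const 1) (.const 0) e st
  simp only [Expr.cost, Expr.eval] at this
  rwa [show 1 + 1 + 1 + e.cost + 1 = e.cost + 4 by omega] at this

theorem setVar_run (d : ℕ) (e : Expr) (st : Store) :
    Run (setVar d e) st (e.cost + 4) (st.write 5 d 0 0 (e.eval st)) := by
  have := Run.assign 5 (.const d) (.const 0) (.const 0) e st
  simp only [Expr.cost, Expr.eval] at this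
  rwa [show 1 + 1 + 1 + e.cost + 1 = e.cost + 4 by omega] at this

theorem Store.write_same (st : Store) (arr i j k x : ℕ) : st.write arr i j k x arr i j k = x := by
  simp [Store.write_apply]

/-- Intermediate results form a stack: a subterm compiled at depth `d` may overwrite results from
`d` on and variables from `v` on, but nothing below. As bound variables are numbered consecutively,
a nested iteration never overwrites the counter or the accumulator of an enclosing one. -/
theorem Tm.compile_run {B : ℕ} (t : Tm) : ∀ (v d : ℕ) (st : Store) (env : ℕ → ℕ),
    t.wf v = true → t.avoids [5] = true → (∀ b, st 4 b 0 0 ≤ B) → (∀ x < v, st 5 x 0 0 = env x) →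
    ∃ T st', Run (t.compile d) st T st' ∧ T ≤ t.cost B ∧ st' 5 d 1 0 = t.eval st env ∧
      Agree v d st st' := by
  have h45 : 4 ∉ [5] := by simp
  have hev : ∀ (t : Tm) {v d st st'}, Agree v d st st' → t.avoids [5] = true → ∀ env,
      t.eval st' env = t.eval st env := fun t v d st st' h ht env =>
    t.eval_congr h45 (fun a ha => h.arr a (by simpa using ha)) ht env
  have hB : ∀ {v d} {st st' : Store}, Agree v d st st' → (∀ b, st 4 b 0 0 ≤ B) →
      ∀ b, st' 4 b 0 0 ≤ B := fun h hb b => by rw [h.arr 4 (by omega)]; exact hb b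
  have hE : ∀ {v d} {st st' : Store} {env : ℕ → ℕ}, Agree v d st st' →
      (∀ x < v, st 5 x 0 0 = env x) → ∀ x < v, st' 5 x 0 0 = env x := fun h he x hx => by
    rw [h.var x hx]; exact he x hx
  induction t with
  | const c =>
    intro v d st env _ _ _ _
    exact ⟨_, _, setTmp_run d _ st, le_rfl, Store.write_same .., .write_tmp st _⟩
  | var x =>
    intro v d st env hwf _ _ henv
    refine ⟨_, _, setTmp_run d _ st, le_rfl, ?_, .write_tmp st _⟩
    rw [Store.write_same]
    exact henv x (by simpa [Tm.wf] using hwf)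
  | get arr i j k hi hj hk =>
    intro v d st env hwf hav hb henv
    simp only [Tm.avoids, Bool.and_eq_true, Bool.not_eq_true', List.contains_eq_mem,
      decide_eq_false_iff_not, List.mem_singleton] at hav
    simp only [Tm.wf, Bool.and_eq_true] at hwf
    obtain ⟨T1, st1, r1, c1, e1, a1⟩ := hi v d st env hwf.1.1 hav.1.1.2 hb henv
    obtain ⟨T2, st2, r2, c2, e2, a2⟩ := hj v (d + 1) st1 env hwf.1.2 hav.1.2 (hB a1 hb)
      (hE a1 henv)
    obtain ⟨T3, st3, r3, c3, e3, a3⟩ := hk v (d + 2) st2 env hwf.2 hav.2 (hB a2 (hB a1 hb))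
      (hE a2 (hE a1 henv))
    have a12 := a1.trans (a2.mono le_rfl (by omega))
    have a13 := a12.trans (a3.mono le_rfl (by omega))
    refine ⟨_, _, .seq r1 (.seq r2 (.seq r3 (setTmp_run d _ st3))), ?_, ?_,
      a13.trans (.write_tmp st3 _)⟩
    · simp only [Expr.cost, tmpE, Tm.cost]; omega
    · rw [Store.write_same]
      simp only [Expr.eval, tmpE, Tm.eval]
      rw [e3, a3.tmp (d + 1) (by omega), e2, a3.tmp d (by omega), a2.tmp d (by omega), e1,
        a13.arr arr hav.1.1.1, hev j a1 hav.1.2, hev k a12 hav.2]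
  | plus s t hs ht =>
    intro v d st env hwf hav hb henv
    simp only [Tm.avoids, Bool.and_eq_true] at hav
    simp only [Tm.wf, Bool.and_eq_true] at hwf
    obtain ⟨T1, st1, r1, c1, e1, a1⟩ := hs v d st env hwf.1 hav.1 hb henv
    obtain ⟨T2, st2, r2, c2, e2, a2⟩ := ht v (d + 1) st1 env hwf.2 hav.2 (hB a1 hb) (hE a1 henv)
    refine ⟨_, _, .seq r1 (.seq r2 (setTmp_run d _ st2)), ?_, ?_,
      (a1.trans (a2.mono le_rfl (by omega))).trans (.write_tmp st2 _)⟩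
    · simp only [Expr.cost, tmpE, Tm.cost]; omega
    · rw [Store.write_same]
      simp only [Expr.eval, tmpE, Tm.eval]
      rw [e2, a2.tmp d (by omega), e1, hev t a1 hav.2]
  | minus s t hs ht =>
    intro v d st env hwf hav hb henv
    simp only [Tm.avoids, Bool.and_eq_true] at hav
    simp only [Tm.wf, Bool.and_eq_true] at hwf
    obtain ⟨T1, st1, r1, c1, e1, a1⟩ := hs v d st env hwf.1 hav.1 hb henv
    obtain ⟨T2, st2, r2, c2, e2, a2⟩ := ht v (d + 1) st1 env hwf.2 hav.2 (hB a1 hb) (hE a1 henv)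
    refine ⟨_, _, .seq r1 (.seq r2 (setTmp_run d _ st2)), ?_, ?_,
      (a1.trans (a2.mono le_rfl (by omega))).trans (.write_tmp st2 _)⟩
    · simp only [Expr.cost, tmpE, Tm.cost]; omega
    · rw [Store.write_same]
      simp only [Expr.eval, tmpE, Tm.eval]
      rw [e2, a2.tmp d (by omega), e1, hev t a1 hav.2]
  | half t ht =>
    intro v d st env hwf hav hb henv
    obtain ⟨T1, st1, r1, c1, e1, a1⟩ := ht v d st env hwf hav hb henv
    refine ⟨_, _, .seq r1 (setTmp_run d _ st1), ?_, ?_, a1.trans (.write_tmp st1 _)⟩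
    · simp only [Expr.cost, tmpE, Tm.cost]; omega
    · rw [Store.write_same]
      simp only [Expr.eval, tmpE, Tm.eval]
      rw [e1]
  | ite c s t hc hs ht =>
    intro v d st env hwf hav hb henv
    simp only [Tm.avoids, Bool.and_eq_true] at hav
    simp only [Tm.wf, Bool.and_eq_true] at hwf
    obtain ⟨T1, st1, r1, c1, e1, a1⟩ := hc v d st env hwf.1.1 hav.1.1 hb henv
    by_cases h : c.eval st env = 0
    · obtain ⟨T2, st2, r2, c2, e2, a2⟩ := ht v d st1 env hwf.2 hav.2 (hB a1 hb) (hE a1 henv)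
      refine ⟨_, _, .seq r1 (.condFalse ?_ r2), ?_, ?_, a1.trans a2⟩
      · simp only [Expr.eval, tmpE, e1, h]
      · simp only [Expr.cost, tmpE, Tm.cost]; omega
      · rw [e2, hev t a1 hav.2]; simp only [Tm.eval, h, if_true]
    · obtain ⟨T2, st2, r2, c2, e2, a2⟩ := hs v d st1 env hwf.1.2 hav.1.2 (hB a1 hb) (hE a1 henv)
      refine ⟨_, _, .seq r1 (.condTrue ?_ r2), ?_, ?_, a1.trans a2⟩
      · simpa only [Expr.eval, tmpE, e1] using h
      · simp only [Expr.cost, tmpE, Tm.cost]; omega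
      · rw [e2, hev s a1 hav.1.2]; simp only [Tm.eval, h, if_false]
  | fold x b init step hi hs =>
    intro v d st env hwf hav hb henv
    simp only [Tm.avoids, Bool.and_eq_true] at hav
    simp only [Tm.wf, Bool.and_eq_true, beq_iff_eq] at hwf
    obtain ⟨⟨rfl, hwi⟩, hws⟩ := hwf
    obtain ⟨T1, st1, r1, c1, e1, a1⟩ := hi x d st env hwi hav.1 hb henv
    have r2 := setVar_run (x + 1) (tmpE d) st1
    simp only [Expr.eval, tmpE, e1] at r2
    let val : ℕ → ℕ := fun j => Nat.rec (init.eval st env)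
      (fun j acc => step.eval st (Function.update (Function.update env x j) (x + 1) acc)) j
    obtain ⟨T3, st3, r3, c3, ⟨a3, -, e3⟩⟩ := forLoop_run (x := x) (b := b) (n := st 4 b 0 0)
      (c := step.cost B + 8) (body := .seq (step.compile d) (setVar (x + 1) (tmpE d)))
      (fun j st' => Agree x d st st' ∧ st' 5 x 0 0 = j ∧ st' 5 (x + 1) 0 0 = val j)
      (fun j st' h => ⟨h.2.1, by rw [h.1.arr 4 (by omega)]⟩)
      (fun j hj st' ⟨h1, h2, h3⟩ => by
        obtain ⟨T4, st4, r4, c4, e4, a4⟩ := hs (x + 2) d st'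
          (Function.update (Function.update env x j) (x + 1) (val j)) hws hav.2 (hB h1 hb)
          (fun y hy => by
            rcases lt_or_ge y x with hlt | hge
            · rw [Function.update_of_ne (by omega), Function.update_of_ne (by omega)]
              exact hE h1 henv y hlt
            · obtain rfl | rfl : y = x ∨ y = x + 1 := by omega
              · rw [Function.update_of_ne (by omega), Function.update_self]; exact h2
              · rw [Function.update_self]; exact h3)
        have h4 : st4 5 x 0 0 = j := (a4.var x (by omega)).trans h2
        refine ⟨_, _, .seq r4 (setVar_run (x + 1) (tmpE d) st4), ?_, ?_, ?_, ?_, ?_⟩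
        · simp only [Expr.cost, tmpE]; omega
        · simp [Store.write_apply, h4]
        · exact ((h1.trans (a4.mono (by omega) le_rfl)).trans
            (.write_var _ (by omega) _)).trans (.write_var _ le_rfl _)
        · exact Store.write_same ..
        · have : step.eval st' (Function.update (Function.update env x j) (x + 1) (val j)) =
            val (j + 1) := hev step h1 hav.2 _
          simp only [Store.write_apply, Expr.eval, tmpE, e4, this]
          simp)
      (st := st1.write 5 (x + 1) 0 0 (init.eval st env))
      ⟨(a1.trans (.write_var _ (by omega) _)).trans (.write_var _ le_rfl _),
        Store.write_same .., by simp [Store.write_apply, val]⟩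
    refine ⟨_, _, .seq r1 (.seq r2 (.seq r3 (setTmp_run d _ st3))), ?_, ?_,
      a3.trans (.write_tmp _ _)⟩
    · simp only [Expr.cost, varE, Tm.cost]
      have := Nat.mul_le_mul_right (step.cost B + 8 + 20) (hb b)
      rw [show step.cost B + 28 = step.cost B + 8 + 20 by omega]
      omega
    · rw [Store.write_same]
      simp only [Expr.eval, varE, e3]
      rfl

/-! ### Commands that compute sizes and fill arrays -/

inductive Cmd
  /-- Store the value of a term in cell `b` of array `4`. -/
  | size (b : ℕ) (t : Tm)
  /-- Fill a box in an array; the side lengths of the box are the cells `b₁`, `b₂`, `b₃` of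
  array `4`. The variables `0`, `1`, `2` of the term are the indices. -/
  | fill (arr b₁ b₂ b₃ : ℕ) (t : Tm)

/-- The values of the index variables. -/
def indexEnv (i j k : ℕ) : ℕ → ℕ
  | 0 => i
  | 1 => j
  | 2 => k
  | _ => 0

/-- The effect of a command outside of scratch memory. -/
noncomputable def Cmd.exec (st : Store) : Cmd → Store
  | .size b t => st.write 4 b 0 0 (t.eval st (indexEnv 0 0 0))
  | .fill arr b₁ b₂ b₃ t => fun arr' i j k =>
      open Classical in
      if arr' = arr ∧ i < st 4 b₁ 0 0 ∧ j < st 4 b₂ 0 0 ∧ k < st 4 b₃ 0 0 then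
        t.eval st (indexEnv i j k) else st arr' i j k

def Cmd.wf : Cmd → Bool
  | .size _ t => t.wf 0 && t.avoids [5]
  | .fill arr _ _ _ t => t.wf 3 && t.avoids [5] && t.avoids [5, arr] && arr != 4 && arr != 5

def Cmd.prog : Cmd → Prog
  | .size b t => .seq (t.compile 0) (.assign 4 (.const b) (.const 0) (.const 0) (tmpE 0))
  | .fill arr b₁ b₂ b₃ t => forLoop 0 b₁ (forLoop 1 b₂ (forLoop 2 b₃
      (.seq (t.compile 0) (.assign arr (varE 0) (varE 1) (varE 2) (tmpE 0)))))

def Cmd.cost (B : ℕ) : Cmd → ℕ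
  | .size _ t => t.cost B + 8
  | .fill _ _ _ _ t => 15 + B * (15 + B * (15 + B * (t.cost B + 17 + 20) + 20) + 20)

/-- The term may not read the array being filled, nor may that array be the one with the loop
bounds; hence each cell receives the value that the term has in the initial memory. -/
theorem Cmd.fill_run {B : ℕ} {arr b₁ b₂ b₃ : ℕ} {t : Tm}
    (hwf : (Cmd.fill arr b₁ b₂ b₃ t).wf = true) {st : Store} (hB : ∀ b, st 4 b 0 0 ≤ B) :
    ∃ T st', Run (Cmd.fill arr b₁ b₂ b₃ t).prog st T st' ∧ T ≤ (Cmd.fill arr b₁ b₂ b₃ t).cost B ∧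
      ∀ a, a ≠ 5 → st' a = (Cmd.fill arr b₁ b₂ b₃ t).exec st a := by
  classical
  simp only [Cmd.wf, Bool.and_eq_true, bne_iff_ne, ne_eq] at hwf
  obtain ⟨⟨⟨⟨hwf, hav⟩, hav'⟩, h4⟩, h5⟩ := hwf
  let val : ℕ → ℕ → ℕ → ℕ := fun i j k => t.eval st (indexEnv i j k)
  let Filled : (ℕ → ℕ → ℕ → Prop) → Store → Prop := fun D s =>
    (∀ a, a ≠ 5 → a ≠ arr → s a = st a) ∧
      ∀ i j k, s arr i j k = if D i j k then val i j k else st arr i j k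
  have hcongr : ∀ {D D' s}, (∀ i j k, D i j k ↔ D' i j k) → Filled D s → Filled D' s :=
    fun h hs => ⟨hs.1, fun i j k => by rw [hs.2]; simp only [h]⟩
  have hvar : ∀ {D s} (x y : ℕ), Filled D s → Filled D (s.write 5 x 0 0 y) := fun x y hs =>
    ⟨fun a ha ha' => by rw [Store.write_of_ne _ ha]; exact hs.1 a ha ha',
      fun i j k => by rw [Store.write_of_ne _ h5]; exact hs.2 i j k⟩
  have hsz : ∀ {D s} b, Filled D s → s 4 b 0 0 = st 4 b 0 0 := fun b hs => by
    rw [hs.1 4 (by omega) (Ne.symm h4)]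
  set n₁ := st 4 b₁ 0 0
  set n₂ := st 4 b₂ 0 0
  set n₃ := st 4 b₃ 0 0
  have hwr : ∀ (s : Store) (x y z : ℕ), x ≠ y → s.write 5 x 0 0 z 5 y 0 0 = s 5 y 0 0 :=
    fun s x y z h => by simp [Store.write_apply, h.symm]
  -- The cells already written form a lexicographic initial segment of the box.
  have inner : ∀ i₀ < n₁, ∀ j₀ < n₂, ∀ s, (Filled (fun i j k => k < n₃ ∧ j < n₂ ∧
      (i < i₀ ∨ (i = i₀ ∧ j < j₀))) s ∧ s 5 0 0 0 = i₀ ∧ s 5 1 0 0 = j₀) →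
      ∃ T s', Run (forLoop 2 b₃ (.seq (t.compile 0)
          (.assign arr (varE 0) (varE 1) (varE 2) (tmpE 0)))) s T s' ∧
        T ≤ 15 + B * (t.cost B + 17 + 20) ∧
        (Filled (fun i j k => k < n₃ ∧ j < n₂ ∧ (i < i₀ ∨ (i = i₀ ∧ j < j₀ + 1))) s' ∧
          s' 5 0 0 0 = i₀ ∧ s' 5 1 0 0 = j₀) := by
    intro i₀ hi₀ j₀ hj₀ s ⟨hs, hs0, hs1⟩
    obtain ⟨T, s', r, c, ⟨h1, h2, h3, -⟩⟩ := forLoop_run (x := 2) (b := b₃) (n := n₃)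
      (c := t.cost B + 17)
      (fun k₀ s => Filled (fun i j k => k < n₃ ∧ j < n₂ ∧ (i < i₀ ∨ (i = i₀ ∧ (j < j₀ ∨
        (j = j₀ ∧ k < k₀))))) s ∧ s 5 0 0 0 = i₀ ∧ s 5 1 0 0 = j₀ ∧ s 5 2 0 0 = k₀)
      (fun k₀ s h => ⟨h.2.2.2, hsz _ h.1⟩)
      (fun k₀ hk₀ s ⟨h1, h2, h3, h4'⟩ => by
        obtain ⟨T, s', r, c, e, a⟩ := t.compile_run 3 0 s (indexEnv i₀ j₀ k₀) hwf hav
          (fun b => by rw [hsz b h1]; exact hB b) (fun x hx => by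
            obtain rfl | rfl | rfl : x = 0 ∨ x = 1 ∨ x = 2 := by omega
            · exact h2
            · exact h3
            · exact h4')
        have hval : t.eval s (indexEnv i₀ j₀ k₀) = val i₀ j₀ k₀ :=
          t.eval_congr (l := [5, arr]) (by simpa using Ne.symm h4)
            (fun a ha => by
              simp only [List.mem_cons, List.not_mem_nil, or_false, not_or] at ha
              exact h1.1 a ha.1 ha.2) hav' _
        have hr := Run.assign arr (varE 0) (varE 1) (varE 2) (tmpE 0) s'
        have e0 : s' 5 0 0 0 = i₀ := (a.var 0 (by omega)).trans h2
        have e1 : s' 5 1 0 0 = j₀ := (a.var 1 (by omega)).trans h3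
        have e2 : s' 5 2 0 0 = k₀ := (a.var 2 (by omega)).trans h4'
        simp only [Expr.eval, varE, tmpE, e0, e1, e2, e, hval] at hr
        have hne : (5 : ℕ) ≠ arr := Ne.symm h5
        refine ⟨_, _, .seq r hr, ?_, ?_, hvar _ _ ⟨fun a' ha ha' => ?_, fun i j k => ?_⟩, ?_, ?_, ?_⟩
        · simp only [Expr.cost]; omega
        · rw [Store.write_of_ne _ hne, e2]
        · rw [Store.write_of_ne _ ha', a.arr a' ha]; exact h1.1 a' ha ha'
        · simp only [Store.write_apply]
          rw [a.arr arr h5, h1.2]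
          by_cases hijk : i = i₀ ∧ j = j₀ ∧ k = k₀
          · obtain ⟨rfl, rfl, rfl⟩ := hijk
            rw [if_pos (by simp), if_pos (by omega)]
          · rw [if_neg (by simpa using hijk)]
            have : (k < n₃ ∧ j < n₂ ∧ (i < i₀ ∨ (i = i₀ ∧ (j < j₀ ∨ (j = j₀ ∧ k < k₀))))) ↔
                (k < n₃ ∧ j < n₂ ∧ (i < i₀ ∨ (i = i₀ ∧ (j < j₀ ∨ (j = j₀ ∧ k < k₀ + 1))))) := by
              omega
            split_ifs with h6 h7 h7
            · rfl
            · exact absurd (this.1 h6) h7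
            · exact absurd (this.2 h7) h6
            · rfl
        · rw [hwr _ _ _ _ (by omega), Store.write_of_ne _ hne, e0]
        · rw [hwr _ _ _ _ (by omega), Store.write_of_ne _ hne, e1]
        · exact Store.write_same ..)
      (st := s)
      ⟨hvar _ _ (hcongr (fun i j k => by omega) hs), by rw [hwr _ _ _ _ (by omega), hs0],
        by rw [hwr _ _ _ _ (by omega), hs1], Store.write_same ..⟩
    have := Nat.mul_le_mul_right (t.cost B + 17 + 20) (show n₃ ≤ B from hB b₃)
    exact ⟨T, s', r, c.trans (by omega), hcongr (fun i j k => by omega) h1, h2, h3⟩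
  have middle : ∀ i₀ < n₁, ∀ s, (Filled (fun i j k => k < n₃ ∧ j < n₂ ∧ i < i₀) s ∧
      s 5 0 0 0 = i₀) →
      ∃ T s', Run (forLoop 1 b₂ (forLoop 2 b₃ (.seq (t.compile 0)
          (.assign arr (varE 0) (varE 1) (varE 2) (tmpE 0))))) s T s' ∧
        T ≤ 15 + B * (15 + B * (t.cost B + 17 + 20) + 20) ∧
        (Filled (fun i j k => k < n₃ ∧ j < n₂ ∧ i < i₀ + 1) s' ∧ s' 5 0 0 0 = i₀) := by
    intro i₀ hi₀ s ⟨hs, hs0⟩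
    obtain ⟨T, s', r, c, ⟨h1, h2, -⟩⟩ := forLoop_run (x := 1) (b := b₂) (n := n₂)
      (c := 15 + B * (t.cost B + 17 + 20))
      (fun j₀ s => Filled (fun i j k => k < n₃ ∧ j < n₂ ∧ (i < i₀ ∨ (i = i₀ ∧ j < j₀))) s ∧
        s 5 0 0 0 = i₀ ∧ s 5 1 0 0 = j₀)
      (fun j₀ s h => ⟨h.2.2, hsz _ h.1⟩)
      (fun j₀ hj₀ s h => by
        obtain ⟨T, s', r, c, h1, h2, h3⟩ := inner i₀ hi₀ j₀ hj₀ s h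
        exact ⟨T, s', r, c, h3, hvar _ _ h1, by rw [hwr _ _ _ _ (by omega), h2],
          Store.write_same ..⟩)
      (st := s)
      ⟨hvar _ _ (hcongr (fun i j k => by omega) hs), by rw [hwr _ _ _ _ (by omega), hs0],
        Store.write_same ..⟩
    have := Nat.mul_le_mul_right (15 + B * (t.cost B + 17 + 20) + 20) (show n₂ ≤ B from hB b₂)
    exact ⟨T, s', r, c.trans (by omega), hcongr (fun i j k => by omega) h1, h2⟩
  obtain ⟨T, s', r, c, h1, -⟩ := forLoop_run (x := 0) (b := b₁) (n := n₁)
    (c := 15 + B * (15 + B * (t.cost B + 17 + 20) + 20))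
    (fun i₀ s => Filled (fun i j k => k < n₃ ∧ j < n₂ ∧ i < i₀) s ∧ s 5 0 0 0 = i₀)
    (fun i₀ s h => ⟨h.2, hsz _ h.1⟩)
    (fun i₀ hi₀ s h => by
      obtain ⟨T, s', r, c, h1, h2⟩ := middle i₀ hi₀ s h
      exact ⟨T, s', r, c, h2, hvar _ _ h1, Store.write_same ..⟩)
    (st := st)
    ⟨hvar _ _ ⟨fun _ _ _ => rfl, fun i j k => by simp⟩, Store.write_same ..⟩
  have := Nat.mul_le_mul_right (15 + B * (15 + B * (t.cost B + 17 + 20) + 20) + 20) (show n₁ ≤ B from hB b₁)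
  refine ⟨T, s', r, c.trans (by simp only [Cmd.cost]; omega), fun a ha => ?_⟩
  funext i j k
  simp only [Cmd.exec]
  by_cases haa : a = arr
  · subst haa
    rw [h1.2]
    have : (k < n₃ ∧ j < n₂ ∧ i < n₁) ↔ (a = a ∧ i < n₁ ∧ j < n₂ ∧ k < n₃) := by simp; tauto
    simp only [this]
    rfl
  · rw [h1.1 a ha haa]
    simp [haa]

theorem Cmd.size_run {B : ℕ} {b : ℕ} {t : Tm} (hwf : (Cmd.size b t).wf = true) {st : Store}
    (hB : ∀ b, st 4 b 0 0 ≤ B) :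
    ∃ T st', Run (Cmd.size b t).prog st T st' ∧ T ≤ (Cmd.size b t).cost B ∧
      ∀ a, a ≠ 5 → st' a = (Cmd.size b t).exec st a := by
  simp only [Cmd.wf, Bool.and_eq_true] at hwf
  obtain ⟨T, st', r, c, e, a⟩ := t.compile_run 0 0 st (indexEnv 0 0 0) hwf.1 hwf.2 hB
    (fun x hx => absurd hx (by omega))
  have hr := Run.assign 4 (.const b) (.const 0) (.const 0) (tmpE 0) st'
  simp only [Expr.eval, tmpE, e] at hr
  refine ⟨_, _, .seq r hr, ?_, fun a' ha => ?_⟩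
  · simp only [Expr.cost, Cmd.cost]; omega
  · funext i j k
    simp only [Cmd.exec, Store.write_apply, a.arr a' ha]

/-- The effect of a list of commands outside of scratch memory. -/
noncomputable def execAll (st : Store) : List Cmd → Store
  | [] => st
  | c :: cs => execAll (c.exec st) cs

def progAll : List Cmd → Prog
  | [] => .skip
  | c :: cs => .seq c.prog (progAll cs)

def costAll (B : ℕ) : List Cmd → ℕ
  | [] => 1
  | c :: cs => c.cost B + costAll B cs

/-- All numbers that the commands write into array `4` are at most `B`. -/
def SizesBounded (B : ℕ) (st : Store) : List Cmd → Prop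
  | [] => True
  | .size b t :: cs =>
      t.eval st (indexEnv 0 0 0) ≤ B ∧ SizesBounded B ((Cmd.size b t).exec st) cs
  | .fill arr b₁ b₂ b₃ t :: cs => SizesBounded B ((Cmd.fill arr b₁ b₂ b₃ t).exec st) cs

theorem Cmd.exec_congr {c : Cmd} (hc : c.wf = true) {st st' : Store}
    (h : ∀ a, a ≠ 5 → st' a = st a) : ∀ a, a ≠ 5 → c.exec st' a = c.exec st a := by
  intro a ha
  have h' : ∀ a, a ∉ [5] → st' a = st a := fun a ha => h a (by simpa using ha)
  cases c with
  | size b t =>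
    simp only [Cmd.wf, Bool.and_eq_true] at hc
    funext i j k
    simp only [Cmd.exec, Store.write_apply, t.eval_congr (by simp) h' hc.2, h a ha]
  | fill arr b₁ b₂ b₃ t =>
    simp only [Cmd.wf, Bool.and_eq_true] at hc
    funext i j k
    simp only [Cmd.exec, t.eval_congr (by simp) h' hc.1.1.1.2, h a ha, h 4 (by omega)]

/-- The idealized effect `execAll` ignores scratch memory, so the real memory is compared with it on
the other arrays only. No command reads scratch memory through its term, so the comparison is
preserved. -/
theorem execAll_run {B : ℕ} (cs : List Cmd) : ∀ {st st₁ : Store}, (cs.all Cmd.wf) = true →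
    SizesBounded B st cs → (∀ b, st 4 b 0 0 ≤ B) → (∀ a, a ≠ 5 → st₁ a = st a) →
    ∃ T st', Run (progAll cs) st₁ T st' ∧ T ≤ costAll B cs ∧
      ∀ a, a ≠ 5 → st' a = execAll st cs a := by
  induction cs with
  | nil => exact fun _ _ _ h => ⟨1, _, .skip _, le_rfl, h⟩
  | cons c cs ih =>
    intro st st₁ hwf hb hB h
    simp only [List.all_cons, Bool.and_eq_true] at hwf
    have hB₁ : ∀ b, st₁ 4 b 0 0 ≤ B := fun b => by rw [h 4 (by omega)]; exact hB b
    have hrun : ∃ T st', Run c.prog st₁ T st' ∧ T ≤ c.cost B ∧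
        ∀ a, a ≠ 5 → st' a = c.exec st₁ a := by
      cases c with
      | size b t => exact Cmd.size_run hwf.1 hB₁
      | fill arr b₁ b₂ b₃ t => exact Cmd.fill_run hwf.1 hB₁
    obtain ⟨T, st', r, hc, e⟩ := hrun
    have hnext : SizesBounded B (c.exec st) cs ∧ ∀ b, c.exec st 4 b 0 0 ≤ B := by
      cases c with
      | size b t =>
        refine ⟨hb.2, fun b' => ?_⟩
        simp only [Cmd.exec, Store.write_apply]
        split_ifs
        · exact hb.1
        · exact hB b'
      | fill arr b₁ b₂ b₃ t =>
        refine ⟨hb, fun b' => ?_⟩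
        have h4 : arr ≠ 4 := by
          have := hwf.1
          simp only [Cmd.wf, Bool.and_eq_true, bne_iff_ne] at this
          exact this.1.2
        simp only [Cmd.exec, h4.symm, false_and, if_false]
        exact hB b'
    obtain ⟨T', st'', r', hc', e'⟩ := ih hwf.2 hnext.1 hnext.2 (st₁ := st') fun a ha =>
      (e a ha).trans (Cmd.exec_congr hwf.1 h a ha)
    exact ⟨_, _, .seq r r', by simp only [costAll]; omega, e'⟩

theorem execAll_append (st : Store) (cs ds : List Cmd) :
    execAll st (cs ++ ds) = execAll (execAll st cs) ds := by
  induction cs generalizing st with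
  | nil => rfl
  | cons c cs ih => exact ih _

/-- The cells of array `4` that the commands write. -/
def sizeTargets : List Cmd → List ℕ
  | [] => []
  | .size b _ :: cs => b :: sizeTargets cs
  | .fill .. :: cs => sizeTargets cs

theorem execAll_size_of_notMem {b : ℕ} (cs : List Cmd) : ∀ {st : Store}, cs.all Cmd.wf = true →
    b ∉ sizeTargets cs → execAll st cs 4 b 0 0 = st 4 b 0 0 := by
  induction cs with
  | nil => exact fun _ _ => rfl
  | cons c cs ih =>
    intro st hwf hb
    simp only [List.all_cons, Bool.and_eq_true] at hwf
    cases c with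
    | size b' t =>
      simp only [sizeTargets, List.mem_cons, not_or] at hb
      rw [execAll, ih hwf.2 hb.2]
      simp [Cmd.exec, Store.write_apply, hb.1]
    | fill arr b₁ b₂ b₃ t =>
      have h4 := hwf.1
      simp only [Cmd.wf, Bool.and_eq_true, bne_iff_ne] at h4
      rw [execAll, ih hwf.2 hb]
      simp [Cmd.exec, h4.1.2.symm]

/-- If no cell is written twice, then it suffices to bound the final sizes. -/
theorem sizesBounded_of_final {B : ℕ} (cs : List Cmd) : ∀ {st : Store}, cs.all Cmd.wf = true →
    (sizeTargets cs).Nodup → (∀ b, execAll st cs 4 b 0 0 ≤ B) → SizesBounded B st cs := by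
  induction cs with
  | nil => exact fun _ _ _ => trivial
  | cons c cs ih =>
    intro st hwf hnd hb
    simp only [List.all_cons, Bool.and_eq_true] at hwf
    cases c with
    | size b t =>
      simp only [sizeTargets, List.nodup_cons] at hnd
      refine ⟨?_, ih hwf.2 hnd.2 hb⟩
      have := hb b
      rw [execAll, execAll_size_of_notMem cs hwf.2 hnd.1] at this
      simpa [Cmd.exec, Store.write_apply] using this
    | fill arr b₁ b₂ b₃ t => exact ih hwf.2 hnd hb

/-! ### Polynomial bounds -/

/-- The base `B + 1` is positive, so exponents can be enlarged freely when bounds are added. -/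
def PolyBounded (f : ℕ → ℕ) : Prop := ∃ K d, ∀ B, f B ≤ K * (B + 1) ^ d

theorem PolyBounded.const (c : ℕ) : PolyBounded fun _ => c := ⟨c, 0, fun B => by simp⟩

theorem PolyBounded.id : PolyBounded fun B => B := ⟨1, 1, fun B => by simp⟩

theorem PolyBounded.add {f g : ℕ → ℕ} (hf : PolyBounded f) (hg : PolyBounded g) :
    PolyBounded fun B => f B + g B := by
  obtain ⟨K, d, h⟩ := hf
  obtain ⟨K', d', h'⟩ := hg
  refine ⟨K + K', d + d', fun B => ?_⟩
  have h1 : (B + 1) ^ d ≤ (B + 1) ^ (d + d') := Nat.pow_le_pow_right (by omega) (by omega)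
  have h2 : (B + 1) ^ d' ≤ (B + 1) ^ (d + d') := Nat.pow_le_pow_right (by omega) (by omega)
  rw [add_mul]
  exact Nat.add_le_add ((h B).trans (Nat.mul_le_mul_left _ h1))
    ((h' B).trans (Nat.mul_le_mul_left _ h2))

theorem PolyBounded.mul {f g : ℕ → ℕ} (hf : PolyBounded f) (hg : PolyBounded g) :
    PolyBounded fun B => f B * g B := by
  obtain ⟨K, d, h⟩ := hf
  obtain ⟨K', d', h'⟩ := hg
  refine ⟨K * K', d + d', fun B => (Nat.mul_le_mul (h B) (h' B)).trans_eq ?_⟩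
  ring

theorem Tm.polyBounded_cost (t : Tm) : PolyBounded fun B => t.cost B := by
  induction t with
  | const c => exact .const _
  | var x => exact .const _
  | get arr i j k hi hj hk => exact ((hi.add hj).add hk).add (.const _)
  | plus s t hs ht => exact (hs.add ht).add (.const _)
  | minus s t hs ht => exact (hs.add ht).add (.const _)
  | half t ht => exact ht.add (.const _)
  | ite c s t hc hs ht => exact ((hc.add hs).add ht).add (.const _)
  | fold x b init step hi hs =>
    exact (hi.add (PolyBounded.id.mul (hs.add (.const _)))).add (.const _)

theorem polyBounded_costAll (cs : List Cmd) : PolyBounded fun B => costAll B cs := by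
  induction cs with
  | nil => exact .const _
  | cons c cs ih =>
    refine PolyBounded.add ?_ ih
    cases c with
    | size b t => exact t.polyBounded_cost.add (.const _)
    | fill arr b₁ b₂ b₃ t =>
      have h := (t.polyBounded_cost.add (.const 17)).add (.const 20)
      exact (PolyBounded.const 15).add (PolyBounded.id.mul (((PolyBounded.const 15).add
        (PolyBounded.id.mul (((PolyBounded.const 15).add (PolyBounded.id.mul h)).add
          (.const 20)))).add (.const 20)))

/-! ### Derived terms -/

@[simp] theorem bit_ne_zero {P : Prop} : bit P ≠ 0 ↔ P := by
  unfold bit; split_ifs <;> simp_all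

@[simp] theorem bit_eq_zero {P : Prop} : bit P = 0 ↔ ¬ P := by
  unfold bit; split_ifs <;> simp_all

theorem bit_congr {P P' : Prop} (h : P ↔ P') : bit P = bit P' := by
  rw [propext h]

/-- Iteration of a function that is told the number of the iteration. -/
def iter (a : ℕ) (f : ℕ → ℕ → ℕ) : ℕ → ℕ
  | 0 => a
  | n + 1 => f n (iter a f n)

theorem iter_eq_rec (a : ℕ) (f : ℕ → ℕ → ℕ) (n : ℕ) : iter a f n = Nat.rec a f n := by
  induction n with
  | zero => rfl
  | succ n ih => exact congrArg (f n) ih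

theorem iter_double (k : ℕ) : iter 1 (fun _ acc => acc + acc) k = 2 ^ k := by
  induction k with
  | zero => rfl
  | succ k ih => rw [iter, ih]; ring

namespace Tm

def not (t : Tm) : Tm := .ite t (.const 0) (.const 1)
def and (s t : Tm) : Tm := .ite s (.ite t (.const 1) (.const 0)) (.const 0)
def or (s t : Tm) : Tm := .ite s (.const 1) (.ite t (.const 1) (.const 0))
def eq (s t : Tm) : Tm := .ite (.plus (.minus s t) (.minus t s)) (.const 0) (.const 1)
def lt (s t : Tm) : Tm := .ite (.minus t s) (.const 1) (.const 0)
def size (b : ℕ) : Tm := .get 4 (.const b) (.const 0) (.const 0)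
def get1 (arr : ℕ) (i : Tm) : Tm := .get arr i (.const 0) (.const 0)
def get2 (arr : ℕ) (i j : Tm) : Tm := .get arr i j (.const 0)

/-- Some value of the variable `x` below the size `b` makes the term nonzero. -/
def ex (x b : ℕ) (t : Tm) : Tm :=
  .fold x b (.const 0) (.ite (.var (x + 1)) (.const 1) (.ite t (.const 1) (.const 0)))

def all (x b : ℕ) (t : Tm) : Tm := (ex x b t.not).not

/-- The product of two sizes. -/
def mulSize (x b c : ℕ) : Tm := .fold x b (.const 0) (.plus (.var (x + 1)) (size c))

/-- The product of a size and a variable. -/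
def mulVar (x b v : ℕ) : Tm := .fold x b (.const 0) (.plus (.var (x + 1)) (.var v))

variable {st : Store} {env : ℕ → ℕ}

@[simp] theorem eval_not (t : Tm) : t.not.eval st env = bit (t.eval st env = 0) := by
  simp only [not, eval, bit]; split_ifs <;> rfl

@[simp] theorem eval_and (s t : Tm) :
    (s.and t).eval st env = bit (s.eval st env ≠ 0 ∧ t.eval st env ≠ 0) := by
  simp only [and, eval, bit]; split_ifs <;> simp_all

@[simp] theorem eval_or (s t : Tm) :
    (s.or t).eval st env = bit (s.eval st env ≠ 0 ∨ t.eval st env ≠ 0) := by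
  simp only [or, eval, bit]; split_ifs <;> simp_all

@[simp] theorem eval_eq (s t : Tm) :
    (s.eq t).eval st env = bit (s.eval st env = t.eval st env) := by
  by_cases h : s.eval st env = t.eval st env
  · simp [eq, eval, bit, h]
  · have : s.eval st env - t.eval st env + (t.eval st env - s.eval st env) ≠ 0 := by omega
    simp only [eq, eval, bit, this, h, if_false]

@[simp] theorem eval_lt (s t : Tm) :
    (s.lt t).eval st env = bit (s.eval st env < t.eval st env) := by
  by_cases h : s.eval st env < t.eval st env
  · have : t.eval st env - s.eval st env ≠ 0 := by omega
    simp only [lt, eval, bit, this, h, if_false, if_true]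
  · have : t.eval st env - s.eval st env = 0 := by omega
    simp only [lt, eval, bit, this, h, if_false, if_true]

@[simp] theorem eval_size (b : ℕ) : (size b).eval st env = st 4 b 0 0 := rfl

@[simp] theorem eval_get1 (arr : ℕ) (i : Tm) :
    (get1 arr i).eval st env = st arr (i.eval st env) 0 0 := rfl

@[simp] theorem eval_get2 (arr : ℕ) (i j : Tm) :
    (get2 arr i j).eval st env = st arr (i.eval st env) (j.eval st env) 0 := rfl

@[simp] theorem eval_const (c : ℕ) : (const c).eval st env = c := rfl

@[simp] theorem eval_var (x : ℕ) : (var x).eval st env = env x := rfl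

@[simp] theorem eval_get (arr : ℕ) (i j k : Tm) :
    (get arr i j k).eval st env = st arr (i.eval st env) (j.eval st env) (k.eval st env) := rfl

@[simp] theorem eval_plus (s t : Tm) :
    (s.plus t).eval st env = s.eval st env + t.eval st env := rfl

@[simp] theorem eval_minus (s t : Tm) :
    (s.minus t).eval st env = s.eval st env - t.eval st env := rfl

@[simp] theorem eval_half (t : Tm) : t.half.eval st env = t.eval st env / 2 := rfl

@[simp] theorem eval_ite (c s t : Tm) : (c.ite s t).eval st env =
    if c.eval st env = 0 then t.eval st env else s.eval st env := rfl

/-- Two successive updates of an environment, by a loop variable and an accumulator. -/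
def bind (env : ℕ → ℕ) (x j acc : ℕ) : ℕ → ℕ :=
  fun y => if y = x then j else if y = x + 1 then acc else env y

theorem update_eq_bind (env : ℕ → ℕ) (x j acc : ℕ) :
    Function.update (Function.update env x j) (x + 1) acc = bind env x j acc := by
  funext y
  simp only [Function.update_apply, bind]
  split_ifs <;> first | rfl | omega

@[simp] theorem bind_apply (env : ℕ → ℕ) (x j acc y : ℕ) :
    bind env x j acc y = if y = x then j else if y = x + 1 then acc else env y := rfl

theorem eval_fold (x b : ℕ) (init step : Tm) : (fold x b init step).eval st env =
    iter (init.eval st env) (fun j acc => step.eval st (bind env x j acc)) (st 4 b 0 0) := by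
  rw [iter_eq_rec]
  simp only [← update_eq_bind]
  rfl

@[simp] theorem eval_ex (x b : ℕ) (t : Tm) : (ex x b t).eval st env =
    bit (∃ j < st 4 b 0 0, t.eval st (bind env x j 0) ≠ 0) := by
  rw [ex, eval_fold]
  induction st 4 b 0 0 with
  | zero => simp [iter, bit]
  | succ n ih =>
    rw [iter, ih]
    by_cases h : ∃ j < n, t.eval st (bind env x j 0) ≠ 0
    · have h' : ∃ j < n + 1, t.eval st (bind env x j 0) ≠ 0 := by
        obtain ⟨j, hj, hj'⟩ := h
        exact ⟨j, by omega, hj'⟩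
      simp only [bit, if_pos h, if_pos h']
      simp
    · by_cases ht : t.eval st (bind env x n 0) = 0
      · have h' : ¬ ∃ j < n + 1, t.eval st (bind env x j 0) ≠ 0 := by
          rintro ⟨j, hj, hj'⟩
          rcases Nat.lt_succ_iff_lt_or_eq.1 hj with h1 | rfl
          · exact h ⟨j, h1, hj'⟩
          · exact hj' ht
        simp only [bit, if_neg h, if_neg h']
        simp [ht]
      · have h' : ∃ j < n + 1, t.eval st (bind env x j 0) ≠ 0 := ⟨n, by omega, ht⟩
        simp only [bit, if_neg h, if_pos h']
        simp [ht]

@[simp] theorem eval_all (x b : ℕ) (t : Tm) : (all x b t).eval st env =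
    bit (∀ j < st 4 b 0 0, t.eval st (bind env x j 0) ≠ 0) := by
  rw [all, eval_not, eval_ex]
  refine bit_congr ?_
  simp

@[simp] theorem eval_mulSize (x b c : ℕ) :
    (mulSize x b c).eval st env = st 4 b 0 0 * st 4 c 0 0 := by
  rw [mulSize, eval_fold]
  induction st 4 b 0 0 with
  | zero => simp [iter]
  | succ n ih => rw [iter, ih]; simp; ring

@[simp] theorem eval_mulVar (x b v : ℕ) (hv : v < x) :
    (mulVar x b v).eval st env = st 4 b 0 0 * env v := by
  rw [mulVar, eval_fold]
  induction st 4 b 0 0 with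
  | zero => simp [iter]
  | succ n ih =>
    have h1 : v ≠ x := by omega
    have h2 : v ≠ x + 1 := by omega
    rw [iter, ih]
    simp [h1, h2]
    ring

end Tm

@[simp] theorem indexEnv_zero (i j k : ℕ) : indexEnv i j k 0 = i := rfl
@[simp] theorem indexEnv_one (i j k : ℕ) : indexEnv i j k 1 = j := rfl

theorem Cmd.exec_size_apply (st : Store) (b : ℕ) (t : Tm) (a i j k : ℕ) :
    (Cmd.size b t).exec st a i j k =
      if a = 4 ∧ i = b ∧ j = 0 ∧ k = 0 then t.eval st (indexEnv 0 0 0) else st a i j k := by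
  simp only [Cmd.exec, Store.write_apply]

theorem Cmd.exec_fill_apply (st : Store) (arr b₁ b₂ b₃ : ℕ) (t : Tm) (a i j k : ℕ) :
    (Cmd.fill arr b₁ b₂ b₃ t).exec st a i j k =
      if a = arr ∧ i < st 4 b₁ 0 0 ∧ j < st 4 b₂ 0 0 ∧ k < st 4 b₃ 0 0 then
        t.eval st (indexEnv i j k) else st a i j k := by
  simp only [Cmd.exec]

theorem tab3_apply {n l n' : ℕ} (f : Fin n → Fin l → Fin n' → ℕ) (i j k : ℕ) :
    tab (fun q => tab (fun a => tab (fun q' => f q a q') k) j) i =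
      if h : i < n ∧ j < l ∧ k < n' then f ⟨i, h.1⟩ ⟨j, h.2.1⟩ ⟨k, h.2.2⟩ else 0 := by
  unfold tab
  split_ifs <;> first | rfl | (exfalso; tauto)

/-! ### Coding the tracking automaton -/

section Coding

variable {m n : ℕ}

/-- The number of a letter of the tracking automaton. -/
def letterCode (a : Fin m) (x y : Option (Fin n)) : Fin (m * ((n + 1) * (n + 1))) :=
  finProdFinEquiv (a, finProdFinEquiv (finSuccEquivLast.symm x, finSuccEquivLast.symm y))

theorem letterCode_inj {a a' : Fin m} {x x' y y' : Option (Fin n)} :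
    letterCode a x y = letterCode a' x' y' ↔ a = a' ∧ x = x' ∧ y = y' := by
  simp [letterCode]

theorem letterCode_val (a : Fin m) (x y : Fin (n + 1)) :
    (letterCode a (finSuccEquivLast x) (finSuccEquivLast y) : ℕ) =
      y + (n + 1) * x + (n + 1) * (n + 1) * a := by
  simp [letterCode, finProdFinEquiv]

/-- The tracking automaton with numbered letters. -/
def APT.tracker (A : APT (Fin m) (Fin n)) : NPW (Fin (m * ((n + 1) * (n + 1)))) (Fin n) where
  init := A.init
  δ p b := {p' | ∃ a x y, b = letterCode a x y ∧ A.Track a x y p p'}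
  prio q := A.prio q + 1

theorem APT.isTracker_tracker (A : APT (Fin m) (Fin n)) :
    IsTracker A letterCode A.tracker where
  init := rfl
  mem_δ p a x y p' := by
    constructor
    · rintro ⟨a', x', y', h, ht⟩
      obtain ⟨rfl, rfl, rfl⟩ := letterCode_inj.1 h
      exact ht
    · exact fun h => ⟨a, x, y, rfl, h⟩
  prio _ := rfl

/-- The shift by one is injective; hence the bounds given for the determinizer may be stated in
terms of the rank of `A`. -/
theorem APT.rank_tracker (A : APT (Fin m) (Fin n)) : A.tracker.rank = A.rank := by
  unfold NPW.rank APT.rank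
  have : Set.range A.tracker.prio = Nat.succ '' Set.range A.prio := by
    rw [← Set.range_comp]; rfl
  rw [this, Set.ncard_image_of_injective _ Nat.succ_injective]

end Coding

/-! ### The program that writes the tracking automaton -/

namespace Program

open Tm

/-- The number of the letter given by three variables. -/
def letterTm (x a p q : ℕ) : Tm := .plus (.plus (.var q) (mulVar x 3 p)) (mulVar x 7 a)

/-- The moves of a trace; the variables `0`, `2`, `3`, `5`, `7` are the old and the new state, the
letter, the active state and Diamond's choice. -/
def trackTm : Tm :=
  let δ := Tm.get 2 (.var 0) (.var 3) (.var 2)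
  .ite (lt (.var 7) (size 2))
    (.ite (eq (.var 5) (.var 0)) (eq (.var 7) (.var 2)) (eq (.var 2) (.var 0)))
    (.ite (and (lt (.var 5) (size 2)) (eq (get1 1 (.var 5)) (.const 1)))
      (.ite (eq (.var 5) (.var 0)) δ (eq (.var 2) (.var 0)))
      (and δ (or (eq (get1 1 (.var 0)) (.const 3))
        (and (eq (.var 5) (.var 0)) (eq (get1 1 (.var 0)) (.const 2))))))

def trackerTm : Tm :=
  ex 3 1 (ex 5 3 (ex 7 3 (and (eq (.var 1) (letterTm 9 3 5 7)) trackTm)))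

/-- Cell `0` holds the side length `1` of degenerate boxes and cell `6` the length `3` of headers.
Powers of two arise by doubling and products by repeated addition, the machine having no
multiplication. -/
def sizeCmds : List Cmd :=
  [.size 0 (.const 1), .size 6 (.const 3),
    .size 1 (get1 0 (.const 0)), .size 2 (get1 0 (.const 1)), .size 9 (get1 0 (.const 2)),
    .size 3 (.plus (size 2) (.const 1)), .size 4 (.plus (size 1) (.const 1)),
    .size 5 (.fold 0 2 (.const 1) (.plus (.var 1) (.var 1))),
    .size 7 (mulSize 0 3 3), .size 8 (mulSize 0 1 7)]

def headerTm (s t r : Tm) : Tm := .ite (.var 0) (.ite (.minus (.var 0) (.const 1)) r t) s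

/-- The transition table is kept in array `6` besides being copied to array `12`: the determinizer
may destroy its input, and the game still needs the table. -/
def trackerCmds : List Cmd :=
  [.fill 10 6 0 0 (headerTm (size 8) (size 2) (size 9)),
    .fill 6 2 8 2 trackerTm,
    .fill 12 2 8 2 (.get 6 (.var 0) (.var 1) (.var 2)),
    .fill 14 2 0 0 (.plus (get1 3 (.var 0)) (.const 1))]

theorem eval_letterTm {st : Store} {env : ℕ → ℕ} {x a p q : ℕ} (ha : a < x) (hp : p < x) :
    (letterTm x a p q).eval st env =
      env q + st 4 3 0 0 * env p + st 4 7 0 0 * env a := by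
  simp [letterTm, ha, hp]

/-- The memory contains the tree automaton `A`, and array `4` contains its sizes. -/
structure HasAPT {m n : ℕ} (A : APT (Fin m) (Fin n)) (st : Store) : Prop where
  kind : ∀ q : Fin n, st 1 q 0 0 = (A.kind q).code
  δ : ∀ (q : Fin n) (a : Fin m) (q' : Fin n), st 2 q a q' = bit (q' ∈ A.δ q a)
  prio : ∀ q : Fin n, st 3 q 0 0 = A.prio q
  size_one : st 4 0 0 0 = 1
  size_m : st 4 1 0 0 = m
  size_n : st 4 2 0 0 = n
  size_n_succ : st 4 3 0 0 = n + 1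
  size_m_succ : st 4 4 0 0 = m + 1
  size_pow : st 4 5 0 0 = 2 ^ n
  size_three : st 4 6 0 0 = 3
  size_sq : st 4 7 0 0 = (n + 1) * (n + 1)
  size_l : st 4 8 0 0 = m * ((n + 1) * (n + 1))
  size_init : st 4 9 0 0 = A.init

theorem HasAPT.congr {m n : ℕ} {A : APT (Fin m) (Fin n)} {st st' : Store} (h : HasAPT A st)
    (h' : ∀ a, a = 1 ∨ a = 2 ∨ a = 3 → st' a = st a) (h4 : ∀ b < 10, st' 4 b 0 0 = st 4 b 0 0) :
    HasAPT A st' := by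
  constructor
  · rw [h' 1 (by simp)]; exact h.kind
  · rw [h' 2 (by simp)]; exact h.δ
  · rw [h' 3 (by simp)]; exact h.prio
  all_goals rw [h4 _ (by omega)]
  · exact h.size_one
  · exact h.size_m
  · exact h.size_n
  · exact h.size_n_succ
  · exact h.size_m_succ
  · exact h.size_pow
  · exact h.size_three
  · exact h.size_sq
  · exact h.size_l
  · exact h.size_init

theorem code_eq_one {x : StateKind} : x.code = 1 ↔ x = .localUniv := by
  cases x <;> simp [StateKind.code]

theorem code_eq_two {x : StateKind} : x.code = 2 ↔ x = .modalEx := by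
  cases x <;> simp [StateKind.code]

theorem code_eq_three {x : StateKind} : x.code = 3 ↔ x = .modalUniv := by
  cases x <;> simp [StateKind.code]

theorem code_lt_two {x : StateKind} : x.code < 2 ↔ x.IsLocal := by
  cases x <;> simp [StateKind.code, StateKind.IsLocal]

/-- In a letter the number `n` stands for `none`, so comparisons with `n` separate the cases of
`APT.Track`. -/
theorem HasAPT.eval_trackTm {m n : ℕ} {A : APT (Fin m) (Fin n)} {st : Store} (h : HasAPT A st)
    {env : ℕ → ℕ} (p p' : Fin n) (a : Fin m) (x y : Fin (n + 1)) (h0 : env 0 = p)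
    (h2 : env 2 = p') (h3 : env 3 = a) (h5 : env 5 = x) (h7 : env 7 = y) :
    trackTm.eval st env ≠ 0 ↔ A.Track a (finSuccEquivLast x) (finSuccEquivLast y) p p' := by
  simp only [trackTm, eval_ite, eval_lt, eval_var, eval_size, h0, h2, h3, h5, h7, h.size_n, eval_eq,
    eval_and, eval_or, eval_get1, eval_get, eval_const, h.δ, h.kind, bit_eq_zero, bit_ne_zero,
    code_eq_two, code_eq_three]
  induction y using Fin.lastCases with
  | last =>
    simp only [Fin.val_last, lt_irrefl, not_false_eq_true, if_true, finSuccEquivLast_last]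
    induction x using Fin.lastCases with
    | last =>
      have hp : n ≠ p := p.2.ne'
      simp [APT.Track, hp]
    | cast x =>
      have hx : (x : ℕ) = p ↔ x = p := Fin.val_inj
      have hp : (p' : ℕ) = p ↔ p' = p := Fin.val_inj
      have hk : st 1 x 0 0 = 1 ↔ A.kind x = .localUniv := by rw [h.kind, code_eq_one]
      simp only [Fin.val_castSucc, x.2, finSuccEquivLast_castSucc, APT.Track,
        hx, hp, true_and, Option.some_inj, exists_eq_left']
      by_cases h1 : A.kind x = .localUniv
      · rw [if_neg (not_not.2 (hk.2 h1))]
        by_cases h4 : x = p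
        · subst h4; simp [h1]
        · simp [h1, h4]
      · rw [if_pos (mt hk.1 h1)]
        by_cases h4 : x = p
        · subst h4; simp [h1]; tauto
        · simp [h1, h4]
  | cast y =>
    have hy : (y : ℕ) = p' ↔ p' = y := Fin.val_inj.trans eq_comm
    have hp : (p' : ℕ) = p ↔ p' = p := Fin.val_inj
    simp only [Fin.val_castSucc, y.2, not_true_eq_false, if_false, finSuccEquivLast_castSucc,
      APT.Track, hy, hp]
    induction x using Fin.lastCases with
    | last =>
      have hp : n ≠ p := p.2.ne'
      simp [hp]
    | cast x =>
      have hx : (x : ℕ) = p ↔ x = p := Fin.val_inj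
      simp only [Fin.val_castSucc, finSuccEquivLast_castSucc, hx, Option.some_inj]
      by_cases h4 : x = p <;> simp [h4]

/-- Letters are decoded by searching for components with the right number, which avoids division. -/
theorem HasAPT.eval_trackerTm {m n : ℕ} {A : APT (Fin m) (Fin n)} {st : Store} (h : HasAPT A st)
    (p p' : Fin n) (b : Fin (m * ((n + 1) * (n + 1)))) :
    trackerTm.eval st (indexEnv p b p') = bit (p' ∈ A.tracker.δ p b) := by
  simp only [trackerTm, eval_ex, eval_and, eval_eq, h.size_m, h.size_n_succ, bit_ne_zero]
  refine bit_congr ?_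
  change _ ↔ ∃ a x y, b = letterCode a x y ∧ A.Track a x y p p'
  simp only [finSuccEquivLast.symm.exists_congr_left, Equiv.symm_symm, ← Fin.val_inj,
    letterCode_val, Fin.exists_iff (n := m), Fin.exists_iff (n := n + 1)]
  refine exists_congr fun a => ?_
  constructor
  · rintro ⟨ha, x, hx, y, hy, h1, h2⟩
    refine ⟨ha, x, hx, y, hy, ?_, ?_⟩
    · simpa [eval_letterTm, h.size_n_succ, h.size_sq] using h1
    · exact (h.eval_trackTm p p' ⟨a, ha⟩ ⟨x, hx⟩ ⟨y, hy⟩ rfl rfl rfl rfl rfl).1 h2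
  · rintro ⟨ha, x, hx, y, hy, h1, h2⟩
    refine ⟨ha, x, hx, y, hy, ?_, ?_⟩
    · simpa [eval_letterTm, h.size_n_succ, h.size_sq] using h1
    · exact (h.eval_trackTm p p' ⟨a, ha⟩ ⟨x, hx⟩ ⟨y, hy⟩ rfl rfl rfl rfl rfl).2 h2

theorem sizeCmds_spec {m n : ℕ} (A : APT (Fin m) (Fin n)) {st : Store}
    (h : ∀ a < 4, st a = inputAPT A a) :
    HasAPT A (execAll st sizeCmds) ∧ ∀ a, a ≠ 4 → execAll st sizeCmds a = st a := by
  have e0 : st 0 0 0 0 = m := by rw [h 0 (by omega)]; rfl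
  have e1 : st 0 1 0 0 = n := by rw [h 0 (by omega)]; rfl
  have e2 : st 0 2 0 0 = A.init := by rw [h 0 (by omega)]; rfl
  have hother : ∀ a, a ≠ 4 → execAll st sizeCmds a = st a := fun a ha => by
    funext i j k
    simp [sizeCmds, execAll, Cmd.exec_size_apply, ha]
  refine ⟨⟨?_, ?_, ?_, ?_, ?_, ?_, ?_, ?_, ?_, ?_, ?_, ?_, ?_⟩, hother⟩
  · intro q
    rw [hother 1 (by omega), h 1 (by omega)]
    simp [inputAPT, cell1, tab]
  · intro q a q'
    rw [hother 2 (by omega), h 2 (by omega)]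
    simp [inputAPT, tab3_apply]
  · intro q
    rw [hother 3 (by omega), h 3 (by omega)]
    simp [inputAPT, cell1, tab]
  all_goals simp [sizeCmds, execAll, Cmd.exec_size_apply, eval_fold, iter_double, e0, e1, e2]

@[simp] theorem eval_headerTm {st : Store} {env : ℕ → ℕ} (s t r : Tm) :
    (headerTm s t r).eval st env = if env 0 = 0 then s.eval st env else
      if env 0 - 1 = 0 then t.eval st env else r.eval st env := rfl

theorem fill_header {st : Store} {arr b b' : ℕ} (hb : st 4 b 0 0 = 3) (hb' : st 4 b' 0 0 = 1)
    (h : ∀ i j k, st arr i j k = 0) (s t r : Tm) {x y z : ℕ}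
    (hs : ∀ env, s.eval st env = x) (ht : ∀ env, t.eval st env = y)
    (hr : ∀ env, r.eval st env = z) :
    (Cmd.fill arr b b' b' (headerTm s t r)).exec st arr = cell1 (header x y z) := by
  funext i j k
  rw [Cmd.exec_fill_apply, h, hb, hb']
  simp only [eval_headerTm, hs, ht, hr, indexEnv_zero, cell1, true_and, Nat.lt_one_iff]
  by_cases hjk : j = 0 ∧ k = 0
  · simp only [hjk, and_true, if_true]
    match i with
    | 0 => rfl
    | 1 => rfl
    | 2 => rfl
    | i + 3 => simp [header]
  · rw [if_neg (fun h => hjk h.2), if_neg hjk]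

theorem fill_tab {st : Store} {arr b b' v : ℕ} (hb : st 4 b 0 0 = v) (hb' : st 4 b' 0 0 = 1)
    (h : ∀ i j k, st arr i j k = 0) (t : Tm) (f : Fin v → ℕ)
    (hf : ∀ u : Fin v, t.eval st (indexEnv u 0 0) = f u) :
    (Cmd.fill arr b b' b' t).exec st arr = cell1 (tab f) := by
  funext i j k
  rw [Cmd.exec_fill_apply, h, hb, hb']
  simp only [cell1, true_and, Nat.lt_one_iff, tab]
  by_cases hjk : j = 0 ∧ k = 0
  · obtain ⟨rfl, rfl⟩ := hjk
    by_cases hi : i < v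
    · simp [hi, ← hf]
    · simp [hi]
  · rw [if_neg (fun h => hjk h.2), if_neg hjk]

theorem trackerCmds_spec {m n : ℕ} {A : APT (Fin m) (Fin n)} {st : Store} (h : HasAPT A st)
    (h0 : ∀ a, 5 < a → ∀ i j k, st a i j k = 0) :
    (∀ a, execAll st trackerCmds (2 * a + 10) = inputNPW A.tracker a) ∧
      (∀ p b p', execAll st trackerCmds 6 (p : Fin n) (b : Fin (m * ((n + 1) * (n + 1))))
        (p' : Fin n) = bit (p' ∈ A.tracker.δ p b)) ∧
      ∀ a, a ∉ [6, 10, 12, 14] → execAll st trackerCmds a = st a := by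
  set c₁ := Cmd.fill 10 6 0 0 (headerTm (size 8) (size 2) (size 9)) with hc₁
  set c₂ := Cmd.fill 6 2 8 2 trackerTm with hc₂
  set c₃ := Cmd.fill 12 2 8 2 (.get 6 (.var 0) (.var 1) (.var 2)) with hc₃
  set c₄ := Cmd.fill 14 2 0 0 (.plus (get1 3 (.var 0)) (.const 1)) with hc₄
  set st₁ := c₁.exec st with hst₁
  set st₂ := c₂.exec st₁ with hst₂
  set st₃ := c₃.exec st₂ with hst₃
  have hcs : execAll st trackerCmds = c₄.exec st₃ := rfl
  have fr : ∀ (arr b₁ b₂ b₃ : ℕ) (t : Tm) (s : Store) (a : ℕ), a ≠ arr →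
      (Cmd.fill arr b₁ b₂ b₃ t).exec s a = s a := fun arr b₁ b₂ b₃ t s a ha => by
    funext i j k
    rw [Cmd.exec_fill_apply, if_neg (fun h => ha h.1)]
  have f₁ : ∀ a, a ≠ 10 → st₁ a = st a := fun a ha => fr _ _ _ _ _ _ _ ha
  have f₂ : ∀ a, a ≠ 6 → st₂ a = st₁ a := fun a ha => fr _ _ _ _ _ _ _ ha
  have f₃ : ∀ a, a ≠ 12 → st₃ a = st₂ a := fun a ha => fr _ _ _ _ _ _ _ ha
  have f₄ : ∀ a, a ≠ 14 → c₄.exec st₃ a = st₃ a := fun a ha => fr _ _ _ _ _ _ _ ha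
  have h₁ : HasAPT A st₁ := h.congr (fun a ha => f₁ a (by omega)) fun b _ => by
    rw [f₁ 4 (by omega)]
  have e6 : ∀ p b p', st₂ 6 (p : Fin n) (b : Fin (m * ((n + 1) * (n + 1)))) (p' : Fin n) =
      bit (p' ∈ A.tracker.δ p b) := fun p b p' => by
    rw [hst₂, hc₂, Cmd.exec_fill_apply, h₁.size_n, h₁.size_l,
      if_pos ⟨rfl, p.2, b.2, p'.2⟩, h₁.eval_trackerTm]
  have h₂ : HasAPT A st₂ := h₁.congr (fun a ha => f₂ a (by omega)) fun b _ => by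
    rw [f₂ 4 (by omega)]
  have h₃ : HasAPT A st₃ := h₂.congr (fun a ha => f₃ a (by omega)) fun b _ => by
    rw [f₃ 4 (by omega)]
  refine ⟨fun a => ?_, fun p b p' => ?_, fun a ha => ?_⟩
  · rw [hcs]
    match a with
    | 0 =>
      rw [f₄ _ (by omega), f₃ _ (by omega), f₂ _ (by omega)]
      exact fill_header h.size_three h.size_one (h0 10 (by omega)) _ _ _ (fun _ => h.size_l)
        (fun _ => h.size_n) fun _ => h.size_init
    | 1 =>
      rw [f₄ _ (by omega)]
      funext i j k
      rw [hst₃, hc₃, Cmd.exec_fill_apply, h₂.size_n, h₂.size_l]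
      simp only [inputNPW, tab3_apply]
      split_ifs with h1 h2 h2
      · exact e6 ⟨i, h2.1⟩ ⟨j, h2.2.1⟩ ⟨k, h2.2.2⟩
      · exact absurd h1.2 h2
      · exact absurd ⟨trivial, h2⟩ h1
      · rw [f₂ _ (by omega), f₁ _ (by omega), h0 _ (by omega)]
    | 2 =>
      refine fill_tab h₃.size_n h₃.size_one (fun i j k => ?_) _ _ fun u => ?_
      · rw [f₃ _ (by omega), f₂ _ (by omega), f₁ _ (by omega), h0 _ (by omega)]
      · simp [h₃.prio, APT.tracker]
    | a + 3 =>
      rw [f₄ _ (by omega), f₃ _ (by omega), f₂ _ (by omega), f₁ _ (by omega)]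
      funext i j k
      exact h0 _ (by omega) i j k
  · rw [hcs, f₄ _ (by omega), f₃ _ (by omega), e6]
  · simp only [List.mem_cons, List.not_mem_nil, or_false, not_or] at ha
    rw [hcs, f₄ _ ha.2.2.2, f₃ _ ha.2.2.1, f₂ _ ha.1, f₁ _ ha.2.1]

theorem phaseOne_run {m n : ℕ} (A : APT (Fin m) (Fin n)) {B : ℕ} (h3 : 3 ≤ B) (hm : m + 1 ≤ B)
    (hn : 2 ^ n ≤ B) (hsq : (n + 1) * (n + 1) ≤ B) (hl : m * ((n + 1) * (n + 1)) ≤ B) :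
    ∃ T st, Run (progAll (sizeCmds ++ trackerCmds)) (inputAPT A) T st ∧
      T ≤ costAll B (sizeCmds ++ trackerCmds) ∧ HasAPT A st ∧ (∀ b, st 4 b 0 0 ≤ B) ∧
      (∀ a, st (2 * a + 10) = inputNPW A.tracker a) ∧
      (∀ p b p', st 6 (p : Fin n) (b : Fin (m * ((n + 1) * (n + 1)))) (p' : Fin n) =
        bit (p' ∈ A.tracker.δ p b)) ∧ ∀ a i j k, st (2 * a + 11) i j k = 0 := by
  have hzero : ∀ a, 3 < a → ∀ i j k, inputAPT A a i j k = 0 := by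
    intro a ha i j k
    match a with
    | a + 4 => rfl
  obtain ⟨s1, s2⟩ := sizeCmds_spec A (st := inputAPT A) fun _ _ => rfl
  obtain ⟨t1, t2, t3⟩ := trackerCmds_spec s1 fun a ha i j k => by
    rw [s2 a (by omega)]; exact hzero a (by omega) i j k
  have hwf : (sizeCmds ++ trackerCmds).all Cmd.wf = true := by decide
  have hfin : HasAPT A (execAll (inputAPT A) (sizeCmds ++ trackerCmds)) := by
    rw [execAll_append]
    refine s1.congr (fun a ha => t3 a ?_) fun b _ => by rw [t3 4 (by decide)]
    rcases ha with rfl | rfl | rfl <;> decide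
  have hbd : ∀ b, execAll (inputAPT A) (sizeCmds ++ trackerCmds) 4 b 0 0 ≤ B := by
    intro b
    have hn1 : n + 1 ≤ 2 ^ n := Nat.lt_two_pow_self
    by_cases hb : b < 10
    · have hi := A.init.2
      interval_cases b
      · rw [hfin.size_one]; omega
      · rw [hfin.size_m]; omega
      · rw [hfin.size_n]; omega
      · rw [hfin.size_n_succ]; omega
      · rw [hfin.size_m_succ]; omega
      · rw [hfin.size_pow]; omega
      · rw [hfin.size_three]; omega
      · rw [hfin.size_sq]; omega
      · rw [hfin.size_l]; omega
      · rw [hfin.size_init]; omega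
    · rw [execAll_size_of_notMem _ hwf (by
        simp only [show sizeTargets (sizeCmds ++ trackerCmds) = [0, 6, 1, 2, 9, 3, 4, 5, 7, 8]
          from rfl, List.mem_cons, List.not_mem_nil, or_false]
        omega), hzero 4 (by omega)]
      omega
  obtain ⟨T, st, hr, hT, h⟩ := execAll_run (st₁ := inputAPT A) _ hwf
    (sizesBounded_of_final _ hwf (by decide) hbd)
    (fun b => by rw [hzero 4 (by omega)]; omega) fun _ _ => rfl
  have hapt : HasAPT A st := by
    refine hfin.congr (fun a ha => h a ?_) fun b _ => by rw [h 4 (by omega)]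
    rcases ha with rfl | rfl | rfl <;> decide
  refine ⟨T, st, hr, hT, hapt, fun b => by rw [h 4 (by omega)]; exact hbd b, fun a => ?_, fun p b p' => ?_,
    fun a i j k => ?_⟩
  · rw [h (2 * a + 10) (by omega), execAll_append, t1]
  · rw [h 6 (by omega), execAll_append, t2]
  · rw [h (2 * a + 11) (by omega), execAll_append, t3 (2 * a + 11) (by
      simp only [List.mem_cons, List.not_mem_nil, or_false]; omega), s2 (2 * a + 11) (by omega),
      hzero (2 * a + 11) (by omega)]

end Program

/-! ### The emptiness game with numbered nodes -/

section Nodes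

variable {m n s : ℕ}

/-- The set of states that is coded by a number. -/
def codeSet (U : Fin (2 ^ n)) : Set (Fin n) := {q | (U : ℕ).testBit q = true}

theorem codeSet_surjective : Function.Surjective (codeSet : Fin (2 ^ n) → Set (Fin n)) := by
  classical
  intro S
  refine ⟨⟨Nat.ofBits fun q : Fin n => decide (q ∈ S), Nat.ofBits_lt_two_pow _⟩, ?_⟩
  ext q
  simp [codeSet, Nat.testBit_ofBits_lt]

open Classical in
/-- The largest local state below `k` in a set, and `n` if there is none. -/
noncomputable def APT.pickIndex (A : APT (Fin m) (Fin n)) (S : Set (Fin n)) (k : ℕ) : ℕ :=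
  iter n (fun j acc => if ∃ h : j < n, ⟨j, h⟩ ∈ S ∧ (A.kind ⟨j, h⟩).IsLocal then j else acc) k

theorem APT.pickIndex_spec (A : APT (Fin m) (Fin n)) (S : Set (Fin n)) (k : ℕ) :
    (∃ h : A.pickIndex S k < n, ⟨_, h⟩ ∈ S ∧ (A.kind ⟨_, h⟩).IsLocal) ∨
      (A.pickIndex S k = n ∧ ∀ q ∈ S, (q : ℕ) < k → ¬ (A.kind q).IsLocal) := by
  classical
  induction k with
  | zero => exact .inr ⟨rfl, fun _ _ h => absurd h (by omega)⟩
  | succ k ih =>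
    by_cases hk : ∃ h : k < n, ⟨k, h⟩ ∈ S ∧ (A.kind ⟨k, h⟩).IsLocal
    · have : A.pickIndex S (k + 1) = k := if_pos hk
      simp only [this]
      exact .inl hk
    · have : A.pickIndex S (k + 1) = A.pickIndex S k := if_neg hk
      simp only [this]
      refine ih.imp id fun h => ⟨h.1, fun q hq hlt hl => ?_⟩
      rcases Nat.lt_succ_iff_lt_or_eq.1 hlt with h1 | h1
      · exact h.2 q hq h1 hl
      · subst h1
        exact hk ⟨q.2, hq, hl⟩

theorem APT.pickIndex_lt (A : APT (Fin m) (Fin n)) (S : Set (Fin n)) (k : ℕ) :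
    A.pickIndex S k < n + 1 := by
  rcases A.pickIndex_spec S k with ⟨h, -⟩ | ⟨h, -⟩ <;> omega

/-- The largest local state in a set. -/
noncomputable def APT.pick (A : APT (Fin m) (Fin n)) (S : Set (Fin n)) : Option (Fin n) :=
  finSuccEquivLast ⟨A.pickIndex S n, A.pickIndex_lt S n⟩

theorem finSuccEquivLast_eq_some {x : Fin (n + 1)} {q : Fin n} :
    finSuccEquivLast x = some q ↔ (x : ℕ) = q := by
  rw [← finSuccEquivLast_castSucc, finSuccEquivLast.apply_eq_iff_eq, ← Fin.val_inj]
  rfl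

theorem finSuccEquivLast_eq_none {x : Fin (n + 1)} : finSuccEquivLast x = none ↔ (x : ℕ) = n := by
  rw [← finSuccEquivLast_last, finSuccEquivLast.apply_eq_iff_eq, ← Fin.val_inj]
  rfl

theorem APT.pick_eq_some {A : APT (Fin m) (Fin n)} {S : Set (Fin n)} {q : Fin n} :
    A.pick S = some q ↔ A.pickIndex S n = q :=
  finSuccEquivLast_eq_some

theorem APT.pick_eq_none {A : APT (Fin m) (Fin n)} {S : Set (Fin n)} :
    A.pick S = none ↔ A.pickIndex S n = n :=
  finSuccEquivLast_eq_none

theorem APT.isPick_pick (A : APT (Fin m) (Fin n)) : IsPick A A.pick where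
  some {U q} h := by
    rw [pick_eq_some] at h
    rcases A.pickIndex_spec U n with ⟨h1, h2⟩ | ⟨h1, -⟩
    · have : (⟨_, h1⟩ : Fin n) = q := Fin.ext h
      rwa [this] at h2
    · have := q.2
      omega
  none {U} h q hq := by
    rw [pick_eq_none] at h
    rcases A.pickIndex_spec U n with ⟨h1, -⟩ | ⟨-, h2⟩
    · omega
    · exact h2 q hq q.2

open Classical in
/-- The number of values of the last component of a node. -/
noncomputable def choices (det : Prop) (n : ℕ) : ℕ := if det then 1 else n + 1

theorem choices_le (det : Prop) (n : ℕ) : choices det n ≤ n + 1 := by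
  unfold choices; split_ifs <;> omega

theorem choices_pos (det : Prop) (n : ℕ) : 0 < choices det n := by
  unfold choices; split_ifs <;> omega

/-- The number of a node. -/
def nodeCode {Y : ℕ} (y : Fin Y) (a : Fin (m + 1)) (U : Fin (2 ^ n)) (h : Fin s) :
    Fin (Y * ((m + 1) * (2 ^ n * s))) :=
  finProdFinEquiv (y, finProdFinEquiv (a, finProdFinEquiv (U, h)))

theorem nodeCode_val {Y : ℕ} (y : Fin Y) (a : Fin (m + 1)) (U : Fin (2 ^ n)) (h : Fin s) :
    (nodeCode y a U h : ℕ) =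
      h + s * U + 2 ^ n * s * a + (m + 1) * (2 ^ n * s) * y := by
  simp [nodeCode, finProdFinEquiv]

theorem nodeCode_surjective {Y : ℕ} (u : Fin (Y * ((m + 1) * (2 ^ n * s)))) :
    ∃ y a U h, u = nodeCode y a U h := by
  obtain ⟨⟨y, x⟩, rfl⟩ := finProdFinEquiv.surjective u
  obtain ⟨⟨a, x⟩, rfl⟩ := finProdFinEquiv.surjective x
  obtain ⟨⟨U, h⟩, rfl⟩ := finProdFinEquiv.surjective x
  exact ⟨y, a, U, h, rfl⟩

theorem nodeCode_inj {Y : ℕ} {y y' : Fin Y} {a a' : Fin (m + 1)} {U U' : Fin (2 ^ n)}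
    {h h' : Fin s} : nodeCode y a U h = nodeCode y' a' U' h' ↔ y = y' ∧ a = a' ∧ U = U' ∧ h = h' := by
  simp [nodeCode]

/-- The node of the emptiness game with the given components. -/
def viewOf {Y : ℕ} (hY : Y ≤ n + 1) (y : Fin Y) (a : Fin (m + 1)) (U : Fin (2 ^ n)) (h : Fin s) :
    View (Fin m) (Fin n) (Fin s) :=
  ⟨finSuccEquivLast a, codeSet U, h, finSuccEquiv n (Fin.castLE hY y)⟩

/-- The node of the emptiness game with the given number. -/
def nodeView {Y : ℕ} (hY : Y ≤ n + 1) (u : Fin (Y * ((m + 1) * (2 ^ n * s)))) :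
    View (Fin m) (Fin n) (Fin s) :=
  let x := finProdFinEquiv.symm u
  let x' := finProdFinEquiv.symm x.2
  let x'' := finProdFinEquiv.symm x'.2
  viewOf hY x.1 x'.1 x''.1 x''.2

theorem nodeView_nodeCode {Y : ℕ} (hY : Y ≤ n + 1) (y : Fin Y) (a : Fin (m + 1)) (U : Fin (2 ^ n))
    (h : Fin s) : nodeView hY (nodeCode y a U h) = viewOf hY y a U h := by
  simp [nodeView, nodeCode]

variable (A : APT (Fin m) (Fin n)) (H : NPW (Fin (m * ((n + 1) * (n + 1)))) (Fin s))

/-- The emptiness game with numbered nodes. -/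
noncomputable def emptinessGame (det : Prop) :
    ParityGame (Fin (choices det n * ((m + 1) * (2 ^ n * s)))) where
  dia u := A.EmptinessDia A.pick (nodeView (choices_le det n) u)
  edge u u' := EmptinessEdge A letterCode A.tracker A.pick H det (nodeView (choices_le det n) u)
    (nodeView (choices_le det n) u')
  prio u := H.prio (nodeView (choices_le det n) u).h + 1

theorem isEmptinessGame_emptinessGame (det : Prop) :
    IsEmptinessGame A letterCode A.tracker A.pick H det (emptinessGame A H det)
      (nodeView (choices_le det n)) where
  dia _ := Iff.rfl
  edge _ _ := Iff.rfl
  prio _ := rfl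
  surj := by
    rintro ⟨a, S, h, y⟩ hy
    obtain ⟨U, rfl⟩ := codeSet_surjective S
    have : ∃ y' : Fin (choices det n), finSuccEquiv n (Fin.castLE (choices_le det n) y') = y := by
      by_cases hd : det
      · refine ⟨⟨0, choices_pos det n⟩, ?_⟩
        have hy' : y = none := hy hd
        subst hy'
        rfl
      · have hc : n + 1 = choices det n := by simp [choices, hd]
        refine ⟨Fin.cast hc ((finSuccEquiv n).symm y), ?_⟩
        rw [← Equiv.eq_symm_apply]
        rfl
    obtain ⟨y', rfl⟩ := this
    exact ⟨nodeCode y' (finSuccEquivLast.symm a) U h, by simp [nodeView_nodeCode, viewOf]⟩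

theorem rank_emptinessGame_le (det : Prop) : (emptinessGame A H det).rank ≤ H.rank := by
  unfold ParityGame.rank NPW.rank
  have h : Set.range (emptinessGame A H det).prio ⊆ Nat.succ '' Set.range H.prio := by
    rintro _ ⟨u, rfl⟩
    exact ⟨_, ⟨_, rfl⟩, rfl⟩
  refine (Set.ncard_le_ncard h ((Set.finite_range _).image _)).trans ?_
  exact (Set.ncard_image_of_injective _ Nat.succ_injective).le

/-- The initial node. -/
def initNode {Y : ℕ} (hY : 0 < Y) : Fin (Y * ((m + 1) * (2 ^ n * s))) :=
  nodeCode ⟨0, hY⟩ (Fin.last m) ⟨2 ^ (A.init : ℕ), Nat.pow_lt_pow_right (by omega) A.init.2⟩ H.init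

theorem initNode_val {Y : ℕ} (hY : 0 < Y) :
    (initNode A H hY : ℕ) = H.init + 2 ^ (A.init : ℕ) * s + 2 ^ n * s * m := by
  rw [initNode, nodeCode_val]
  simp only [Fin.val_last, mul_zero, add_zero]
  ring

theorem nodeView_initNode {det : Prop} : nodeView (choices_le det n)
    (initNode A H (choices_pos det n)) = ⟨none, {A.init}, H.init, none⟩ := by
  rw [initNode, nodeView_nodeCode, viewOf, finSuccEquivLast_last]
  congr 1
  ext q
  simp [codeSet, Nat.testBit_two_pow, Fin.val_inj, eq_comm]

theorem wins_emptinessGame_iff (hHD : H.HistoryDeterministic)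
    (hlang : H.language = A.tracker.language) {det : Prop} (hdet : det → H.Deterministic) :
    (emptinessGame A H det).Wins (initNode A H (choices_pos det n)) ↔ A.IsNonempty :=
  (isEmptinessGame_emptinessGame A H det).wins_iff A.isTracker_tracker A.isPick_pick hHD hlang hdet
    (nodeView_initNode A H)

end Nodes

/-! ### The moves of the emptiness game as one test -/

section

variable {α Q B S : Type}

/-- The moves of the emptiness game that read a letter, given by a state `p` and a choice `z`. -/
def APT.ReadingMove (A : APT α Q) (pick : Set Q → Option Q) (det : Prop) (v : View α Q S)
    (a' : Option α) (a : α) (p z : Option Q) : Prop :=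
  (z ≠ none ∧ v.y = z ∧ p ≠ none ∧ pick v.U = p ∧ a' = v.a) ∨
  (det ∧ v.y = none ∧ pick v.U = p ∧ a' = v.a ∧
    ∃ q q', p = some q ∧ A.kind q = .localEx ∧ z = some q' ∧ q' ∈ A.δ q a) ∨
  (v.y = none ∧ pick v.U = p ∧ a' = v.a ∧ z = none ∧ ∃ q, p = some q ∧ A.kind q = .localUniv) ∨
  (v.y = none ∧ pick v.U = none ∧ a' = none ∧ z = none ∧
    (p = none ∨ ∃ q, p = some q ∧ A.kind q = .modalEx))

/-- All moves that read a letter share the conditions on `H` and on the new set of states; they are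
gathered under one quantifier over letters, which is the shape that the program evaluates. -/
theorem emptinessEdge_iff {A : APT α Q} {enc : α → Option Q → Option Q → B} {N : NPW B Q}
    {pick : Set Q → Option Q} {H : NPW B S} {det : Prop} {v v' : View α Q S} :
    EmptinessEdge A enc N pick H det v v' ↔
      (v.y = none ∧ v.a = none ∧ v'.a ≠ none ∧ v'.U = v.U ∧ v'.h = v.h ∧ v'.y = none) ∨
      (¬ det ∧ v.y = none ∧ v'.a = v.a ∧ v'.U = v.U ∧ v'.h = v.h ∧
        ∃ a q q', v.a = some a ∧ pick v.U = some q ∧ A.kind q = .localEx ∧ v'.y = some q' ∧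
          q' ∈ A.δ q a) ∨
      ∃ a p z, v.a = some a ∧ A.ReadingMove pick det v v'.a a p z ∧
        v'.h ∈ H.δ v.h (enc a p z) ∧ v'.y = none ∧ v'.U = N.post v.U (enc a p z) := by
  constructor
  · intro h
    cases h with
    | label a => exact .inl ⟨rfl, rfl, by simp, rfl, rfl, rfl⟩
    | choose h1 h2 h3 h4 =>
      exact .inr (.inl ⟨h1, rfl, rfl, rfl, rfl, _, _, _, rfl, h2, h3, rfl, h4⟩)
    | chosen h1 h2 =>
      exact .inr (.inr ⟨_, _, _, rfl, .inl ⟨by simp, rfl, by simp, h1, rfl⟩, h2, rfl, rfl⟩)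
    | existential h1 h2 h3 h4 h5 =>
      exact .inr (.inr ⟨_, _, _, rfl,
        .inr (.inl ⟨h1, rfl, h2, rfl, _, _, rfl, h3, rfl, h4⟩), h5, rfl, rfl⟩)
    | universal h1 h2 h3 =>
      exact .inr (.inr ⟨_, _, _, rfl,
        .inr (.inr (.inl ⟨rfl, h1, rfl, rfl, _, rfl, h2⟩)), h3, rfl, rfl⟩)
    | modal h1 h2 h3 =>
      exact .inr (.inr ⟨_, _, _, rfl,
        .inr (.inr (.inr ⟨rfl, h1, rfl, rfl, h2⟩)), h3, rfl, rfl⟩)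
  · obtain ⟨a, U, h, y⟩ := v
    obtain ⟨a', U', h', y'⟩ := v'
    rintro (⟨h1, h2, h3, h4, h5, h6⟩ | ⟨h1, h2, h3, h4, h5, a₀, q, q', h6, h7, h8, h9, h10⟩ |
      ⟨a₀, p, z, h1, h2, h3, h4, h5⟩)
    · obtain ⟨a', rfl⟩ := Option.ne_none_iff_exists'.1 h3
      simp only at h1 h2 h4 h5 h6
      subst h1 h2 h4 h5 h6
      exact .label a'
    · simp only at h2 h3 h4 h5 h6 h9
      subst h2 h3 h4 h5 h6 h9
      exact .choose h1 h7 h8 h10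
    · simp only at h1 h3 h4 h5
      subst h1 h4 h5
      rcases h2 with ⟨g1, g2, g3, g4, g5⟩ | ⟨g1, g2, g3, g4, q, q', g5, g6, g7, g8⟩ |
        ⟨g1, g2, g3, g4, q, g5, g6⟩ | ⟨g1, g2, g3, g4, g5⟩
      · obtain ⟨q', rfl⟩ := Option.ne_none_iff_exists'.1 g1
        obtain ⟨q, rfl⟩ := Option.ne_none_iff_exists'.1 g3
        simp only at g2 g4 g5
        subst g2 g5
        exact .chosen g4 h3
      · simp only at g2 g3 g4
        subst g2 g4 g5 g7
        exact .existential g1 g3 g6 g8 h3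
      · simp only at g1 g2 g3
        subst g1 g3 g4 g5
        exact .universal g2 g6 h3
      · simp only at g1 g2 g3
        subst g1 g3 g4
        exact .modal g2 g5 h3

end

/-! ### The program that writes the emptiness game -/

namespace Program

open Tm

/-- The number of the node with the given components. -/
def nodeTm (x y a U h : ℕ) : Tm :=
  .plus (.plus (.plus (.var h) (mulVar x 10 U)) (mulVar x 13 a)) (mulVar x 14 y)

/-- Assign the components of the node `u` to the variables `x`, `x + 2`, `x + 4` and `x + 6`. -/
def decodeTm (u x : ℕ) (t : Tm) : Tm :=
  ex x 12 (ex (x + 2) 4 (ex (x + 4) 5 (ex (x + 6) 10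
    (and (eq (.var u) (nodeTm (x + 8) x (x + 2) (x + 4) (x + 6))) t))))

def pickTm : Tm := get1 8 (.var 7)

/-- The local existential state with number `p` has the successor `z` by the letter `a`. -/
def choiceTm (p a z : Tm) : Tm :=
  and (and (lt p (size 2)) (eq (get1 1 p) (.const 0))) (and (lt z (size 2)) (.get 2 p a z))

def kindTm (p : Tm) (c : ℕ) : Tm := and (lt p (size 2)) (eq (get1 1 p) (.const c))

def labelTm : Tm :=
  and (eq (.var 3) (.const 0)) (and (eq (.var 5) (size 1)) (and (lt (.var 13) (size 1))
    (and (eq (.var 15) (.var 7)) (and (eq (.var 17) (.var 9)) (eq (.var 11) (.const 0))))))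

def chooseTm : Tm :=
  and (eq (size 16) (.const 0)) (and (eq (.var 3) (.const 0)) (and (eq (.var 13) (.var 5))
    (and (eq (.var 15) (.var 7)) (and (eq (.var 17) (.var 9)) (and (lt (.var 5) (size 1))
      (and (lt (.const 0) (.var 11))
        (choiceTm pickTm (.var 5) (.minus (.var 11) (.const 1)))))))))

/-- Two codings of optional states meet here: in a node `0` means `none` and `q + 1` means `q`,
whereas in a letter `n` means `none`. Hence the comparison of the variable `21`, raised by one, with
the variable `3`. -/
def guardTm : Tm :=
  or (and (eq (.plus (.var 21) (.const 1)) (.var 3)) (and (lt (.var 19) (size 2))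
      (and (eq pickTm (.var 19)) (eq (.var 13) (.var 5)))))
    (or (and (size 16) (and (eq (.var 3) (.const 0)) (and (eq pickTm (.var 19))
        (and (eq (.var 13) (.var 5)) (choiceTm (.var 19) (.var 5) (.var 21))))))
      (or (and (eq (.var 3) (.const 0)) (and (eq pickTm (.var 19)) (and (eq (.var 13) (.var 5))
          (and (eq (.var 21) (size 2)) (kindTm (.var 19) 1)))))
        (and (eq (.var 3) (.const 0)) (and (eq pickTm (size 2)) (and (eq (.var 13) (size 1))
          (and (eq (.var 21) (size 2)) (or (eq (.var 19) (size 2)) (kindTm (.var 19) 2))))))))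

/-- The variable `15` codes the states that are reached from the ones coded by `7`. -/
def postTm : Tm :=
  all 23 2 (eq (get2 7 (.var 15) (.var 23))
    (ex 25 2 (and (get2 7 (.var 7) (.var 25))
      (.get 6 (.var 25) (letterTm 27 5 19 21) (.var 23)))))

def moveTm : Tm :=
  or labelTm (or chooseTm (ex 19 3 (ex 21 3 (and (lt (.var 5) (size 1)) (and guardTm
    (and (.get 12 (.var 9) (letterTm 23 5 19 21) (.var 17))
      (and (eq (.var 11) (.const 0)) postTm)))))))

def edgeTm : Tm := decodeTm 0 3 (decodeTm 1 11 moveTm)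

def diaTm : Tm :=
  decodeTm 0 3 (and (eq (.var 3) (.const 0)) (or (eq (.var 5) (size 1)) (kindTm pickTm 0)))

/-- The remainder modulo a size. -/
def modTm (x b c v : ℕ) : Tm :=
  .fold x b (.var v) (.ite (lt (.var (x + 1)) (size c)) (.var (x + 1))
    (.minus (.var (x + 1)) (size c)))

def prioTm : Tm := .plus (get1 14 (modTm 3 15 10 0)) (.const 1)

/-- The program tests determinism of the automaton it was given, so a single program achieves both
time bounds. -/
def detTm : Tm :=
  all 0 10 (all 2 8 (all 4 10 (all 6 10
    (.ite (and (.get 12 (.var 0) (.var 2) (.var 4)) (.get 12 (.var 0) (.var 2) (.var 6)))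
      (eq (.var 4) (.var 6)) (.const 1)))))

def nodeSizeCmds : List Cmd :=
  [.size 10 (get1 10 (.const 1)), .size 11 (get1 10 (.const 2)), .size 16 detTm,
    .size 12 (.ite (size 16) (.const 1) (size 3)),
    .size 13 (mulSize 0 5 10), .size 14 (mulSize 0 4 13), .size 15 (mulSize 0 12 14),
    .size 18 (.fold 0 9 (.const 1) (.plus (.var 1) (.var 1))),
    .size 17 (.plus (.plus (size 11) (mulSize 0 18 10)) (mulSize 0 13 1))]

/-- Iterations are bounded by sizes, not by variables; so there are `n` rounds, of which only the
first ones, as many as the bit index says, halve the number. -/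
def shiftTm : Tm := .fold 3 2 (.var 0) (.ite (lt (.var 3) (.var 1)) (.half (.var 4)) (.var 4))

def bitTm : Tm := .minus shiftTm (.plus (.half shiftTm) (.half shiftTm))

def lastTm : Tm :=
  .fold 3 2 (size 2) (.ite (and (get2 7 (.var 0) (.var 3)) (lt (get1 1 (.var 3)) (.const 2)))
    (.var 3) (.var 4))

def setCmds : List Cmd := [.fill 7 5 2 0 bitTm, .fill 8 5 0 0 lastTm]

def gameCmds : List Cmd :=
  [.fill 11 6 0 0 (headerTm (size 15) (size 17) (.const 0)), .fill 13 15 15 0 edgeTm,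
    .fill 15 15 0 0 diaTm, .fill 17 15 0 0 prioTm]

def phaseTwo : List Cmd := nodeSizeCmds ++ setCmds ++ gameCmds

theorem phaseTwo_wf : phaseTwo.all Cmd.wf = true := by decide

variable {m n s : ℕ}

/-- The memory contains the tree automaton `A`, its tracking automaton, and the word automaton
`H`. -/
structure HasAut (A : APT (Fin m) (Fin n)) (H : NPW (Fin (m * ((n + 1) * (n + 1)))) (Fin s))
    (st : Store) : Prop extends HasAPT A st where
  tracker : ∀ (p : Fin n) (b : Fin (m * ((n + 1) * (n + 1)))) (p' : Fin n),
    st 6 p b p' = bit (p' ∈ A.tracker.δ p b)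
  autδ : ∀ (h : Fin s) (b : Fin (m * ((n + 1) * (n + 1)))) (h' : Fin s),
    st 12 h b h' = bit (h' ∈ H.δ h b)
  autPrio : ∀ h : Fin s, st 14 h 0 0 = H.prio h

/-- The memory moreover contains the sizes of the emptiness game. -/
structure HasSizes (A : APT (Fin m) (Fin n)) (H : NPW (Fin (m * ((n + 1) * (n + 1)))) (Fin s))
    (st : Store) : Prop extends HasAut A H st where
  size_s : st 4 10 0 0 = s
  size_Y : st 4 12 0 0 = choices H.Deterministic n
  size_13 : st 4 13 0 0 = 2 ^ n * s
  size_14 : st 4 14 0 0 = (m + 1) * (2 ^ n * s)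
  size_v : st 4 15 0 0 = choices H.Deterministic n * ((m + 1) * (2 ^ n * s))
  size_det : st 4 16 0 0 = bit H.Deterministic
  size_init_node : st 4 17 0 0 = initNode A H (choices_pos H.Deterministic n)

/-- The memory moreover contains a table of the sets of states. -/
structure HasSets (A : APT (Fin m) (Fin n)) (H : NPW (Fin (m * ((n + 1) * (n + 1)))) (Fin s))
    (st : Store) : Prop extends HasSizes A H st where
  bit : ∀ (U : Fin (2 ^ n)) (q : Fin n), st 7 U q 0 = bit (q ∈ codeSet U)
  pick : ∀ U : Fin (2 ^ n), st 8 U 0 0 = A.pickIndex (codeSet U) n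

variable {A : APT (Fin m) (Fin n)} {H : NPW (Fin (m * ((n + 1) * (n + 1)))) (Fin s)} {st : Store}
  {env : ℕ → ℕ}

theorem HasSizes.congr (h : HasSizes A H st) {st' : Store}
    (h' : ∀ a, a ∈ [1, 2, 3, 4, 6, 12, 14] → st' a = st a) : HasSizes A H st' where
  toHasAPT := h.toHasAPT.congr (fun a ha => h' a (by rcases ha with rfl | rfl | rfl <;> simp))
    fun b _ => by rw [h' 4 (by simp)]
  tracker := by rw [h' 6 (by simp)]; exact h.tracker
  autδ := by rw [h' 12 (by simp)]; exact h.autδ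
  autPrio := by rw [h' 14 (by simp)]; exact h.autPrio
  size_s := by rw [h' 4 (by simp)]; exact h.size_s
  size_Y := by rw [h' 4 (by simp)]; exact h.size_Y
  size_13 := by rw [h' 4 (by simp)]; exact h.size_13
  size_14 := by rw [h' 4 (by simp)]; exact h.size_14
  size_v := by rw [h' 4 (by simp)]; exact h.size_v
  size_det := by rw [h' 4 (by simp)]; exact h.size_det
  size_init_node := by rw [h' 4 (by simp)]; exact h.size_init_node

theorem HasSets.congr (h : HasSets A H st) {st' : Store}
    (h' : ∀ a, a ∈ [1, 2, 3, 4, 6, 7, 8, 12, 14] → st' a = st a) : HasSets A H st' where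
  toHasSizes := h.toHasSizes.congr fun a ha => h' a (by
    simp only [List.mem_cons, List.not_mem_nil, or_false] at ha ⊢; omega)
  bit := by rw [h' 7 (by simp)]; exact h.bit
  pick := by rw [h' 8 (by simp)]; exact h.pick

theorem eval_nodeTm (h : HasSizes A H st) {x y a U k : ℕ} (hy : y < x) (ha : a < x) (hU : U < x) :
    (nodeTm x y a U k).eval st env =
      env k + s * env U + 2 ^ n * s * env a + (m + 1) * (2 ^ n * s) * env y := by
  simp [nodeTm, hy, ha, hU, h.size_s, h.size_13, h.size_14]

/-- The environment after decoding a node. -/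
def nodeEnv (env : ℕ → ℕ) (x y a U k : ℕ) : ℕ → ℕ :=
  bind (bind (bind (bind env x y 0) (x + 2) a 0) (x + 4) U 0) (x + 6) k 0

theorem nodeEnv_spec (env : ℕ → ℕ) (x y a U k : ℕ) :
    nodeEnv env x y a U k x = y ∧ nodeEnv env x y a U k (x + 2) = a ∧
      nodeEnv env x y a U k (x + 4) = U ∧ nodeEnv env x y a U k (x + 6) = k ∧
      ∀ z < x, nodeEnv env x y a U k z = env z := by
  refine ⟨?_, ?_, ?_, ?_, fun z hz => ?_⟩ <;> simp only [nodeEnv, bind_apply] <;>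
    split_ifs <;> first | rfl | omega

/-- The search succeeds with the true components and, the coding of nodes being injective, with no
others. -/
theorem eval_decodeTm (h : HasSizes A H st) {u x : ℕ} (hu : u < x) {t : Tm}
    (y : Fin (choices H.Deterministic n)) (a : Fin (m + 1)) (U : Fin (2 ^ n)) (k : Fin s)
    (he : env u = nodeCode y a U k) :
    (decodeTm u x t).eval st env = bit (t.eval st (nodeEnv env x y a U k) ≠ 0) := by
  simp only [decodeTm, eval_ex, eval_and, eval_eq, bit_ne_zero, h.size_Y, h.size_m_succ,
    h.size_pow, h.size_s]
  refine bit_congr ⟨?_, fun ht => ⟨y, y.2, a, a.2, U, U.2, k, k.2, ?_, ht⟩⟩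
  · rintro ⟨y', hy', a', ha', U', hU', k', hk', h1, h2⟩
    obtain ⟨e1, e2, e3, e4, e5⟩ := nodeEnv_spec env x y' a' U' k'
    rw [eval_nodeTm h (by omega) (by omega) (by omega)] at h1
    have : nodeCode y a U k = nodeCode ⟨y', hy'⟩ ⟨a', ha'⟩ ⟨U', hU'⟩ ⟨k', hk'⟩ := by
      rw [← Fin.val_inj, ← he, nodeCode_val, ← e5 u hu]
      refine h1.trans ?_
      change nodeEnv env x y' a' U' k' (x + 6) + s * nodeEnv env x y' a' U' k' (x + 4) +
        2 ^ n * s * nodeEnv env x y' a' U' k' (x + 2) +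
        (m + 1) * (2 ^ n * s) * nodeEnv env x y' a' U' k' x = _
      rw [e1, e2, e3, e4]
    obtain ⟨rfl, rfl, rfl, rfl⟩ := nodeCode_inj.1 this
    exact h2
  · obtain ⟨e1, e2, e3, e4, e5⟩ := nodeEnv_spec env x y a U k
    rw [eval_nodeTm h (by omega) (by omega) (by omega)]
    change nodeEnv env x y a U k u = nodeEnv env x y a U k (x + 6) +
      s * nodeEnv env x y a U k (x + 4) + 2 ^ n * s * nodeEnv env x y a U k (x + 2) +
      (m + 1) * (2 ^ n * s) * nodeEnv env x y a U k x
    rw [e1, e2, e3, e4, e5 u hu, he, nodeCode_val]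

theorem eval_kindTm (h : HasAPT A st) {t : Tm} {x : Fin (n + 1)} (ht : t.eval st env = x)
    (c : StateKind) :
    (kindTm t c.code).eval st env = bit (∃ q, finSuccEquivLast x = some q ∧ A.kind q = c) := by
  simp only [kindTm, eval_and, eval_lt, eval_eq, eval_get1, eval_size, eval_const, ht, h.size_n,
    bit_ne_zero]
  have hcode : ∀ c c' : StateKind, c.code = c'.code → c = c' := by
    intro c c'; cases c <;> cases c' <;> simp [StateKind.code]
  refine bit_congr ⟨fun ⟨h1, h2⟩ => ⟨⟨x, h1⟩, finSuccEquivLast_eq_some.2 rfl, hcode _ _ ?_⟩, ?_⟩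
  · rw [← h.kind, ← h2]
  · rintro ⟨q, hq, rfl⟩
    rw [finSuccEquivLast_eq_some] at hq
    rw [hq]
    exact ⟨q.2, h.kind q⟩

theorem eval_choiceTm (h : HasAPT A st) {t t' : Tm} {v : ℕ} {x z : Fin (n + 1)} {a : Fin m}
    (ht : t.eval st env = x) (ht' : t'.eval st env = z) (hv : env v = a) :
    (choiceTm t (.var v) t').eval st env = bit (∃ q q', finSuccEquivLast x = some q ∧
      A.kind q = .localEx ∧ finSuccEquivLast z = some q' ∧ q' ∈ A.δ q a) := by
  have h1 := eval_kindTm h ht .localEx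
  simp only [kindTm, StateKind.code] at h1
  simp only [choiceTm, eval_and _ (and _ _), h1, bit_ne_zero, eval_and, eval_lt, eval_get,
    eval_size, eval_var, ht, ht', hv, h.size_n]
  refine bit_congr ⟨fun ⟨⟨q, h2, h3⟩, h4, h5⟩ =>
    ⟨q, ⟨z, h4⟩, h2, h3, finSuccEquivLast_eq_some.2 rfl, ?_⟩, ?_⟩
  · rw [finSuccEquivLast_eq_some] at h2
    rw [h2, h.δ q a ⟨z, h4⟩] at h5
    simpa using h5
  · rintro ⟨q, q', h2, h3, h4, h5⟩
    refine ⟨⟨q, h2, h3⟩, ?_⟩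
    rw [finSuccEquivLast_eq_some] at h2 h4
    rw [h2, h4, h.δ]
    exact ⟨q'.2, by simpa using h5⟩

end Program

/-! ### Components of nodes in terms of their numbers -/

section

variable {m n s Y : ℕ} (hY : Y ≤ n + 1) (y y' : Fin Y) (a a' : Fin (m + 1)) (U U' : Fin (2 ^ n))
  (k : Fin s)

theorem codeSet_injective : Function.Injective (codeSet : Fin (2 ^ n) → Set (Fin n)) :=
  ((Fintype.bijective_iff_surjective_and_card _).2 ⟨codeSet_surjective, by simp⟩).1

theorem viewOf_a_eq_none : (viewOf hY y a U k).a = none ↔ (a : ℕ) = m :=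
  finSuccEquivLast_eq_none

theorem viewOf_a_eq_some {b : Fin m} : (viewOf hY y a U k).a = some b ↔ (a : ℕ) = b :=
  finSuccEquivLast_eq_some

theorem viewOf_y_eq_none : (viewOf hY y a U k).y = none ↔ (y : ℕ) = 0 := by
  rw [← finSuccEquiv_zero, viewOf, (finSuccEquiv n).apply_eq_iff_eq, ← Fin.val_inj]
  rfl

theorem viewOf_y_eq_some {q : Fin n} : (viewOf hY y a U k).y = some q ↔ (y : ℕ) = q + 1 := by
  rw [← finSuccEquiv_succ, viewOf, (finSuccEquiv n).apply_eq_iff_eq, ← Fin.val_inj]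
  simp

theorem viewOf_a_eq {y₁ : Fin Y} {U₁ : Fin (2 ^ n)} {k₁ : Fin s} :
    (viewOf hY y₁ a' U₁ k₁).a = (viewOf hY y a U k).a ↔ (a' : ℕ) = a := by
  rw [viewOf, viewOf, finSuccEquivLast.apply_eq_iff_eq, Fin.val_inj]

theorem viewOf_U_eq {y₁ : Fin Y} {a₁ : Fin (m + 1)} {k₁ : Fin s} :
    (viewOf hY y₁ a₁ U' k₁).U = (viewOf hY y a U k).U ↔ (U' : ℕ) = U := by
  rw [viewOf, viewOf, codeSet_injective.eq_iff, Fin.val_inj]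

end

namespace Program

open Tm

variable {m n s : ℕ} {A : APT (Fin m) (Fin n)}
  {H : NPW (Fin (m * ((n + 1) * (n + 1)))) (Fin s)} {st : Store} {env : ℕ → ℕ}

/-- The variables `x`, `x + 2`, `x + 4`, `x + 6` hold the components of a node. -/
structure HoldsNode (env : ℕ → ℕ) (x : ℕ) {Y : ℕ} (y : Fin Y) (a : Fin (m + 1)) (U : Fin (2 ^ n))
    (k : Fin s) : Prop where
  y : env x = y
  a : env (x + 2) = a
  U : env (x + 4) = U
  k : env (x + 6) = k

theorem eval_pickTm (h : HasSets A H st) {U : Fin (2 ^ n)} (hU : env 7 = U) :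
    pickTm.eval st env = A.pickIndex (codeSet U) n := by
  simp [pickTm, hU, h.pick]

theorem bit_inj {P P' : Prop} : TreeEmptiness.bit P = TreeEmptiness.bit P' ↔ (P ↔ P') := by
  unfold TreeEmptiness.bit
  split_ifs <;> simp_all

variable {Y : ℕ} {y y' : Fin Y} {a a' : Fin (m + 1)} {U U' : Fin (2 ^ n)} {k k' : Fin s}

theorem eval_labelTm (h : HasSets A H st) (hY : Y ≤ n + 1) (e : HoldsNode env 3 y a U k)
    (e' : HoldsNode env 11 y' a' U' k') : labelTm.eval st env ≠ 0 ↔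
    (viewOf hY y a U k).y = none ∧ (viewOf hY y a U k).a = none ∧ (viewOf hY y' a' U' k').a ≠ none ∧
      (viewOf hY y' a' U' k').U = (viewOf hY y a U k).U ∧
      (viewOf hY y' a' U' k').h = (viewOf hY y a U k).h ∧ (viewOf hY y' a' U' k').y = none := by
  have ha' := a'.2
  have hlt : (a' : ℕ) < m ↔ ¬ (a' : ℕ) = m := by omega
  rw [viewOf_y_eq_none, viewOf_a_eq_none, ne_eq, ne_eq, viewOf_a_eq_none, viewOf_U_eq,
    viewOf_y_eq_none, ← hlt]
  simp only [labelTm, eval_and, eval_eq, eval_lt, eval_var, eval_const, eval_size, e.y, e.a, e.U,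
    e.k, e'.y, e'.a, e'.U, e'.k, h.size_m, bit_eq_zero, not_not, bit_ne_zero, Fin.val_inj]
  rfl

theorem eval_chooseTm (h : HasSets A H st) (hY : Y ≤ n + 1) (e : HoldsNode env 3 y a U k)
    (e' : HoldsNode env 11 y' a' U' k') : chooseTm.eval st env ≠ 0 ↔ ¬ st 4 16 0 0 ≠ 0 ∧
    (viewOf hY y a U k).y = none ∧ (viewOf hY y' a' U' k').a = (viewOf hY y a U k).a ∧
      (viewOf hY y' a' U' k').U = (viewOf hY y a U k).U ∧
      (viewOf hY y' a' U' k').h = (viewOf hY y a U k).h ∧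
      ∃ b q q', (viewOf hY y a U k).a = some b ∧ A.pick (viewOf hY y a U k).U = some q ∧
        A.kind q = .localEx ∧ (viewOf hY y' a' U' k').y = some q' ∧ q' ∈ A.δ q b := by
  rw [viewOf_y_eq_none, viewOf_a_eq, viewOf_U_eq]
  simp only [viewOf_a_eq_some, viewOf_y_eq_some]
  simp only [chooseTm, eval_and, eval_eq, eval_lt, eval_var, eval_const, eval_size, e.y, e.a, e.U,
    e.k, e'.y, e'.a, e'.U, e'.k, h.size_m, bit_ne_zero, Fin.val_inj, not_not]
  refine and_congr_right fun _ => and_congr_right fun _ => and_congr_right fun _ =>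
    and_congr_right fun _ => and_congr Iff.rfl ?_
  -- For `y' = 0` the truncated difference is meaningless; the test `0 < y'` excludes that case.
  have hz : (y' : ℕ) - 1 < n + 1 := by have := y'.2; omega
  have key : ∀ ha : (a : ℕ) < m, _ := fun ha => eval_choiceTm (env := env) (v := 5) (a := ⟨a, ha⟩)
    (z := ⟨y' - 1, hz⟩) (x := ⟨_, A.pickIndex_lt (codeSet U) n⟩) h.toHasAPT (eval_pickTm h e.U)
    (t' := .minus (.var 11) (.const 1)) (by simp [e'.y]) e.a
  constructor
  · rintro ⟨ha, hy', hc⟩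
    rw [key ha, bit_ne_zero] at hc
    obtain ⟨q, q', h1, h2, h3, h4⟩ := hc
    refine ⟨⟨a, ha⟩, q, q', rfl, h1, h2, ?_, h4⟩
    rw [finSuccEquivLast_eq_some] at h3
    simp only at h3
    omega
  · rintro ⟨b, q, q', hb, h1, h2, h3, h4⟩
    have ha : (a : ℕ) < m := by rw [hb]; exact b.2
    refine ⟨ha, by omega, ?_⟩
    rw [key ha, bit_ne_zero]
    have hab : (⟨a, ha⟩ : Fin m) = b := Fin.ext hb
    exact ⟨q, q', h1, h2, finSuccEquivLast_eq_some.2 (by simp only; omega), hab ▸ h4⟩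

theorem eval_guardTm (h : HasSets A H st) (hY : Y ≤ n + 1) (e : HoldsNode env 3 y a U k)
    (e' : HoldsNode env 11 y' a' U' k') {b : Fin m} {x z : Fin (n + 1)} (hb : (a : ℕ) = b)
    (hx : env 19 = x) (hz : env 21 = z) :
    guardTm.eval st env ≠ 0 ↔ A.ReadingMove A.pick (st 4 16 0 0 ≠ 0) (viewOf hY y a U k)
      (viewOf hY y' a' U' k').a b (finSuccEquivLast x) (finSuccEquivLast z) := by
  have hp : A.pick (viewOf hY y a U k).U = finSuccEquivLast x ↔ A.pickIndex (codeSet U) n = x := by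
    rw [APT.pick, finSuccEquivLast.apply_eq_iff_eq, ← Fin.val_inj]
    rfl
  have hn : A.pick (viewOf hY y a U k).U = none ↔ A.pickIndex (codeSet U) n = n := APT.pick_eq_none
  have hc := eval_choiceTm (env := env) (t := .var 19) (t' := .var 21) h.toHasAPT hx hz
    (show env 5 = b from e.a.trans hb)
  have h1 : (kindTm (.var 19) 1).eval st env = _ :=
    eval_kindTm h.toHasAPT (t := .var 19) hx .localUniv
  have h2 : (kindTm (.var 19) 2).eval st env = _ :=
    eval_kindTm h.toHasAPT (t := .var 19) hx .modalEx
  simp only [guardTm, eval_and, eval_or, eval_eq, eval_lt, eval_var, eval_const, eval_size,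
    eval_plus, eval_pickTm h e.U, hc, h1, h2, hx, hz, bit_ne_zero, h.size_n, h.size_m, e.y, e.a,
    e'.a, APT.ReadingMove, hp, hn, viewOf_y_eq_none, viewOf_a_eq_none, viewOf_a_eq, ne_eq,
    finSuccEquivLast_eq_none]
  -- Only the alternative with a pending choice is not literal. A letter without choice has code
  -- `n`, and `n + 1` exceeds every last component of a node.
  refine or_congr ?_ Iff.rfl
  have hx' := x.2
  rcases hq : finSuccEquivLast z with _ | q
  · rw [finSuccEquivLast_eq_none] at hq
    have := y.2
    constructor
    · rintro ⟨g, -⟩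
      omega
    · rintro ⟨g, -⟩
      exact absurd hq g
  · rw [finSuccEquivLast_eq_some] at hq
    rw [viewOf_y_eq_some]
    have := q.2
    constructor
    · rintro ⟨g1, g2, g3, g4⟩
      exact ⟨by omega, by omega, by omega, g3, g4⟩
    · rintro ⟨g1, g2, g3, g4, g5⟩
      exact ⟨by omega, by omega, g4, g5⟩

theorem eval_letterTm_eq (h : HasAPT A st) {x v p q : ℕ} (hv : v < x) (hp : p < x) {b : Fin m}
    {i j : Fin (n + 1)} (ea : env v = b) (ep : env p = i) (eq : env q = j) :
    (letterTm x v p q).eval st env =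
      letterCode b (finSuccEquivLast i) (finSuccEquivLast j) := by
  rw [eval_letterTm hv hp, h.size_n_succ, h.size_sq, ea, ep, eq, letterCode_val]

/-- The code of the new set is never computed: the proposed set is compared with the set of
successors member by member. -/
theorem eval_postTm (h : HasSets A H st) (hY : Y ≤ n + 1) (e : HoldsNode env 3 y a U k)
    (e' : HoldsNode env 11 y' a' U' k') {b : Fin m} {x z : Fin (n + 1)} (hb : (a : ℕ) = b)
    (hx : env 19 = x) (hz : env 21 = z) :
    postTm.eval st env ≠ 0 ↔ (viewOf hY y' a' U' k').U = A.tracker.post (viewOf hY y a U k).U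
      (letterCode b (finSuccEquivLast x) (finSuccEquivLast z)) := by
  have hU : env 7 = U := e.U
  have hU' : env 15 = U' := e'.U
  have ha : env 5 = b := e.a.trans hb
  have key : ∀ q p : Fin n, (letterTm 27 5 19 21).eval st (bind (bind env 23 q 0) 25 p 0) =
      letterCode b (finSuccEquivLast x) (finSuccEquivLast z) := fun q p =>
    eval_letterTm_eq h.toHasAPT (by omega) (by omega) (by simpa using ha) (by simpa using hx)
      (by simpa using hz)
  rw [Set.ext_iff, Fin.forall_iff]
  simp only [postTm, eval_all, bit_ne_zero, h.size_n, eval_eq]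
  refine forall₂_congr fun q hq => ?_
  have h1 : (get2 7 (.var 15) (.var 23)).eval st (bind env 23 q 0) =
      TreeEmptiness.bit ((⟨q, hq⟩ : Fin n) ∈ codeSet U') := by
    rw [← h.bit]
    simp [hU']
  rw [h1, eval_ex, bit_inj]
  change (_ ↔ _) ↔ (_ ↔ ∃ p : Fin n, _ ∧ _)
  refine iff_congr Iff.rfl ?_
  rw [h.size_n, Fin.exists_iff]
  refine exists_congr fun p => ?_
  rw [← exists_prop]
  refine exists_congr fun hp => ?_
  rw [eval_and, bit_ne_zero, eval_get, key ⟨q, hq⟩ ⟨p, hp⟩]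
  have h2 : (get2 7 (.var 7) (.var 25)).eval st (bind (bind env 23 q 0) 25 p 0) =
      TreeEmptiness.bit ((⟨p, hp⟩ : Fin n) ∈ codeSet U) := by
    rw [← h.bit]
    simp [hU]
  have h3 := h.tracker ⟨p, hp⟩ (letterCode b (finSuccEquivLast x) (finSuccEquivLast z)) ⟨q, hq⟩
  simp only at h3
  simp only [h2, bit_ne_zero, eval_var, bind_apply, if_true, Nat.reduceEqDiff, if_false]
  rw [h3, bit_ne_zero]
  rfl

theorem HoldsNode.bind {x v w : ℕ} (e : HoldsNode env x y a U k) (hv : x + 6 < v) :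
    HoldsNode (Tm.bind env v w 0) x y a U k := by
  constructor <;> rw [bind_apply, if_neg (by omega), if_neg (by omega)]
  · exact e.y
  · exact e.a
  · exact e.U
  · exact e.k

theorem eval_moveTm (h : HasSets A H st) (hY : Y ≤ n + 1) (e : HoldsNode env 3 y a U k)
    (e' : HoldsNode env 11 y' a' U' k') :
    moveTm.eval st env ≠ 0 ↔ EmptinessEdge A letterCode A.tracker A.pick H H.Deterministic
      (viewOf hY y a U k) (viewOf hY y' a' U' k') := by
  have hdet : st 4 16 0 0 ≠ 0 ↔ H.Deterministic := by rw [h.size_det, bit_ne_zero]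
  rw [emptinessEdge_iff, moveTm, eval_or, bit_ne_zero, eval_labelTm h hY e e', eval_or, bit_ne_zero,
    eval_chooseTm h hY e e', hdet]
  refine or_congr Iff.rfl (or_congr Iff.rfl ?_)
  simp only [eval_ex, bit_ne_zero, h.size_n_succ]
  have key : ∀ (b : Fin m) (x z : Fin (n + 1)), (a : ℕ) = b →
      (eval st (Tm.bind (Tm.bind env 19 x 0) 21 z 0) (and (lt (.var 5) (size 1)) (and guardTm
        (and (.get 12 (.var 9) (letterTm 23 5 19 21) (.var 17))
          (and (eq (.var 11) (.const 0)) postTm)))) ≠ 0 ↔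
      A.ReadingMove A.pick H.Deterministic (viewOf hY y a U k) (viewOf hY y' a' U' k').a b
        (finSuccEquivLast x) (finSuccEquivLast z) ∧
      (viewOf hY y' a' U' k').h ∈ H.δ (viewOf hY y a U k).h
        (letterCode b (finSuccEquivLast x) (finSuccEquivLast z)) ∧
      (viewOf hY y' a' U' k').y = none ∧ (viewOf hY y' a' U' k').U =
        A.tracker.post (viewOf hY y a U k).U
          (letterCode b (finSuccEquivLast x) (finSuccEquivLast z))) := by
    intro b x z hb
    have e₁ := (e.bind (v := 19) (w := x) (by omega)).bind (v := 21) (w := z) (by omega)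
    have e₁' := (e'.bind (v := 19) (w := x) (by omega)).bind (v := 21) (w := z) (by omega)
    have hx : Tm.bind (Tm.bind env 19 x 0) 21 z 0 19 = x := rfl
    have hz : Tm.bind (Tm.bind env 19 x 0) 21 z 0 21 = z := rfl
    generalize Tm.bind (Tm.bind env 19 x 0) 21 z 0 = env' at e₁ e₁' hx hz
    have hk : env' 9 = k := e₁.k
    have hk' : env' 17 = k' := e₁'.k
    have hlt : env' 5 < m := by rw [show env' 5 = a from e₁.a, hb]; exact b.2
    have hl := eval_letterTm_eq h.toHasAPT (x := 23) (v := 5) (p := 19) (q := 21) (by omega)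
      (by omega) (show env' 5 = b from e₁.a.trans hb) hx hz
    simp only [eval_and, bit_ne_zero, eval_guardTm h hY e₁ e₁' hb hx hz,
      eval_postTm h hY e₁ e₁' hb hx hz, eval_lt, eval_var, eval_size, h.size_m, hlt, true_and,
      hdet, eval_get, hk, hk', hl, h.autδ, eval_eq, eval_const, viewOf_y_eq_none]
    rw [show env' 11 = y' from e₁'.y]
    rfl
  constructor
  · rintro ⟨x, hx, z, hz, hev⟩
    -- The explicit test on the label ensures that the letter number is meaningful.
    have ha : (a : ℕ) < m := by
      have := hev
      simp only [eval_and, bit_ne_zero, eval_lt, eval_var, eval_size, h.size_m] at this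
      rw [← show env 5 = a from e.a]
      exact this.1
    exact ⟨⟨a, ha⟩, _, _, (viewOf_a_eq_some ..).2 rfl, (key ⟨a, ha⟩ ⟨x, hx⟩ ⟨z, hz⟩ rfl).1 hev⟩
  · rintro ⟨b, p, q, hb, hev⟩
    obtain ⟨x, rfl⟩ := finSuccEquivLast.surjective p
    obtain ⟨z, rfl⟩ := finSuccEquivLast.surjective q
    exact ⟨x, x.2, z, z.2, (key b x z ((viewOf_a_eq_some ..).1 hb)).2 hev⟩

theorem HoldsNode.nodeEnv (env : ℕ → ℕ) (x : ℕ) (y : Fin Y) (a : Fin (m + 1)) (U : Fin (2 ^ n))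
    (k : Fin s) : HoldsNode (Program.nodeEnv env x y a U k) x y a U k := by
  obtain ⟨e1, e2, e3, e4, -⟩ := nodeEnv_spec env x y a U k
  exact ⟨e1, e2, e3, e4⟩

theorem HoldsNode.nodeEnv_of_lt {x x' : ℕ} {env : ℕ → ℕ} (e : HoldsNode env x y a U k)
    (hx : x + 6 < x') (y₁ a₁ U₁ k₁ : ℕ) :
    HoldsNode (Program.nodeEnv env x' y₁ a₁ U₁ k₁) x y a U k := by
  obtain ⟨-, -, -, -, e5⟩ := nodeEnv_spec env x' y₁ a₁ U₁ k₁
  constructor <;> rw [e5 _ (by omega)]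
  · exact e.y
  · exact e.a
  · exact e.U
  · exact e.k

theorem eval_edgeTm (h : HasSets A H st)
    (u u' : Fin (choices H.Deterministic n * ((m + 1) * (2 ^ n * s)))) (k : ℕ) :
    edgeTm.eval st (indexEnv u u' k) =
      TreeEmptiness.bit ((emptinessGame A H H.Deterministic).edge u u') := by
  obtain ⟨y, a, U, q, rfl⟩ := nodeCode_surjective u
  obtain ⟨y', a', U', q', rfl⟩ := nodeCode_surjective u'
  rw [edgeTm, eval_decodeTm h.toHasSizes (u := 0) (env := indexEnv _ _ k) (by omega) y a U q
    (indexEnv_zero ..), eval_decodeTm h.toHasSizes (by omega) y' a' U' q' (by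
      rw [(nodeEnv_spec _ _ _ _ _ _).2.2.2.2 1 (by omega)]; rfl)]
  refine bit_congr ?_
  rw [bit_ne_zero, eval_moveTm h (choices_le _ _)
    ((HoldsNode.nodeEnv _ 3 y a U q).nodeEnv_of_lt (by omega) _ _ _ _) (.nodeEnv _ 11 y' a' U' q')]
  simp only [emptinessGame, nodeView_nodeCode]

theorem eval_diaTm (h : HasSets A H st)
    (u : Fin (choices H.Deterministic n * ((m + 1) * (2 ^ n * s)))) :
    diaTm.eval st (indexEnv u 0 0) =
      TreeEmptiness.bit ((emptinessGame A H H.Deterministic).dia u) := by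
  obtain ⟨y, a, U, q, rfl⟩ := nodeCode_surjective u
  rw [diaTm, eval_decodeTm h.toHasSizes (u := 0) (env := indexEnv _ 0 0) (by omega) y a U q
    (indexEnv_zero ..)]
  refine bit_congr ?_
  have e := HoldsNode.nodeEnv (indexEnv (nodeCode y a U q) 0 0) 3 y a U q
  generalize Program.nodeEnv (indexEnv (nodeCode y a U q) 0 0) 3 y a U q = env at e
  have h1 : (kindTm pickTm 0).eval st env = _ :=
    eval_kindTm h.toHasAPT (x := ⟨_, A.pickIndex_lt (codeSet U) n⟩) (eval_pickTm h e.U) .localEx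
  simp only [emptinessGame, nodeView_nodeCode, APT.EmptinessDia, viewOf_y_eq_none,
    viewOf_a_eq_none, eval_and, eval_or, bit_ne_zero, eval_eq, eval_var, eval_size, eval_const,
    h.size_m, h1, e.y, e.a]
  rfl

/-- Repeated subtraction: every round that does not start below `s` lowers the value by at least
one, so after more than `u` rounds the remainder is reached. -/
theorem iter_mod (u s : ℕ) (k : ℕ) (f : ℕ → ℕ → ℕ)
    (hf : ∀ j acc, f j acc = if acc < s then acc else acc - s) (hs : 0 < s) :
    iter u f k % s = u % s ∧ (iter u f k < s ∨ iter u f k + k ≤ u) := by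
  induction k with
  | zero => exact ⟨rfl, .inr le_rfl⟩
  | succ k ih =>
    rw [iter, hf]
    split_ifs with h1
    · exact ⟨ih.1, .inl h1⟩
    · exact ⟨(Nat.mod_eq_sub_mod (not_lt.1 h1)).symm.trans ih.1, by omega⟩

theorem eval_prioTm (h : HasSizes A H st)
    (u : Fin (choices H.Deterministic n * ((m + 1) * (2 ^ n * s)))) :
    prioTm.eval st (indexEnv u 0 0) = (emptinessGame A H H.Deterministic).prio u := by
  have hu := u.2
  obtain ⟨y, a, U, q, rfl⟩ := nodeCode_surjective u
  have hs : 0 < s := q.pos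
  have hmod : (modTm 3 15 10 0).eval st (indexEnv (nodeCode y a U q) 0 0) = q := by
    rw [modTm, eval_fold, h.size_v]
    obtain ⟨h1, h2⟩ := iter_mod (nodeCode y a U q) s
      (choices H.Deterministic n * ((m + 1) * (2 ^ n * s))) (fun j acc =>
        (Tm.ite (lt (.var (3 + 1)) (size 10)) (.var (3 + 1)) (.minus (.var (3 + 1)) (size 10))).eval
          st (Tm.bind (indexEnv (nodeCode y a U q) 0 0) 3 j acc))
      (fun j acc => by
        by_cases hacc : acc < s <;> simp [hacc, h.size_s]) hs
    have hlt := h2.resolve_right (by omega)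
    rw [Nat.mod_eq_of_lt hlt] at h1
    refine h1.trans ?_
    -- The state of `H` is the least significant digit of a node number.
    rw [nodeCode_val, show (q : ℕ) + s * U + 2 ^ n * s * a + (m + 1) * (2 ^ n * s) * y =
      q + s * (U + 2 ^ n * a + (m + 1) * 2 ^ n * y) by ring, Nat.add_mul_mod_self_left,
      Nat.mod_eq_of_lt q.2]
  rw [prioTm, eval_plus, eval_get1, hmod, h.autPrio]
  simp only [emptinessGame, nodeView_nodeCode]
  rfl

end Program

theorem iter_congr {x : ℕ} {f g : ℕ → ℕ → ℕ} {k : ℕ} (h : ∀ j < k, ∀ acc, f j acc = g j acc) :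
    iter x f k = iter x g k := by
  induction k with
  | zero => rfl
  | succ k ih => rw [iter, iter, ih fun j hj => h j (by omega), h k (by omega)]

theorem iter_half (U q k : ℕ) :
    iter U (fun j acc => if j < q then acc / 2 else acc) k = U / 2 ^ min k q := by
  induction k with
  | zero => simp [iter]
  | succ k ih =>
    rw [iter, ih]
    split_ifs with h
    · rw [Nat.div_div_eq_div_mul, ← pow_succ]
      congr 2
      omega
    · congr 2
      omega

namespace Program

open Tm

variable {m n s : ℕ} {A : APT (Fin m) (Fin n)}
  {H : NPW (Fin (m * ((n + 1) * (n + 1)))) (Fin s)} {st : Store}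

theorem eval_detTm (h : HasAut A H st) (hs : st 4 10 0 0 = s) (env : ℕ → ℕ) :
    detTm.eval st env = TreeEmptiness.bit H.Deterministic := by
  simp only [detTm, eval_all, bit_ne_zero, h.size_l, hs, eval_ite, eval_and, eval_get, eval_eq,
    eval_var, eval_const, bind_apply]
  refine bit_congr ?_
  constructor
  · intro hd q b x hx y hy
    have := hd q q.2 b b.2 x x.2 y y.2
    simp only [Nat.reduceEqDiff, if_true, if_false, OfNat.ofNat_ne_zero, h.autδ, bit_ne_zero, hx, hy,
      bit_eq_zero, true_and] at this
    simpa [Fin.val_inj] using this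
  · intro hd q hq b hb x hx y hy
    have h1 := h.autδ ⟨q, hq⟩ ⟨b, hb⟩ ⟨x, hx⟩
    have h2 := h.autδ ⟨q, hq⟩ ⟨b, hb⟩ ⟨y, hy⟩
    simp only at h1 h2
    by_cases h3 : (⟨x, hx⟩ : Fin s) ∈ H.δ ⟨q, hq⟩ ⟨b, hb⟩ ∧ (⟨y, hy⟩ : Fin s) ∈ H.δ ⟨q, hq⟩ ⟨b, hb⟩
    · have := Fin.val_inj.2 (hd _ _ h3.1 h3.2)
      simp_all
    · rw [if_pos]
      · simp
      · simpa [h1, h2] using h3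

theorem HasAut.congr (h : HasAut A H st) {st' : Store}
    (h' : ∀ a, a ≠ 4 → st' a = st a) (h4 : ∀ b < 10, st' 4 b 0 0 = st 4 b 0 0) :
    HasAut A H st' where
  toHasAPT := h.toHasAPT.congr (fun a ha => h' a (by omega)) h4
  tracker := by rw [h' 6 (by omega)]; exact h.tracker
  autδ := by rw [h' 12 (by omega)]; exact h.autδ
  autPrio := by rw [h' 14 (by omega)]; exact h.autPrio

theorem nodeSizeCmds_spec (h : HasAut A H st) (hs : st 10 1 0 0 = s) (hi : st 10 2 0 0 = H.init) :
    HasSizes A H (execAll st nodeSizeCmds) ∧ execAll st nodeSizeCmds 4 11 0 0 = H.init ∧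
      execAll st nodeSizeCmds 4 18 0 0 = 2 ^ (A.init : ℕ) ∧
      ∀ a, a ≠ 4 → execAll st nodeSizeCmds a = st a := by
  -- The determinism test can be evaluated once the number of states of `H` is available as a loop
  -- bound.
  set st₂ := execAll st [.size 10 (get1 10 (.const 1)), .size 11 (get1 10 (.const 2))] with hst₂
  have h' : HasAut A H st₂ := by
    refine h.congr (fun a ha => ?_) fun b hb => ?_
    · funext i j k
      simp [hst₂, execAll, Cmd.exec_size_apply, ha]
    · have h1 : b ≠ 10 := by omega
      have h2 : b ≠ 11 := by omega
      simp [hst₂, execAll, Cmd.exec_size_apply, h1, h2]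
  have hs₂ : st₂ 4 10 0 0 = s := by simp [hst₂, execAll, Cmd.exec_size_apply, hs]
  have hi₂ : st₂ 4 11 0 0 = H.init := by simp [hst₂, execAll, Cmd.exec_size_apply, hi]
  have hd := eval_detTm h' hs₂ (indexEnv 0 0 0)
  have hst : ∀ a, a ≠ 4 → execAll st nodeSizeCmds a = st a := fun a ha => by
    funext i j k
    simp [nodeSizeCmds, execAll, Cmd.exec_size_apply, ha]
  have hlow : ∀ b < 10, execAll st nodeSizeCmds 4 b 0 0 = st 4 b 0 0 := fun b hb =>
    execAll_size_of_notMem _ (by decide) (by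
      simp only [show sizeTargets nodeSizeCmds = [10, 11, 16, 12, 13, 14, 15, 18, 17] from rfl,
        List.mem_cons, List.not_mem_nil, or_false]
      omega)
  have hY : (if TreeEmptiness.bit H.Deterministic = 0 then n + 1 else 1) =
      choices H.Deterministic n := by
    classical
    unfold choices TreeEmptiness.bit
    split_ifs <;> simp_all
  have hrest : execAll st nodeSizeCmds = execAll st₂ (nodeSizeCmds.drop 2) := rfl
  have hval : ∀ b i j k, b = 4 → execAll st nodeSizeCmds b i j k =
      execAll st₂ (nodeSizeCmds.drop 2) 4 i j k := fun b i j k hb => by rw [hb, hrest]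
  refine ⟨⟨h.congr hst hlow, ?_, ?_, ?_, ?_, ?_, ?_, ?_⟩, ?_, ?_, hst⟩
  all_goals rw [hval _ _ _ _ rfl]
  all_goals simp [-bit_eq_zero, nodeSizeCmds, execAll, Cmd.exec_size_apply, eval_fold, iter_double,
    hd, hs₂, hi₂, hY, h'.size_n_succ, h'.size_m_succ, h'.size_pow, h'.size_init, h'.size_m, initNode_val]

theorem eval_bitTm (h : HasAPT A st) {U q : ℕ} (hq : q < n) (k : ℕ) :
    bitTm.eval st (indexEnv U q k) = TreeEmptiness.bit (U.testBit q = true) := by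
  have hshift : shiftTm.eval st (indexEnv U q k) = U / 2 ^ q := by
    have hmin : min n q = q := by omega
    rw [shiftTm, eval_fold, h.size_n]
    refine (iter_congr fun j _ acc => ?_).trans ((iter_half U q n).trans (by rw [hmin]))
    by_cases hj : j < q <;> simp [hj]
  rw [bitTm, eval_minus, eval_plus, eval_half, hshift, Nat.testBit_eq_decide_div_mod_eq]
  unfold TreeEmptiness.bit
  split_ifs with h1 <;> simp only [decide_eq_true_eq] at h1 <;> omega

theorem eval_lastTm (h : HasAPT A st) (hbit : ∀ (U : Fin (2 ^ n)) (q : Fin n),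
    st 7 U q 0 = TreeEmptiness.bit (q ∈ codeSet U)) (U : Fin (2 ^ n)) (j k : ℕ) :
    lastTm.eval st (indexEnv U j k) = A.pickIndex (codeSet U) n := by
  rw [lastTm, eval_fold, h.size_n, APT.pickIndex]
  simp only [eval_size, h.size_n]
  refine iter_congr fun i hi acc => ?_
  have h1 := hbit U ⟨i, hi⟩
  have h2 := h.kind ⟨i, hi⟩
  simp only at h1 h2
  simp only [eval_ite, eval_and, eval_get2, eval_get1, eval_lt, eval_const, eval_var, bind_apply,
    OfNat.zero_ne_ofNat, Nat.reduceEqDiff, Nat.reduceAdd, if_true, if_false, indexEnv_zero, h1, h2,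
    code_lt_two, bit_ne_zero]
  by_cases hc : ⟨i, hi⟩ ∈ codeSet U ∧ (A.kind ⟨i, hi⟩).IsLocal
  · rw [if_neg (by simpa using hc), if_pos ⟨hi, hc⟩]
  · rw [if_pos (by simpa using hc), if_neg fun h => hc h.2]

theorem fill_of_ne {arr b₁ b₂ b₃ a : ℕ} {t : Tm} {st : Store} (ha : a ≠ arr) :
    (Cmd.fill arr b₁ b₂ b₃ t).exec st a = st a := by
  funext i j k
  rw [Cmd.exec_fill_apply, if_neg (fun h => ha h.1)]

theorem setCmds_spec (h : HasSizes A H st) : HasSets A H (execAll st setCmds) ∧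
    ∀ a, a ≠ 7 → a ≠ 8 → execAll st setCmds a = st a := by
  set st₁ := (Cmd.fill 7 5 2 0 bitTm).exec st with hst₁
  have h₁ : HasSizes A H st₁ := h.congr fun a ha => fill_of_ne (by
    rintro rfl; revert ha; decide)
  have hbit : ∀ (U : Fin (2 ^ n)) (q : Fin n),
      st₁ 7 U q 0 = TreeEmptiness.bit (q ∈ codeSet U) := fun U q => by
    rw [hst₁, Cmd.exec_fill_apply, h.size_pow, h.size_n, h.size_one,
      if_pos ⟨rfl, U.2, q.2, by omega⟩, eval_bitTm h.toHasAPT q.2]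
    rfl
  have hcs : execAll st setCmds = (Cmd.fill 8 5 0 0 lastTm).exec st₁ := rfl
  rw [hcs]
  refine ⟨⟨h₁.congr fun a ha => fill_of_ne (by rintro rfl; revert ha; decide), fun U q => ?_,
    fun U => ?_⟩, fun a h7 h8 => ?_⟩
  · rw [fill_of_ne (by omega), hbit]
  · rw [Cmd.exec_fill_apply, h₁.size_pow, h₁.size_one, if_pos ⟨rfl, U.2, by omega, by omega⟩]
    exact eval_lastTm h₁.toHasAPT hbit U 0 0
  · rw [fill_of_ne h8, hst₁, fill_of_ne h7]

/-- The odd arrays from `11` on must equal the solver's input exactly, including zeros in all unused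
cells; hence the assumption that they are blank beforehand. -/
theorem gameCmds_spec (h : HasSets A H st) (h0 : ∀ a i j k, st (2 * a + 11) i j k = 0) :
    (∀ a, execAll st gameCmds (2 * a + 11) = inputGame (emptinessGame A H H.Deterministic)
        (initNode A H (choices_pos H.Deterministic n)) a) ∧
      ∀ a, a ∉ [11, 13, 15, 17] → execAll st gameCmds a = st a := by
  set c₁ := Cmd.fill 11 6 0 0 (headerTm (size 15) (size 17) (.const 0)) with hc₁
  set c₂ := Cmd.fill 13 15 15 0 edgeTm with hc₂
  set c₃ := Cmd.fill 15 15 0 0 diaTm with hc₃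
  set c₄ := Cmd.fill 17 15 0 0 prioTm with hc₄
  set st₁ := c₁.exec st with hst₁
  set st₂ := c₂.exec st₁ with hst₂
  set st₃ := c₃.exec st₂ with hst₃
  have hcs : execAll st gameCmds = c₄.exec st₃ := rfl
  have f₁ : ∀ a, a ≠ 11 → st₁ a = st a := fun a ha => fill_of_ne ha
  have f₂ : ∀ a, a ≠ 13 → st₂ a = st₁ a := fun a ha => fill_of_ne ha
  have f₃ : ∀ a, a ≠ 15 → st₃ a = st₂ a := fun a ha => fill_of_ne ha
  have f₄ : ∀ a, a ≠ 17 → c₄.exec st₃ a = st₃ a := fun a ha => fill_of_ne ha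
  have h₁ : HasSets A H st₁ := h.congr fun a ha => f₁ a (by rintro rfl; revert ha; decide)
  have h₂ : HasSets A H st₂ := h₁.congr fun a ha => f₂ a (by rintro rfl; revert ha; decide)
  have h₃ : HasSets A H st₃ := h₂.congr fun a ha => f₃ a (by rintro rfl; revert ha; decide)
  refine ⟨fun a => ?_, fun a ha => ?_⟩
  · rw [hcs]
    match a with
    | 0 =>
      rw [f₄ _ (by omega), f₃ _ (by omega), f₂ _ (by omega)]
      exact fill_header h.size_three h.size_one (h0 0) _ _ _ (fun _ => h.size_v)
        (fun _ => h.size_init_node) fun _ => rfl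
    | 1 =>
      rw [f₄ _ (by omega), f₃ _ (by omega)]
      funext i j k
      rw [hst₂, hc₂, Cmd.exec_fill_apply, h₁.size_v, h₁.size_one, f₁ _ (by omega), h0 1]
      simp only [inputGame, tab]
      by_cases hk : k = 0
      · subst hk
        rw [if_pos rfl]
        split_ifs with h1 h2 h3 h3 h2
        · exact eval_edgeTm h₁ ⟨i, h2⟩ ⟨j, h3⟩ 0
        all_goals first | rfl | (exfalso; tauto)
      · rw [if_neg hk, if_neg (by omega)]
    | 2 =>
      rw [f₄ _ (by omega)]
      refine fill_tab h₂.size_v h₂.size_one (fun i j k => ?_) _ _ fun u => eval_diaTm h₂ u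
      rw [f₂ _ (by omega), f₁ _ (by omega), h0 2]
    | 3 =>
      refine fill_tab h₃.size_v h₃.size_one (fun i j k => ?_) _ _ fun u =>
        eval_prioTm h₃.toHasSizes u
      rw [f₃ _ (by omega), f₂ _ (by omega), f₁ _ (by omega), h0 3]
    | a + 4 =>
      rw [f₄ _ (by omega), f₃ _ (by omega), f₂ _ (by omega), f₁ _ (by omega)]
      funext i j k
      exact h0 _ i j k
  · simp only [List.mem_cons, List.not_mem_nil, or_false, not_or] at ha
    rw [hcs, f₄ _ ha.2.2.2, f₃ _ ha.2.2.1, f₂ _ ha.2.1, f₁ _ ha.1]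

theorem phaseTwo_run (h : HasAut A H st) (hs : st 10 1 0 0 = s) (hi : st 10 2 0 0 = H.init)
    (h0 : ∀ a i j k, st (2 * a + 11) i j k = 0) {B : ℕ} (hB : ∀ b, st 4 b 0 0 ≤ B)
    (hv : (n + 1) * ((m + 1) * (2 ^ n * s)) ≤ B) :
    ∃ T st', Run (progAll phaseTwo) st T st' ∧ T ≤ costAll B phaseTwo ∧
      ∀ a, st' (2 * a + 11) = inputGame (emptinessGame A H H.Deterministic)
        (initNode A H (choices_pos H.Deterministic n)) a := by
  obtain ⟨n1, n2, n3, n4⟩ := nodeSizeCmds_spec h hs hi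
  obtain ⟨s1, s2⟩ := setCmds_spec n1
  obtain ⟨g1, g2⟩ := gameCmds_spec s1 fun a i j k => by
    rw [s2 (2 * a + 11) (by omega) (by omega), n4 (2 * a + 11) (by omega), h0]
  have hexec : execAll st phaseTwo =
      execAll (execAll (execAll st nodeSizeCmds) setCmds) gameCmds := by
    rw [phaseTwo, execAll_append, execAll_append]
  have h4 : ∀ b, execAll st phaseTwo 4 b 0 0 = execAll st nodeSizeCmds 4 b 0 0 := fun b => by
    rw [hexec, g2 4 (by decide), s2 4 (by omega) (by omega)]
  have hbd : ∀ b, execAll st phaseTwo 4 b 0 0 ≤ B := by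
    intro b
    by_cases hb : b ∈ sizeTargets phaseTwo
    · have hinit := H.init.2
      have hpos : 0 < 2 ^ n * s := Nat.mul_pos (by positivity) (by omega)
      have e1 : 2 ^ n * s ≤ (m + 1) * (2 ^ n * s) := Nat.le_mul_of_pos_left _ (by omega)
      have e2 : (m + 1) * (2 ^ n * s) ≤ B :=
        (Nat.le_mul_of_pos_left _ (by omega)).trans hv
      have e3 : s ≤ 2 ^ n * s := Nat.le_mul_of_pos_left _ (by positivity)
      have e4 : 2 ^ n ≤ 2 ^ n * s := Nat.le_mul_of_pos_right _ (by omega)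
      have e5 : (2 : ℕ) ^ (A.init : ℕ) ≤ 2 ^ n := Nat.pow_le_pow_right (by omega) A.init.2.le
      have e6 : n + 1 ≤ 2 ^ n := Nat.lt_two_pow_self
      have e7 := choices_le H.Deterministic n
      have e8 := Nat.mul_le_mul_right ((m + 1) * (2 ^ n * s)) e7
      have e9 := (initNode A H (choices_pos H.Deterministic n)).2
      have e10 : TreeEmptiness.bit H.Deterministic ≤ 1 := by
        unfold TreeEmptiness.bit; split_ifs <;> omega
      rw [h4]
      simp only [show sizeTargets phaseTwo = [10, 11, 16, 12, 13, 14, 15, 18, 17] from rfl,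
        List.mem_cons, List.not_mem_nil, or_false] at hb
      rcases hb with rfl | rfl | rfl | rfl | rfl | rfl | rfl | rfl | rfl
      · rw [n1.size_s]; omega
      · rw [n2]; omega
      · rw [n1.size_det]; omega
      · rw [n1.size_Y]; omega
      · rw [n1.size_13]; omega
      · rw [n1.size_14]; omega
      · rw [n1.size_v]; omega
      · rw [n3]; omega
      · rw [n1.size_init_node]; omega
    · rw [execAll_size_of_notMem _ phaseTwo_wf hb]
      exact hB b
  obtain ⟨T, st', hr, hT, hst⟩ := execAll_run (st₁ := st) _ phaseTwo_wf
    (sizesBounded_of_final _ phaseTwo_wf (by decide) hbd) hB fun _ _ => rfl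
  exact ⟨T, st', hr, hT, fun a => by rw [hst (2 * a + 11) (by omega), hexec, g1]⟩

end Program

/-! ### The complete decision procedure and its running time -/

theorem PolyBounded.exists_bound {f : ℕ → ℕ} (hf : PolyBounded f) :
    ∃ c, ∀ N, 1 ≤ N → f (4 * N ^ 2) ≤ c * N ^ c := by
  obtain ⟨K, d, h⟩ := hf
  -- One constant serves both as coefficient and as exponent; enlarging the exponent needs `1 ≤ N`.
  refine ⟨K * 5 ^ d + 2 * d, fun N hN => ?_⟩
  have h1 : 4 * N ^ 2 + 1 ≤ 5 * N ^ 2 := by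
    have := Nat.one_le_pow 2 N hN
    omega
  calc f (4 * N ^ 2) ≤ K * (4 * N ^ 2 + 1) ^ d := h _
    _ ≤ K * (5 * N ^ 2) ^ d := Nat.mul_le_mul_left _ (Nat.pow_le_pow_left h1 d)
    _ = K * 5 ^ d * N ^ (2 * d) := by rw [mul_pow, ← pow_mul, mul_assoc]
    _ ≤ (K * 5 ^ d + 2 * d) * N ^ (K * 5 ^ d + 2 * d) :=
      Nat.mul_le_mul (Nat.le_add_right _ _) (Nat.pow_le_pow_right hN (Nat.le_add_left _ _))

namespace Program

/-- Decide emptiness of a tree automaton, with programs that determinize word automata and solve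
parity games. -/
def decider (determinizer solver : Prog) : Prog :=
  .seq (progAll (sizeCmds ++ trackerCmds)) (.seq (determinizer.rename fun a => 2 * a + 10)
    (.seq (progAll phaseTwo) (.seq (solver.rename fun a => 2 * a + 11)
      (.assign 0 (.const 0) (.const 0) (.const 0)
        (.minus (.const 1) (.get 11 (.const 0) (.const 0) (.const 0)))))))

/-- The summand `10` is the exact cost of the final assignment, which negates the solver's answer.
-/
def overhead (B : ℕ) : ℕ := costAll B (sizeCmds ++ trackerCmds) + costAll B phaseTwo + 10

theorem polyBounded_overhead : PolyBounded overhead :=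
  ((polyBounded_costAll _).add (polyBounded_costAll _)).add (.const 10)

/-- The arrays below `10` belong to the program itself, the even ones from `10` on to the
determinizer and the odd ones from `11` on to the solver. Thus the sizes, the tables of `A` and the
blank solver arrays survive the run of the determinizer. -/
theorem decider_run {m n s : ℕ} {A : APT (Fin m) (Fin n)}
    {H : NPW (Fin (m * ((n + 1) * (n + 1)))) (Fin s)} {determinizer solver : Prog} {t t' B : ℕ}
    {st : Store} (hdet : Run determinizer (inputNPW A.tracker) t st) (hout : OutputsNPW H st)
    (hHD : H.HistoryDeterministic) (hlang : H.language = A.tracker.language)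
    (hsolver : HaltsWithin solver (inputGame (emptinessGame A H H.Deterministic)
      (initNode A H (choices_pos H.Deterministic n))) t'
      (Answers ((emptinessGame A H H.Deterministic).Wins
        (initNode A H (choices_pos H.Deterministic n)))))
    (h3 : 3 ≤ B) (hsq : (n + 1) * (n + 1) ≤ B) (hl : m * ((n + 1) * (n + 1)) ≤ B)
    (hv : (n + 1) * ((m + 1) * (2 ^ n * s)) ≤ B) :
    DecidesEmptinessWithin (decider determinizer solver) A (t + t' + overhead B) := by
  have hs : 0 < s := H.init.pos
  have hpow : 0 < 2 ^ n := by positivity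
  have hle : (m + 1) * (2 ^ n * s) ≤ B := (Nat.le_mul_of_pos_left _ (by omega)).trans hv
  have hm : m + 1 ≤ B := (Nat.le_mul_of_pos_right _ (Nat.mul_pos hpow hs)).trans hle
  have hn : 2 ^ n ≤ B := ((Nat.le_mul_of_pos_right _ hs).trans
    (Nat.le_mul_of_pos_left _ (by omega))).trans hle
  obtain ⟨T₁, st₁, r₁, c₁, a₁, b₁, d₁, e₁, z₁⟩ := phaseOne_run A h3 hm hn hsq hl
  have hf : Function.Injective fun a : ℕ => 2 * a + 10 := fun x y h => by
    simp only at h; omega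
  have hf' : Function.Injective fun a : ℕ => 2 * a + 11 := fun x y h => by
    simp only at h; omega
  obtain ⟨st₂, r₂, i₂, o₂⟩ := hdet.rename hf st₁ d₁
  have h4 : ∀ a, a < 10 → st₂ a = st₁ a := fun a ha => o₂ a (by
    rintro ⟨x, hx⟩; simp only at hx; omega)
  obtain ⟨-, q1, q2, q3, q4⟩ := hout
  have haut : HasAut A H st₂ := by
    refine ⟨a₁.congr (fun a ha => h4 a (by omega)) fun b _ => by rw [h4 4 (by omega)],
      fun p b p' => ?_, fun h b h' => ?_, fun h => ?_⟩
    · rw [h4 6 (by omega), e₁]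
    · rw [← q3, ← i₂ 1]
    · rw [← q4, ← i₂ 2]
  obtain ⟨T₃, st₃, r₃, c₃, g₃⟩ := phaseTwo_run haut (by rw [← q1, ← i₂ 0]) (by rw [← q2, ← i₂ 0])
    (fun a i j k => by
      rw [o₂ (2 * a + 11) (by rintro ⟨x, hx⟩; simp only at hx; omega), z₁])
    (fun b => by rw [h4 4 (by omega)]; exact b₁ b) hv
  obtain ⟨T, st', hT, hrun, hans⟩ := hsolver
  obtain ⟨st₄, r₄, i₄, -⟩ := hrun.rename hf' st₃ g₃
  have r₅ := Run.assign 0 (.const 0) (.const 0) (.const 0)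
    (.minus (.const 1) (.get 11 (.const 0) (.const 0) (.const 0))) st₄
  refine ⟨_, _, ?_, .seq r₁ (.seq r₂ (.seq r₃ (.seq r₄ r₅))), ?_⟩
  · simp only [Expr.cost, overhead]
    omega
  · have h11 : st₄ 11 0 0 0 = bit A.IsNonempty := by
      rw [show st₄ 11 = st' 0 from i₄ 0, hans]
      exact bit_congr (wins_emptinessGame_iff A H hHD hlang id)
    simp only [Answers, Expr.eval, Store.write_same, h11]
    unfold bit
    split_ifs <;> rfl

end Program

end TreeEmptiness

theorem mainTheorem4
    (determinizer : Prog) (S_HD R_HD : ℕ → ℕ → ℕ) (detTime : ℕ → ℕ → ℕ → ℕ)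
    (hdet : HistoryDeterminizes determinizer S_HD R_HD detTime)
    (solver : Prog) (parityTime : ℕ → ℕ → ℕ)
    (hsolver : SolvesParityGames solver parityTime) :
    ∃ (decider : Prog) (c : ℕ), ∀ (m n : ℕ) (A : APT (Fin m) (Fin n)),
      ∃ l ≤ m * (n + 1) ^ 2,
        DecidesEmptinessWithin decider A
          (detTime l n A.rank
            + parityTime ((n + 1) * ((m + 1) * 2 ^ n * S_HD n A.rank)) (R_HD n A.rank)
            + c * ((m + 1) * 2 ^ n * S_HD n A.rank) ^ c) ∧
        (OutputsDeterministic determinizer →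
          DecidesEmptinessWithin decider A
            (detTime l n A.rank
              + parityTime ((m + 1) * 2 ^ n * S_HD n A.rank) (R_HD n A.rank)
              + c * ((m + 1) * 2 ^ n * S_HD n A.rank) ^ c)) := by
  obtain ⟨c, hc⟩ := Program.polyBounded_overhead.exists_bound
  refine ⟨Program.decider determinizer solver, c, fun m n A => ⟨m * ((n + 1) * (n + 1)),
    by rw [sq], ?_⟩⟩
  obtain ⟨t, st, ht, hrun, s, H, hout, hHD, hlang, hs, hrank⟩ := hdet _ _ A.tracker
  rw [A.rank_tracker] at ht hs hrank
  have hs0 : 0 < s := H.init.pos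
  have hvN : (m + 1) * (2 ^ n * s) ≤ (m + 1) * 2 ^ n * S_HD n A.rank := by
    rw [← mul_assoc]
    exact Nat.mul_le_mul_left _ hs
  have hpow : 0 < 2 ^ n := by positivity
  have hn1 : n + 1 ≤ 2 ^ n := Nat.lt_two_pow_self
  have hmN : (m + 1) * 2 ^ n ≤ (m + 1) * 2 ^ n * S_HD n A.rank :=
    Nat.le_mul_of_pos_right _ (by omega)
  generalize (m + 1) * 2 ^ n * S_HD n A.rank = N at hvN hmN ⊢
  have hm : m + 1 ≤ N := (Nat.le_mul_of_pos_right _ hpow).trans hmN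
  have hn : 2 ^ n ≤ N := (Nat.le_mul_of_pos_left _ (by omega)).trans hmN
  have hN1 : 1 ≤ N := by omega
  -- The two claims differ only in the number of nodes granted to the solver.
  have key : ∀ v, choices H.Deterministic n * ((m + 1) * (2 ^ n * s)) ≤ v →
      DecidesEmptinessWithin (Program.decider determinizer solver) A
        (detTime (m * ((n + 1) * (n + 1))) n A.rank + parityTime v (R_HD n A.rank) + c * N ^ c) := by
    intro v hv
    have h2 : N * N = N ^ 2 := (sq N).symm
    have h1 : 1 ≤ N ^ 2 := Nat.one_le_pow _ _ hN1
    have hsq : (n + 1) * (n + 1) ≤ 2 ^ n * 2 ^ n := Nat.mul_le_mul hn1 hn1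
    -- All loop lengths are at most `4 * N ^ 2`: the products occurring are bounded by `N * N`
    -- because `n + 1 ≤ 2 ^ n ≤ N`, and the factor `4` covers the constant `3`.
    obtain ⟨T, st', hT, hr, hp⟩ := Program.decider_run (B := 4 * N ^ 2) hrun hout hHD hlang
      (hsolver v (R_HD n A.rank) _ _ _ hv ((rank_emptinessGame_le A H _).trans hrank))
      (by omega) (by have := Nat.mul_le_mul hn hn; omega)
      (by
        have := Nat.mul_le_mul_left m hsq
        have := Nat.mul_le_mul hmN hn
        have : m * (2 ^ n * 2 ^ n) ≤ (m + 1) * 2 ^ n * 2 ^ n := by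
          rw [← mul_assoc]
          exact Nat.mul_le_mul_right _ (Nat.mul_le_mul_right _ (by omega))
        omega)
      (by have := Nat.mul_le_mul (hn1.trans hn) hvN; omega)
    exact ⟨T, st', hT.trans (Nat.add_le_add (Nat.add_le_add_right ht _) (hc N hN1)), hr, hp⟩
  refine ⟨key _ (Nat.mul_le_mul (choices_le _ _) hvN), fun hdet' => key _ ?_⟩
  -- Deterministic outputs lead to the merged game, where the last component has a single value.
  have hd : H.Deterministic := hdet' _ _ _ _ _ hrun _ _ hout
  have : choices H.Deterministic n = 1 := by simp [choices, hd]
  rw [this, one_mul]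
  exact hvN
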